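/- Let $q,t\in\mathbb C$ with $|q|<1$ and let ${\bf c}=(c_1,c_2,\dots)$ be a sequence of complex numbers with $\sum_i|c_i|<\infty$. Write $(u;q)_\infty=\prod_{k\ge0}(1-uq^k)$, and define the quantum weight generating function, as a formal power series in $z$ (infinite products being taken coefficientwise), by $$M(q,t,{\bf c},z)=\prod_{i\ge1}\frac{(tzc_i;q)_\infty}{(zc_i;q)_\infty}.$$ For a partition $\mu$ with $m_i(\mu)$ parts equal to $i$ put $z_\mu=\prod_i i^{m_i(\mu)}m_i(\mu)!$, and let $p_\mu({\bf c})=\prod_j\sum_i c_i^{\mu_j}$. Define $$g_j({\bf c},q,t)=\sum_{|\mu|=j}\frac1{z_\mu}\Big(\prod_{i=1}^{\ell(\mu)}\frac{1-t^{\mu_i}}{1-q^{\mu_i}}\Big)p_\mu({\bf c}),\qquad g_\lambda({\bf c},q,t)=\prod_{i=1}^{\ell(\lambda)} g_{\lambda_i}({\bf c},q,t).$$ In the flow variables ${\bf t}=(t_1,t_2,\dots)$ put $p_j({\bf t})=jt_j$, $p_\mu({\bf t})=\prod_i p_{\mu_i}({\bf t})$, $h_k({\bf t})=\sum_{|\mu|=k}z_\mu^{-1}p_\mu({\bf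 t})$ (and $h_k=0$ for $k<0$), and let $s_\lambda({\bf t})=\det\big(h_{\lambda_i-i+j}({\bf t})\big)_{1\le i,j\le\ell(\lambda)}$ be the Schur function; likewise in ${\bf s}=(s_1,s_2,\dots)$. Let $\tau^{M(q,t,{\bf c},z)}({\bf t},{\bf s})$ be the formal power series in ${\bf t},{\bf s}$ with coefficients in $\mathbb C[[z]]$ $$\tau^{M(q,t,{\bf c},z)}({\bf t},{\bf s})=\sum_\lambda r_\lambda\, s_\lambda({\bf t})s_\lambda({\bf s}),\qquad r_\lambda=\prod_{(i,j)\in\lambda}M(q,t,{\bf c},z(j-i)),$$ where the sum is over all partitions $\lambda$ and the product over the boxes of the Young diagram of $\lambda$ (row $i$, column $j$). This is the 2D Toda $\tau$-function of hypergeometric type at $N=0$. For partitions $\mu,\nu$ of $n$ let $\mathrm{cyc}(\mu)\subset S_n$ be the class of permutations of cycle type $\mu$. A $d$-step path from $\mathrm{cyc}(\nu)$ to $\mathrm{cyc}(\mu)$ in the Cayley graph of $S_n$ generated by transpositions consists of an element $h\in\mathrm{cyc}(\nu)$ and transpositions $(a_1b_1),\dots,(a_db_d)$, with $a_k<b_k$,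 such that $(a_1b_1)\cdots(a_db_d)h\in\mathrm{cyc}(\mu)$. Its signature is the partition of $d$ whose parts are the nonzero numbers of times that each $b\in\{1,\dots,n\}$ occurs among $b_1,\dots,b_d$. For $|\lambda|=d$ let $\tilde m^\lambda_{\mu\nu}$ be the number of such paths of signature $\lambda$, let $m^\lambda_{\mu\nu}=\frac{\prod_i\lambda_i!}{d!}\,\tilde m^\lambda_{\mu\nu}$, and define the combinatorial quantum Hurwitz numbers $$F^d_{M(q,t,{\bf c})}(\mu,\nu)=\frac1{n!}\sum_{|\lambda|=d}g_\lambda({\bf c},q,t)\,m^\lambda_{\mu\nu}.$$ Then the products and the sum defining $M(q,t,{\bf c},z)$ and $\tau^{M(q,t,{\bf c},z)}$ converge coefficientwise, $M(q,t,{\bf c},z)=\sum_{j\ge0}g_j({\bf c},q,t)z^j$, and $$\tau^{M(q,t,{\bf c},z)}({\bf t},{\bf s})=\sum_{d=0}^\infty\ \sum_{\substack{\mu,\nu\\|\mu|=|\nu|}}z^d\,F^d_{M(q,t,{\bf c})}(\mu,\nu)\,p_\mu({\bf t})\,p_\nu({\bf s}).$$ -/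

import Mathlib

open scoped PowerSeries PowerSeries.WithPiTopology MvPowerSeries.WithPiTopology

noncomputable section

namespace QuantumHurwitz

/-! ### Partitions and the normalization factor `z_μ` -/

/-- `z_μ = ∏ i, i ^ m_i(μ) * m_i(μ)!`, where `m_i(μ)` is the number of parts of `μ` equal to `i`. -/
def zFactor {n : ℕ} (μ : n.Partition) : ℕ :=
  ∏ i ∈ μ.parts.toFinset, i ^ μ.parts.count i * (μ.parts.count i).factorial

/-! ### The quantum weight generating function, as a formal power series in `z` over `ℂ`

Infinite products and sums of power series are taken coefficientwise. -/

/-- The infinite quantum Pochhammer symbol `(a z; q)_∞ = ∏_{k ≥ 0} (1 - a z q ^ k)`,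
as a power series in `z`. -/
def qPochhammer (q a : ℂ) : ℂ⟦X⟧ :=
  ∏' k : ℕ, (1 - PowerSeries.C (a * q ^ k) * PowerSeries.X)

/-- `M(q, t, z a) = (t z a; q)_∞ / (z a; q)_∞`, as a power series in `z`. -/
def quantumFactor (q t a : ℂ) : ℂ⟦X⟧ :=
  qPochhammer q (t * a) * (qPochhammer q a)⁻¹

/-- The quantum weight generating function `M(q, t, c, z) = ∏_i M(q, t, z c_i)`,
as a power series in `z`. -/
def weightSeries (q t : ℂ) (c : ℕ → ℂ) : ℂ⟦X⟧ :=
  ∏' i : ℕ, quantumFactor q t (c i)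

/-- The content product `r_λ = ∏_{(i, j) ∈ λ} M(q, t, c, z (j - i))`, as a power series in `z`. -/
def contentProduct (q t : ℂ) (c : ℕ → ℂ) (lam : YoungDiagram) : ℂ⟦X⟧ :=
  ∏ x ∈ lam.cells, PowerSeries.rescale ((x.2 : ℂ) - (x.1 : ℂ)) (weightSeries q t c)

/-! ### The symmetric functions `g_λ(c, q, t)` -/

/-- The power sum `p_j(c) = ∑_i c_i ^ j`. -/
def powerSumConst (c : ℕ → ℂ) (j : ℕ) : ℂ := ∑' i : ℕ, c i ^ j

/-- `g_j(c, q, t) = ∑_{|μ| = j} z_μ(q, t)⁻¹ p_μ(c)`, where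
`z_μ(q, t) = z_μ ∏_i (1 - q ^ μ_i) / (1 - t ^ μ_i)`, so that
`z_μ(q, t)⁻¹ = z_μ⁻¹ ∏_i (1 - t ^ μ_i) / (1 - q ^ μ_i)`. -/
def gOne (q t : ℂ) (c : ℕ → ℂ) (j : ℕ) : ℂ :=
  ∑ μ : j.Partition, (zFactor μ : ℂ)⁻¹ *
    (μ.parts.map fun i => (1 - t ^ i) / (1 - q ^ i)).prod *
    (μ.parts.map fun i => powerSumConst c i).prod

/-- `g_λ(c, q, t) = ∏_i g_{λ_i}(c, q, t)`. -/
def gPart (q t : ℂ) (c : ℕ → ℂ) {d : ℕ} (lam : d.Partition) : ℂ :=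
  (lam.parts.map fun j => gOne q t c j).prod

/-! ### Paths in the Cayley graph of `S_n` generated by transpositions -/

/-- The conjugacy class `cyc(μ)` of the permutations whose cycle lengths
(fixed points included) are the parts of `μ`. -/
def cyc {n : ℕ} (μ : n.Partition) : Set (Equiv.Perm (Fin n)) :=
  {h | h.partition.parts = μ.parts}

/-- A `d`-step path in the Cayley graph of `S_n` generated by the transpositions `(a b)`, `a < b`:
a starting point `h` and transpositions `(a_1 b_1), …, (a_d b_d)`. -/
structure CayleyPath (n d : ℕ) where
  /-- the starting point `h` -/
  start : Equiv.Perm (Fin n)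
  /-- the smaller elements `a_k` -/
  fst : Fin d → Fin n
  /-- the larger elements `b_k` -/
  snd : Fin d → Fin n
  fst_lt_snd : ∀ k, fst k < snd k

/-- The end point `(a_1 b_1) ⋯ (a_d b_d) h` of a path. -/
def CayleyPath.finish {n d : ℕ} (P : CayleyPath n d) : Equiv.Perm (Fin n) :=
  (List.ofFn fun k => Equiv.swap (P.fst k) (P.snd k)).prod * P.start

/-- `P` has signature `λ`: the parts of `λ` are the nonzero numbers of times that the
elements `b` appear as the second element among the transpositions of `P`. -/
def CayleyPath.HasSignature {n d : ℕ} (P : CayleyPath n d) (lam : d.Partition) : Prop :=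
  ((Finset.univ : Finset (Fin n)).val.map fun b => Nat.card {k : Fin d // P.snd k = b}).filter
    (fun m => m ≠ 0) = lam.parts

/-- The number of `d`-step paths of signature `λ` from `cyc(ν)` to `cyc(μ)`. -/
def pathCount {n d : ℕ} (lam : d.Partition) (μ ν : n.Partition) : ℕ :=
  Nat.card {P : CayleyPath n d // P.start ∈ cyc ν ∧ P.finish ∈ cyc μ ∧ P.HasSignature lam}

/-- `m^λ_{μν}`, determined by: `|λ|! / ∏_i λ_i! * m^λ_{μν}` is the number of paths of
signature `λ` from `cyc(ν)` to `cyc(μ)`. -/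
def mCoeff {n d : ℕ} (lam : d.Partition) (μ ν : n.Partition) : ℂ :=
  ((lam.parts.map fun i => (i.factorial : ℂ)).prod / (d.factorial : ℂ)) * (pathCount lam μ ν : ℂ)

/-- The combinatorial quantum Hurwitz number
`F^d_{M(q,t,c)}(μ, ν) = (1 / n!) ∑_{|λ| = d} g_λ(c, q, t) m^λ_{μν}`. -/
def hurwitzF (q t : ℂ) (c : ℕ → ℂ) (d : ℕ) {n : ℕ} (μ ν : n.Partition) : ℂ :=
  (n.factorial : ℂ)⁻¹ * ∑ lam : d.Partition, gPart q t c lam * mCoeff lam μ ν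

/-! ### Schur functions of the flow variables and the τ-function

A sequence `u : ℕ → A` stands for the flow variables `(t_1, t_2, …)` with `t_{k+1} = u k`. -/

section Flow

variable {A : Type*} [CommRing A] [Algebra ℂ A]

/-- The power sum `p_j = j t_j`. -/
def powerSum (u : ℕ → A) (j : ℕ) : A := (j : A) * u (j - 1)

/-- `p_μ = ∏_i p_{μ_i}`. -/
def powerSumPart (u : ℕ → A) {n : ℕ} (μ : n.Partition) : A :=
  (μ.parts.map fun j => powerSum u j).prod

/-- The complete symmetric function `h_k = ∑_{|μ| = k} z_μ⁻¹ p_μ`, which is the coefficient of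
`x ^ k` in `exp (∑_i t_i x ^ i)`; it vanishes for `k < 0`. -/
def complete (u : ℕ → A) (k : ℤ) : A :=
  if 0 ≤ k then
    ∑ μ : k.toNat.Partition, algebraMap ℂ A (zFactor μ : ℂ)⁻¹ * powerSumPart u μ
  else 0

/-- The Schur function `s_λ = det (h_{λ_i - i + j})`, `1 ≤ i, j ≤ ℓ(λ)`
(`lam.colLen 0` is the number `ℓ(λ)` of rows, `lam.rowLen i` the length of row `i`). -/
def schur (u : ℕ → A) (lam : YoungDiagram) : A :=
  Matrix.det (Matrix.of fun i j : Fin (lam.colLen 0) =>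
    complete u ((lam.rowLen i : ℤ) - (i : ℤ) + (j : ℤ)))

end Flow

/-- Formal power series in the two sequences `t_1, t_2, …` and `s_1, s_2, …`
with coefficients in `ℂ⟦z⟧`. -/
abbrev TodaSeries : Type := MvPowerSeries (ℕ ⊕ ℕ) ℂ⟦X⟧

/-- The flow variables `t_{k+1}`. -/
def tVar (k : ℕ) : TodaSeries := MvPowerSeries.X (Sum.inl k)

/-- The flow variables `s_{k+1}`. -/
def sVar (k : ℕ) : TodaSeries := MvPowerSeries.X (Sum.inr k)

/-- The term `r_λ s_λ(t) s_λ(s)` of the τ-function. -/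
def tauTerm (q t : ℂ) (c : ℕ → ℂ) (lam : YoungDiagram) : TodaSeries :=
  MvPowerSeries.C (contentProduct q t c lam) * schur tVar lam * schur sVar lam

/-- The 2D Toda τ-function `∑_λ r_λ s_λ(t) s_λ(s)` at `N = 0`; the sum over all partitions
is taken coefficientwise. -/
def tau (q t : ℂ) (c : ℕ → ℂ) : TodaSeries := ∑' lam : YoungDiagram, tauTerm q t c lam

/-- The term `z ^ d F^d(μ, ν) p_μ(t) p_ν(s)`, with `|μ| = |ν| = n`. -/
def hurwitzTerm (q t : ℂ) (c : ℕ → ℂ) (d : ℕ) {n : ℕ} (μ ν : n.Partition) : TodaSeries :=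
  MvPowerSeries.C (PowerSeries.C (hurwitzF q t c d μ ν) * PowerSeries.X ^ d) *
    powerSumPart tVar μ * powerSumPart sVar ν

end QuantumHurwitz

end

/-!
The statement about `M` is the identity of power sums and complete functions. The series
`hSeries p = ∑_n h_n X ^ n = exp (∑_{j ≥ 1} p_j X ^ j / j)` turns sums of sequences `p` into
products (`hSeries_add`), also infinite ones (`hasProd_hSeries`), and `1 - b X` is the series of the
sequence `-b ^ j`. Summing a geometric series in `q` and then the `c_i ^ j` over `i` identifies `M`
with the series of `(1 - t ^ j) / (1 - q ^ j) * ∑_i c_i ^ j`, whose coefficients are the `g_j`.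

For `τ`, the starting point is the Cauchy identity
`∑_{|λ| = n} s_λ(t) s_λ(s) = (1 / n!) ∑_{h ∈ S_n} p_{cyc h}(t) p_{cyc h}(s)` (`cauchy_identity`).
Its right side lies in the image of the characteristic map `charMap`, which sends a permutation to
the power sum of its cycle type. A central element `z` of `ℂ[S_n]` acts on this image by
`charMap y ↦ charMap (z y)` (`exists_linearMap_charMap_mul`). The central element in question is
`∑_{|e| = d} ∏_b g_{e_b} J_b ^ e_b`, the value of `weightPoly` at the Jucys-Murphy elements
`J_b = ∑_{a < b} (a b)`; it is central because `weightPoly` is symmetric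
(`evalJM_commute_of_isSymmetric`). Expanding the powers of the `J_b` into transpositions, it acts
on the right side of the Cauchy identity by a count of weighted paths (`sum_hurwitzF`). On the left
side it acts on `s_λ` by the coefficient of `z ^ d` in `∏_{(i, j) ∈ λ} M(z (j - i))`, because the
Jucys-Murphy elements act by the contents of the boxes. The result is `weighted_cauchy_identity`, a
statement about finite sums, and `τ` is the sum of these over `n` and `d`, which converges
coefficientwise as each monomial in `t` occurs for one `n` only (`hasSum_tauTerm`,
`hasSum_hurwitzTerm`).

The action of the Jucys-Murphy elements is found without representation theory. The Young
symmetrizers of all colourings of `{1, …, n}` form a generating polynomial `colourSum`, and the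
Schur functions are coefficients of its product with the Vandermonde polynomial. A computation with
Euler operators shows that the sum of all transpositions multiplies such a coefficient by the sum
of the contents (`vanPoly_mul_colourSum_twiceTranspositions`,
`exists_linearMap_twiceTranspositions`).
The last Jucys-Murphy element is the difference of the sums of transpositions of `S_{n+1}` and of
`S_n`, so together with Pieri's rule it weights the addition of a box by the content of that box
(`polyCharMap_mul_jucysMurphy_pow`). The contents of the addable boxes are distinct, so Lagrange
interpolation singles out one of them, and every Schur function is the image of a common
eigenvector of the Jucys-Murphy elements (`exists_content_eigenvector`).

The Cauchy identity is proved by derivations of the flow variables: a polynomial killed by `∂/∂t_1`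
and by `∑_m m t_m ∂/∂t_{m+1}` does not depend on `t` (`eq_zero_of_pderiv_of_lowerT`), and both
operators act on Jacobi-Trudi determinants by removing boxes.
-/

noncomputable section

namespace QuantumHurwitz

/-! ### Partition sums and Newton's identities -/

section Newton

variable {A : Type*} [CommRing A] [Algebra ℂ A]

/-- The polynomial `∑_{|μ| = n} z_μ⁻¹ ∏_i p_{μ_i}` in an arbitrary sequence `p`. Both `complete`
and `gOne` are of this form. -/
def hSum (p : ℕ → A) (n : ℕ) : A :=
  ∑ μ : n.Partition, algebraMap ℂ A (zFactor μ : ℂ)⁻¹ * (μ.parts.map p).prod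

/-- The generating function `∑_n h_n X ^ n = exp (∑_{j ≥ 1} p_j X ^ j / j)`. -/
def hSeries (p : ℕ → A) : A⟦X⟧ := PowerSeries.mk (hSum p)

theorem prod_toFinset_pow_mul_factorial_cons (a : ℕ) (m : Multiset ℕ) :
    ∏ i ∈ (a ::ₘ m).toFinset, i ^ (a ::ₘ m).count i * ((a ::ₘ m).count i).factorial =
      a * (m.count a + 1) * ∏ i ∈ m.toFinset, i ^ m.count i * (m.count i).factorial := by
  have h1 : ∏ i ∈ m.toFinset, i ^ m.count i * (m.count i).factorial =
      ∏ i ∈ insert a m.toFinset, i ^ m.count i * (m.count i).factorial := by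
    refine Finset.prod_subset (Finset.subset_insert _ _) fun x _ hx => ?_
    simp [Multiset.count_eq_zero_of_notMem (fun h => hx (Multiset.mem_toFinset.2 h))]
  rw [h1, Multiset.toFinset_cons,
    ← Finset.mul_prod_erase _ _ (Finset.mem_insert_self a m.toFinset),
    ← Finset.mul_prod_erase _ (fun i => i ^ m.count i * (m.count i).factorial)
      (Finset.mem_insert_self a m.toFinset), ← mul_assoc]
  congr 1
  · rw [Multiset.count_cons_self, Nat.factorial_succ, pow_succ]
    ring
  · refine Finset.prod_congr rfl fun x hx => ?_
    rw [Multiset.count_cons_of_ne (Finset.ne_of_mem_erase hx)]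

theorem zFactor_ne_zero {n : ℕ} (μ : n.Partition) : zFactor μ ≠ 0 := by
  refine Finset.prod_ne_zero_iff.2 fun i hi => ?_
  have := μ.parts_pos (Multiset.mem_toFinset.1 hi)
  positivity

theorem sum_range_succ_mul_count {n : ℕ} (μ : (n + 1).Partition) :
    ∑ i ∈ Finset.range (n + 1), (i + 1) * μ.parts.count (i + 1) = n + 1 := by
  conv_rhs => rw [← μ.parts_sum]
  rw [Finset.sum_multiset_count_of_subset μ.parts ((Finset.range (n + 2)))]
  · rw [Finset.sum_range_succ' _ (n + 1)]
    simp [mul_comm]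
  · intro i hi
    have := μ.le_of_mem_parts (Multiset.mem_toFinset.1 hi)
    simp; omega

/-- Newton's identity: the generating function satisfies `H' = (∑_i p_{i+1} X ^ i) H`. -/
theorem derivative_hSeries (p : ℕ → A) :
    PowerSeries.derivative (R := A) (hSeries p) =
      PowerSeries.mk (fun i => p (i + 1)) * hSeries p := by
  ext n
  rw [PowerSeries.coeff_derivative, PowerSeries.coeff_mul,
    Finset.Nat.sum_antidiagonal_eq_sum_range_succ_mk]
  simp only [hSeries, PowerSeries.coeff_mk]
  have key : ∀ i ∈ Finset.range (n + 1), ∑ μ : (n + 1).Partition,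
      (((i + 1) * μ.parts.count (i + 1) : ℕ) : A) *
        (algebraMap ℂ A (zFactor μ : ℂ)⁻¹ * (μ.parts.map p).prod) =
      p (i + 1) * hSum p (n - i) := by
    intro i hi
    have hi' : i + 1 ≤ n + 1 := by simpa [Nat.lt_succ_iff] using hi
    have hsub : n - i = n + 1 - (i + 1) := by omega
    rw [← Finset.sum_filter_of_ne (p := fun μ : (n + 1).Partition => i + 1 ∈ μ.parts),
      Finset.sum_subtype (p := fun μ : (n + 1).Partition => i + 1 ∈ μ.parts) _ (by simp),
      hsub, hSum, Finset.mul_sum]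
    · refine Fintype.sum_equiv (Nat.Partition.partitionWithPartEquiv (Nat.succ_pos i) hi') _ _
        fun x => ?_
      obtain ⟨ν, rfl⟩ :=
        (Nat.Partition.partitionWithPartEquiv (Nat.succ_pos i) hi').symm.surjective x
      rw [Equiv.apply_symm_apply]
      have hz : ((zFactor ((Nat.Partition.partitionWithPartEquiv
          (Nat.succ_pos i) hi').symm ν).1 : ℕ) : ℂ) =
          (i + 1 : ℕ) * (ν.parts.count (i + 1) + 1) * zFactor ν := by
        rw [zFactor, Nat.Partition.partitionWithPartEquiv_symm_apply_parts,
          prod_toFinset_pow_mul_factorial_cons, zFactor]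
        push_cast; ring
      rw [hz, Nat.Partition.partitionWithPartEquiv_symm_apply_parts, Multiset.map_cons,
        Multiset.prod_cons, Multiset.count_cons_self, ← map_natCast (algebraMap ℂ A),
        mul_left_comm (p (i + 1)), ← mul_assoc, ← map_mul]
      congr 2
      have h1 : ((i + 1 : ℕ) : ℂ) ≠ 0 := Nat.cast_ne_zero.2 (Nat.succ_ne_zero i)
      have h2 : ((ν.parts.count (i + 1) : ℂ) + 1) ≠ 0 := by
        exact_mod_cast Nat.succ_ne_zero (ν.parts.count (i + 1))
      have h3 : (zFactor ν : ℂ) ≠ 0 := Nat.cast_ne_zero.2 (zFactor_ne_zero ν)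
      push_cast at h1 ⊢
      field_simp
    · intro μ _ hne
      by_contra hmem
      exact hne (by simp [Multiset.count_eq_zero_of_notMem hmem])
  rw [← Finset.sum_congr rfl key, Finset.sum_comm, hSum, Finset.sum_mul]
  refine Finset.sum_congr rfl fun μ _ => ?_
  rw [← Finset.sum_mul, mul_comm, ← Nat.cast_sum, sum_range_succ_mul_count]
  push_cast; ring

theorem hSum_zero (p : ℕ → A) : hSum p 0 = 1 := by
  simp [hSum, zFactor]

theorem constantCoeff_hSeries (p : ℕ → A) : PowerSeries.constantCoeff (hSeries p) = 1 := by
  simp [hSeries, hSum_zero]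

/-- Newton's identity, coefficientwise. -/
theorem natCast_mul_hSum_succ (p : ℕ → A) (n : ℕ) :
    ((n + 1 : ℕ) : A) * hSum p (n + 1) =
      ∑ i ∈ Finset.range (n + 1), p (i + 1) * hSum p (n - i) := by
  have := congrArg (PowerSeries.coeff n) (derivative_hSeries p)
  rw [PowerSeries.coeff_derivative, PowerSeries.coeff_mul,
    Finset.Nat.sum_antidiagonal_eq_sum_range_succ_mk] at this
  simp only [hSeries, PowerSeries.coeff_mk] at this
  rw [← this]; push_cast; rw [mul_comm]

theorem natCast_succ_isUnit (n : ℕ) : IsUnit ((n + 1 : ℕ) : A) := by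
  rw [← map_natCast (algebraMap ℂ A)]
  exact (IsUnit.mk0 _ (Nat.cast_ne_zero.2 (Nat.succ_ne_zero n))).map _

/-- A power series is determined by its constant term and its logarithmic derivative. -/
theorem eq_of_derivative_eq_mul {f g G : A⟦X⟧}
    (h0 : PowerSeries.constantCoeff f = PowerSeries.constantCoeff g)
    (hf : PowerSeries.derivative (R := A) f = G * f)
    (hg : PowerSeries.derivative (R := A) g = G * g) : f = g := by
  ext n
  induction n using Nat.strong_induction_on with
  | _ n ih =>
    cases n with
    | zero => simpa using h0
    | succ n =>
      have h1 := congrArg (PowerSeries.coeff n) hf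
      have h2 := congrArg (PowerSeries.coeff n) hg
      rw [PowerSeries.coeff_derivative, PowerSeries.coeff_mul] at h1 h2
      rw [Finset.sum_congr rfl fun x hx => by
        rw [ih x.2 (by have := Finset.HasAntidiagonal.mem_antidiagonal.1 hx; omega)], ← h2] at h1
      have hu := natCast_succ_isUnit (A := A) n
      push_cast at hu
      exact hu.mul_right_cancel h1

theorem hSeries_add (p p' : ℕ → A) : hSeries (p + p') = hSeries p * hSeries p' := by
  refine eq_of_derivative_eq_mul (G := PowerSeries.mk fun i => (p + p') (i + 1)) ?_
    (derivative_hSeries _) ?_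
  · simp [constantCoeff_hSeries]
  · rw [Derivation.leibniz, derivative_hSeries, derivative_hSeries, smul_eq_mul, smul_eq_mul]
    have : (PowerSeries.mk fun i => (p + p') (i + 1)) =
      (PowerSeries.mk fun i => p (i + 1)) + PowerSeries.mk fun i => p' (i + 1) := by
      ext; simp
    rw [this]; ring

theorem hSeries_zero : hSeries (0 : ℕ → A) = 1 := by
  refine eq_of_derivative_eq_mul (G := 0) (by simp [constantCoeff_hSeries]) ?_ (by simp)
  rw [derivative_hSeries]
  congr 1

theorem hSeries_sum {ι : Type*} (s : Finset ι) (p : ι → ℕ → A) :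
    hSeries (∑ i ∈ s, p i) = ∏ i ∈ s, hSeries (p i) := by
  classical
  induction s using Finset.induction_on with
  | empty => simp [hSeries_zero]
  | insert a s ha ih => rw [Finset.sum_insert ha, Finset.prod_insert ha, hSeries_add, ih]

/-- `exp (-∑_j b ^ j X ^ j / j) = 1 - b X`. -/
theorem hSeries_neg_pow (b : A) :
    hSeries (fun j => -b ^ j) = 1 - PowerSeries.C b * PowerSeries.X := by
  refine eq_of_derivative_eq_mul (G := PowerSeries.mk fun i => -b ^ (i + 1))
    (by simp [constantCoeff_hSeries]) (derivative_hSeries _) ?_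
  have : (PowerSeries.mk fun i => -b ^ (i + 1)) * (1 - PowerSeries.C b * PowerSeries.X) =
      -PowerSeries.C b := by
    rw [mul_sub, mul_one]
    ext n
    cases n with
    | zero => simp [← mul_assoc]
    | succ n =>
      rw [map_sub, ← mul_assoc, PowerSeries.coeff_succ_mul_X, PowerSeries.coeff_mul_C]
      simp [pow_succ]
  rw [this]
  simp

/-- Rescaling `p_j` by `b ^ j` rescales `h_n` by `b ^ n`. -/
theorem hSum_mul_pow (p : ℕ → A) (b : A) (n : ℕ) :
    hSum (fun j => p j * b ^ j) n = hSum p n * b ^ n := by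
  simp only [hSum, Finset.sum_mul, mul_assoc]
  refine Finset.sum_congr rfl fun μ _ => ?_
  rw [Multiset.prod_map_mul, mul_comm ((μ.parts.map p).prod)]
  congr 1
  rw [mul_comm]; congr 1
  conv_rhs => rw [← μ.parts_sum]
  induction μ.parts using Multiset.induction_on with
  | empty => simp
  | cons a m ih => simp [pow_add, ih]

theorem hSum_congr {p p' : ℕ → A} (h : ∀ j, 0 < j → p j = p' j) (n : ℕ) :
    hSum p n = hSum p' n := by
  refine Finset.sum_congr rfl fun μ _ => ?_
  rw [Multiset.map_congr rfl fun j hj => h j (μ.parts_pos hj)]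

theorem map_hSum {B : Type*} [CommRing B] [Algebra ℂ B] (f : A →ₐ[ℂ] B) (p : ℕ → A) (n : ℕ) :
    f (hSum p n) = hSum (fun j => f (p j)) n := by
  simp [hSum, map_multiset_prod, Multiset.map_map]

theorem complete_natCast (u : ℕ → A) (n : ℕ) : complete u n = hSum (powerSum u) n := by
  simp [complete, hSum, powerSumPart]

theorem complete_of_neg (u : ℕ → A) {k : ℤ} (hk : k < 0) : complete u k = 0 := by
  simp [complete, hk]

/-- A derivation `D` acts on the `h_n` through the logarithmic derivative
`∑_j (D p_j / j) X ^ j` of the generating function; here `D p_j = j * r_j`. -/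
theorem derivation_hSum (D : Derivation ℂ A A) (p r : ℕ → A)
    (hr : ∀ j : ℕ, D (p (j + 1)) = ((j + 1 : ℕ) : A) * r j) (n : ℕ) :
    D (hSum p (n + 1)) = ∑ i ∈ Finset.range (n + 1), r i * hSum p (n - i) := by
  set H := hSeries p
  set P : A⟦X⟧ := PowerSeries.mk fun i => p (i + 1)
  set R : A⟦X⟧ := PowerSeries.mk r
  set f : A⟦X⟧ := PowerSeries.mk fun n => D (hSum p n)
  have hH : PowerSeries.derivative (R := A) H = P * H := derivative_hSeries p
  have hXR : PowerSeries.derivative (R := A) (PowerSeries.X * R) =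
      PowerSeries.mk fun i => D (p (i + 1)) := by
    ext i
    rw [PowerSeries.coeff_derivative, PowerSeries.coeff_succ_X_mul, PowerSeries.coeff_mk,
      PowerSeries.coeff_mk, hr, mul_comm]
    push_cast; rfl
  have hf : PowerSeries.derivative (R := A) f =
      (PowerSeries.mk fun i => D (p (i + 1))) * H + P * f := by
    ext i
    rw [PowerSeries.coeff_derivative, map_add, PowerSeries.coeff_mul, PowerSeries.coeff_mul,
      ← Finset.sum_add_distrib]
    have h1 := congrArg (fun x => D (PowerSeries.coeff i x)) hH
    simp only [PowerSeries.coeff_derivative, PowerSeries.coeff_mul, map_sum,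
      Derivation.leibniz, H, P, hSeries, PowerSeries.coeff_mk, smul_eq_mul] at h1
    simp only [H, P, f, hSeries, PowerSeries.coeff_mk]
    have h2 : D ((i : A) + 1) = 0 := by simp
    rw [h2, mul_zero, zero_add, mul_comm] at h1
    rw [h1]
    exact Finset.sum_congr rfl fun x _ => by ring
  have h0 : f - PowerSeries.X * R * H = 0 := by
    refine eq_of_derivative_eq_mul (G := P) ?_ ?_ (by simp)
    · simp [f, hSum_zero]
    · rw [map_sub, hf, Derivation.leibniz, hXR, hH, smul_eq_mul, smul_eq_mul]
      ring
  have h1 := congrArg (PowerSeries.coeff (n + 1)) (sub_eq_zero.1 h0)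
  rw [mul_assoc, PowerSeries.coeff_succ_X_mul, PowerSeries.coeff_mul,
    Finset.Nat.sum_antidiagonal_eq_sum_range_succ_mk] at h1
  simpa [f, R, H, hSeries] using h1

end Newton

/-! ### The weight generating function -/

section Weight

theorem continuous_hSum (n : ℕ) : Continuous fun p : ℕ → ℂ => hSum p n := by
  unfold hSum
  refine continuous_finsetSum _ fun μ _ => continuous_const.mul ?_
  induction μ.parts using Multiset.induction_on with
  | empty => simpa using continuous_const
  | cons a m ih =>
    simp only [Multiset.map_cons, Multiset.prod_cons]
    exact (continuous_apply a).mul ih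

/-- Since the coefficients of `hSeries` are polynomials in the `p_j`, a sum of sequences that
converges termwise becomes a product that converges coefficientwise. -/
theorem hasProd_hSeries {ι : Type*} {p : ι → ℕ → ℂ} {P : ℕ → ℂ}
    (h : ∀ j, 0 < j → HasSum (fun i => p i j) (P j)) :
    HasProd (fun i => hSeries (p i)) (hSeries P) := by
  -- the entries at `j = 0` play no role, so they may be replaced by zero
  set p' : ι → ℕ → ℂ := fun i j => if j = 0 then 0 else p i j
  set P' : ℕ → ℂ := fun j => if j = 0 then 0 else P j
  have hp : ∀ i, hSeries (p i) = hSeries (p' i) := fun i => by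
    ext n; simpa [hSeries] using hSum_congr (fun j hj => by simp [p', hj.ne']) n
  have hP : hSeries P = hSeries P' := by
    ext n; simpa [hSeries] using hSum_congr (fun j hj => by simp [P', hj.ne']) n
  have h' : HasSum p' P' := by
    rw [Pi.hasSum]
    intro j
    by_cases hj : j = 0
    · simp [p', P', hj, hasSum_zero]
    · simpa [p', P', hj] using h j (Nat.pos_of_ne_zero hj)
  simp_rw [hp, hP]
  unfold HasProd
  rw [PowerSeries.WithPiTopology.tendsto_iff_coeff_tendsto]
  intro n
  simp_rw [← hSeries_sum]
  simpa [hSeries, Function.comp_def] using ((continuous_hSum n).tendsto P').comp h'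

theorem hasProd_qPochhammer {q : ℂ} (hq : ‖q‖ < 1) (a : ℂ) :
    HasProd (fun k : ℕ => (1 - PowerSeries.C (a * q ^ k) * PowerSeries.X : PowerSeries ℂ))
      (hSeries fun j => -(a ^ j / (1 - q ^ j))) := by
  simp_rw [← hSeries_neg_pow]
  refine hasProd_hSeries fun j hj => ?_
  have h : ‖q ^ j‖ < 1 := by
    rw [norm_pow]; exact pow_lt_one₀ (norm_nonneg _) hq hj.ne'
  have := ((hasSum_geometric_of_norm_lt_one h).mul_left (a ^ j)).neg
  simpa [mul_pow, ← pow_mul, mul_comm, div_eq_mul_inv] using this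

theorem qPochhammer_eq {q : ℂ} (hq : ‖q‖ < 1) (a : ℂ) :
    qPochhammer q a = hSeries fun j => -(a ^ j / (1 - q ^ j)) :=
  (hasProd_qPochhammer hq a).tprod_eq

theorem quantumFactor_eq {q : ℂ} (hq : ‖q‖ < 1) (t a : ℂ) :
    quantumFactor q t a = hSeries fun j => (1 - t ^ j) / (1 - q ^ j) * a ^ j := by
  rw [quantumFactor, qPochhammer_eq hq, qPochhammer_eq hq, eq_comm,
    PowerSeries.eq_mul_inv_iff_mul_eq (by simp [constantCoeff_hSeries]), ← hSeries_add]
  congr 1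
  ext j
  simp only [Pi.add_apply, mul_pow]
  ring

theorem summable_pow_of_summable {c : ℕ → ℂ} (hc : Summable c) {j : ℕ} (hj : 0 < j) :
    Summable fun i => c i ^ j := by
  obtain ⟨k, rfl⟩ := Nat.exists_eq_succ_of_ne_zero hj.ne'
  have h0 := hc.norm.tendsto_cofinite_zero
  refine Summable.of_norm_bounded_eventually hc.norm ?_
  filter_upwards [h0.eventually (gt_mem_nhds one_pos)] with i hi
  rw [norm_pow, pow_succ]
  exact mul_le_of_le_one_left (norm_nonneg _) (pow_le_one₀ (norm_nonneg _) hi.le)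

theorem gOne_eq_hSum (q t : ℂ) (c : ℕ → ℂ) (n : ℕ) :
    gOne q t c n = hSum (fun j => (1 - t ^ j) / (1 - q ^ j) * powerSumConst c j) n := by
  simp only [gOne, hSum, Multiset.prod_map_mul, mul_assoc]
  rfl

theorem hasProd_quantumFactor {q : ℂ} (hq : ‖q‖ < 1) (t : ℂ) {c : ℕ → ℂ} (hc : Summable c) :
    HasProd (fun i => quantumFactor q t (c i)) (PowerSeries.mk (gOne q t c)) := by
  simp_rw [quantumFactor_eq hq]
  have : PowerSeries.mk (gOne q t c) =
      hSeries fun j => (1 - t ^ j) / (1 - q ^ j) * powerSumConst c j := by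
    ext n; simp [hSeries, gOne_eq_hSum]
  rw [this]
  exact hasProd_hSeries fun j hj => (summable_pow_of_summable hc hj).hasSum.mul_left _

theorem weightSeries_eq {q : ℂ} (hq : ‖q‖ < 1) (t : ℂ) {c : ℕ → ℂ} (hc : Summable c) :
    weightSeries q t c = PowerSeries.mk (gOne q t c) :=
  (hasProd_quantumFactor hq t hc).tprod_eq

theorem gOne_zero (q t : ℂ) (c : ℕ → ℂ) : gOne q t c 0 = 1 := by
  rw [gOne_eq_hSum, hSum_zero]

end Weight

/-! ### Power sums of cycle types -/

section CycleType

variable {A : Type*} [CommRing A] {Ω : Type*} [Fintype Ω] [DecidableEq Ω]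

/-- The product `∏ p_ℓ` over the lengths `ℓ` of the cycles of `g`, fixed points included. -/
def cycProd (p : ℕ → A) (g : Equiv.Perm Ω) : A := (g.partition.parts.map p).prod

theorem cycProd_eq (p : ℕ → A) (g : Equiv.Perm Ω) :
    cycProd p g = (g.cycleType.map p).prod * p 1 ^ (Fintype.card Ω - g.support.card) := by
  simp [cycProd, Equiv.Perm.parts_partition]

theorem cycProd_conj (p : ℕ → A) (g h : Equiv.Perm Ω) :
    cycProd p (h * g * h⁻¹) = cycProd p g := by
  rw [cycProd_eq, cycProd_eq, Equiv.Perm.cycleType_conj, Equiv.Perm.card_support_conj]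

theorem cycProd_mul_comm (p : ℕ → A) (g h : Equiv.Perm Ω) :
    cycProd p (g * h) = cycProd p (h * g) := by
  rw [← cycProd_conj p (g * h) h]
  congr 1
  group

/-- The conjugacy class of cycle type `μ` has `n! / z_μ` elements. -/
theorem card_partition_mul_zFactor (μ : (Fintype.card Ω).Partition) :
    (Finset.univ.filter fun g : Equiv.Perm Ω => g.partition = μ).card * zFactor μ =
      (Fintype.card Ω).factorial := by
  set m := μ.parts.filter (2 ≤ ·)
  have hm1 : μ.parts.filter (¬ 2 ≤ ·) = Multiset.replicate (μ.parts.count 1) 1 := by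
    rw [← Multiset.filter_eq' μ.parts 1]
    refine Multiset.filter_congr ?_
    intro x hx
    have := μ.parts_pos hx
    omega
  have hsplit : μ.parts = m + Multiset.replicate (μ.parts.count 1) 1 := by
    rw [← hm1]; exact (Multiset.filter_add_not (2 ≤ ·) μ.parts).symm
  have hsum : m.sum + μ.parts.count 1 = Fintype.card Ω := by
    conv_rhs => rw [← μ.parts_sum, hsplit]
    simp
  have h := Equiv.Perm.card_of_cycleType_mul_eq Ω m
  rw [if_pos ⟨by omega, fun a ha => (Multiset.mem_filter.1 ha).2⟩] at h
  rw [← h]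
  congr 1
  · congr 1
    ext g
    simp only [Finset.mem_filter, Finset.mem_univ, true_and]
    constructor
    · rintro rfl
      exact Equiv.Perm.filter_parts_partition_eq_cycleType.symm
    · intro hg
      ext1
      rw [hsplit, Equiv.Perm.parts_partition, hg, ← Equiv.Perm.sum_cycleType, hg]
      congr 2
      omega
  · have h1 : (1 : ℕ) ∉ m.toFinset := by simp [m]
    have hsub : μ.parts.toFinset ⊆ insert 1 m.toFinset := by
      intro x hx
      have := μ.parts_pos (Multiset.mem_toFinset.1 hx)
      by_cases h2 : x = 1
      · simp [h2]
      · simp only [Finset.mem_insert, Multiset.mem_toFinset, m, Multiset.mem_filter]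
        exact Or.inr ⟨Multiset.mem_toFinset.1 hx, by omega⟩
    have hcount : ∀ i ∈ m.toFinset, m.count i = μ.parts.count i := by
      intro i hi
      have := (Multiset.mem_filter.1 (Multiset.mem_toFinset.1 hi)).2
      exact Multiset.count_filter_of_pos this
    rw [zFactor, Finset.prod_subset hsub
      (fun x _ hx => by
        simp [Multiset.count_eq_zero_of_notMem (fun h => hx (Multiset.mem_toFinset.2 h))]),
      Finset.prod_insert h1, Finset.prod_mul_distrib, Finset.prod_multiset_count,
      one_pow, one_mul, Finset.prod_congr rfl fun i hi => by rw [← hcount i hi],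
      mul_assoc, show Fintype.card Ω - m.sum = μ.parts.count 1 by omega]
    congr 2
    exact Finset.prod_congr rfl fun i hi => by rw [← hcount i hi]

theorem sum_cycProd [Algebra ℂ A] (p : ℕ → A) :
    ∑ g : Equiv.Perm Ω, cycProd p g =
      ((Fintype.card Ω).factorial : A) * hSum p (Fintype.card Ω) := by
  rw [← Finset.sum_fiberwise Finset.univ (fun g : Equiv.Perm Ω => g.partition), hSum,
    Finset.mul_sum]
  refine Finset.sum_congr rfl fun μ _ => ?_
  rw [Finset.sum_congr rfl fun g hg => by rw [cycProd, (Finset.mem_filter.1 hg).2],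
    Finset.sum_const, nsmul_eq_mul, ← mul_assoc]
  congr 1
  rw [← map_natCast (algebraMap ℂ A), ← map_natCast (algebraMap ℂ A), ← map_mul]
  congr 1
  rw [← card_partition_mul_zFactor μ]
  have : (zFactor μ : ℂ) ≠ 0 := Nat.cast_ne_zero.2 (zFactor_ne_zero μ)
  push_cast
  field_simp

/-- Restricted to the points outside the range of `f`, the extension of `g` is the identity. -/
theorem cycProd_extendDomain {Ω' : Type*} [Fintype Ω'] [DecidableEq Ω'] {P : Ω' → Prop}
    [DecidablePred P] (f : Ω ≃ Subtype P) (p : ℕ → A) (g : Equiv.Perm Ω) :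
    cycProd p (g.extendDomain f) =
      p 1 ^ (Fintype.card Ω' - Fintype.card Ω) * cycProd p g := by
  rw [cycProd_eq, cycProd_eq, Equiv.Perm.cycleType_extendDomain,
    Equiv.Perm.card_support_extend_domain, mul_left_comm, ← pow_add]
  congr 2
  have h1 : g.support.card ≤ Fintype.card Ω := g.support.card_le_univ
  have h2 : Fintype.card Ω ≤ Fintype.card Ω' := by
    rw [Fintype.card_congr f]; exact Fintype.card_subtype_le P
  omega

open Classical in
/-- The lengths of the cycles are the sizes of the classes of the relation "same cycle". -/
theorem cycProd_eq_prod_quotient (p : ℕ → A) (g : Equiv.Perm Ω) :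
    cycProd p g = ∏ c : Quotient (Equiv.Perm.SameCycle.setoid g),
      p (Finset.univ.filter fun x : Ω => (Quotient.mk _ x : Quotient _) = c).card := by
  have hne : ∀ c : g.cycleFactorsFinset, ∃ x, g.cycleOf x = c.1 ∧ x ∈ g.support := by
    intro c
    obtain ⟨x, hx⟩ := (Equiv.Perm.mem_cycleFactorsFinset_iff.1 c.2).1.nonempty_support
    exact ⟨x, (Equiv.Perm.cycle_is_cycleOf hx c.2).symm,
      Equiv.Perm.mem_cycleFactorsFinset_support_le c.2 hx⟩
  choose r hr hrs using hne
  let ψ : g.cycleFactorsFinset ⊕ {x // g x = x} → Quotient (Equiv.Perm.SameCycle.setoid g) :=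
    Sum.elim (fun c => Quotient.mk _ (r c)) (fun x => Quotient.mk _ x.1)
  have hψ : Function.Bijective ψ := by
    constructor
    · rintro (c | x) (c' | y) h
      · have h' : g.SameCycle (r c) (r c') := Quotient.exact h
        have := h'.cycleOf_eq
        rw [hr, hr] at this
        rw [Subtype.ext this]
      · have h' : g.SameCycle (r c) y := Quotient.exact h
        exact absurd ((h'.apply_eq_self_iff).2 y.2) (Equiv.Perm.mem_support.1 (hrs c))
      · have h' : g.SameCycle x (r c') := Quotient.exact h
        exact absurd ((h'.apply_eq_self_iff).1 x.2) (Equiv.Perm.mem_support.1 (hrs c'))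
      · have h' : g.SameCycle x y := Quotient.exact h
        obtain ⟨i, hi⟩ := h'
        rw [Equiv.Perm.zpow_apply_eq_self_of_apply_eq_self x.2] at hi
        rw [Subtype.ext hi]
    · intro c
      induction c using Quotient.inductionOn with
      | h x =>
        by_cases hx : g x = x
        · exact ⟨Sum.inr ⟨x, hx⟩, rfl⟩
        · have hx' : x ∈ g.support := Equiv.Perm.mem_support.2 hx
          have hc := Equiv.Perm.cycleOf_mem_cycleFactorsFinset_iff.2 hx'
          refine ⟨Sum.inl ⟨_, hc⟩, Quotient.sound ?_⟩
          exact (Equiv.Perm.sameCycle_iff_cycleOf_eq_of_mem_support (hrs _) hx').2 (hr ⟨_, hc⟩)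
  rw [← (Equiv.ofBijective ψ hψ).prod_comp, Fintype.prod_sum_type, cycProd_eq]
  congr 1
  · rw [Equiv.Perm.cycleType_def, Multiset.map_map]
    change ∏ c ∈ g.cycleFactorsFinset, _ = _
    rw [← Finset.prod_coe_sort]
    refine Finset.prod_congr rfl fun c _ => ?_
    simp only [Function.comp_apply]
    congr 2
    ext x
    simp only [Equiv.ofBijective_apply, Finset.mem_filter, Finset.mem_univ, true_and]
    change _ ↔ (Quotient.mk (Equiv.Perm.SameCycle.setoid g) x = Quotient.mk _ (r c))
    rw [Quotient.eq, ← hr c, Equiv.Perm.mem_support_cycleOf_iff]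
    exact ⟨fun h => h.1.symm, fun h => ⟨Equiv.Perm.SameCycle.symm h, hrs c⟩⟩
  · have : ∀ x : {x // g x = x}, (Finset.univ.filter fun y : Ω =>
        (Quotient.mk _ y : Quotient (Equiv.Perm.SameCycle.setoid g)) =
          Equiv.ofBijective ψ hψ (Sum.inr x)).card = 1 := by
      intro x
      rw [Finset.card_eq_one]
      refine ⟨x.1, ?_⟩
      ext y
      simp only [Equiv.ofBijective_apply, Finset.mem_filter, Finset.mem_univ, true_and,
        Finset.mem_singleton]
      change (Quotient.mk (Equiv.Perm.SameCycle.setoid g) y = Quotient.mk _ x.1) ↔ _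
      rw [Quotient.eq]
      constructor
      · rintro ⟨i, hi⟩
        have := congrArg (⇑(g ^ (-i))) hi
        rw [Equiv.Perm.zpow_apply_eq_self_of_apply_eq_self x.2] at this
        simpa using this
      · rintro rfl
        exact Equiv.Perm.SameCycle.refl _ _
    rw [Finset.prod_congr rfl fun x _ => by rw [this x], Finset.prod_const, Finset.card_univ]
    congr 1
    rw [Fintype.card_subtype, ← Finset.card_compl]
    congr 1
    ext x; simp

/-- Colourings constant on the cycles of `g`: the sum of `∏ x_{w(ω)}` over the colourings `w`
with `w ∘ g = w` is the product over the cycles of the power sums `∑_i x_i ^ ℓ`. -/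
theorem sum_prod_comp_eq_self {ι : Type*} [Fintype ι] [DecidableEq ι] (x : ι → A)
    (g : Equiv.Perm Ω) :
    ∑ w ∈ Finset.univ.filter (fun w : Ω → ι => w ∘ g = w), ∏ ω, x (w ω) =
      cycProd (fun j => ∑ i, x i ^ j) g := by
  classical
  let Q := Quotient (Equiv.Perm.SameCycle.setoid g)
  have hlift : ∀ w : {w : Ω → ι // w ∘ g = w}, ∀ a b : Ω,
      (Equiv.Perm.SameCycle.setoid g) a b → w.1 a = w.1 b := by
    rintro ⟨w, hw⟩ a b h
    obtain ⟨i, -, rfl⟩ := Equiv.Perm.SameCycle.exists_pow_eq' h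
    clear h
    induction i with
    | zero => rfl
    | succ i ih =>
      rw [pow_succ', Equiv.Perm.mul_apply]
      exact ih.trans (congrFun hw _).symm
  let e : {w : Ω → ι // w ∘ g = w} ≃ (Q → ι) :=
    { toFun := fun w => Quotient.lift w.1 (hlift w)
      invFun := fun v => ⟨fun ω => v (Quotient.mk _ ω), by
        ext ω
        exact congrArg v (Quotient.sound (Equiv.Perm.sameCycle_apply_left.2
          (Equiv.Perm.SameCycle.refl g ω)))⟩
      left_inv := fun w => rfl
      right_inv := fun v => by
        funext c
        induction c using Quotient.inductionOn with
        | h x => rfl }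
  rw [cycProd_eq_prod_quotient, Finset.prod_univ_sum, Fintype.piFinset_univ,
    Finset.sum_subtype (p := fun w : Ω → ι => w ∘ g = w) _ (by simp), ← e.symm.sum_comp]
  refine Finset.sum_congr rfl fun v _ => ?_
  rw [← Finset.prod_fiberwise Finset.univ (fun ω : Ω => (Quotient.mk _ ω : Q))]
  refine Finset.prod_congr rfl fun c _ => ?_
  rw [Finset.prod_congr rfl (g := fun _ => x (v c)) fun ω hω => by
    rw [← (Finset.mem_filter.1 hω).2]; rfl, Finset.prod_const]

end CycleType

/-! ### The characteristic map on the group algebra -/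

section CharacteristicMap

variable {A : Type*} [CommRing A] [Algebra ℂ A] {Ω : Type*} [Fintype Ω] [DecidableEq Ω]

/-- The linear map `ℂ[S_Ω] → A` sending a permutation to the product of the power sums `p_ℓ` over
the lengths `ℓ` of its cycles. -/
def charMap (p : ℕ → A) : MonoidAlgebra ℂ (Equiv.Perm Ω) →ₗ[ℂ] A :=
  Finsupp.linearCombination ℂ (cycProd p) ∘ₗ (MonoidAlgebra.coeffLinearEquiv ℂ).toLinearMap

theorem charMap_single (p : ℕ → A) (g : Equiv.Perm Ω) (a : ℂ) :
    charMap p (MonoidAlgebra.single g a) = a • cycProd p g := by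
  simp [charMap]

theorem charMap_of (p : ℕ → A) (g : Equiv.Perm Ω) :
    charMap p (MonoidAlgebra.of ℂ _ g) = cycProd p g := by
  simp [charMap]

/-- Two linear maps out of a group algebra agree if they agree on the group elements. -/
theorem linearMap_eq_of_of {G V : Type*} [Monoid G] [AddCommMonoid V] [Module ℂ V]
    {f g : MonoidAlgebra ℂ G →ₗ[ℂ] V}
    (h : ∀ x : G, f (MonoidAlgebra.of ℂ G x) = g (MonoidAlgebra.of ℂ G x)) : f = g := by
  refine LinearMap.ext fun x => ?_
  induction x using MonoidAlgebra.induction_linear with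
  | zero => simp
  | add x y hx hy => rw [map_add, map_add, hx, hy]
  | single m r =>
    have : MonoidAlgebra.single m r = r • MonoidAlgebra.of ℂ G m := by simp
    rw [this, map_smul, map_smul, h]

/-- The characteristic map is a trace. -/
theorem charMap_mul_comm (p : ℕ → A) (x y : MonoidAlgebra ℂ (Equiv.Perm Ω)) :
    charMap p (x * y) = charMap p (y * x) := by
  suffices h : (LinearMap.mul ℂ (MonoidAlgebra ℂ (Equiv.Perm Ω))).compr₂ (charMap p) =
      (LinearMap.mul ℂ (MonoidAlgebra ℂ (Equiv.Perm Ω))).flip.compr₂ (charMap p) from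
    LinearMap.congr_fun₂ h x y
  refine linearMap_eq_of_of fun g => linearMap_eq_of_of fun h => ?_
  simp only [LinearMap.compr₂_apply, LinearMap.mul_apply', LinearMap.flip_apply, ← map_mul,
    charMap_of]
  exact cycProd_mul_comm p g h

theorem map_charMap {B : Type*} [CommRing B] [Algebra ℂ B] (f : A →ₐ[ℂ] B) (p : ℕ → A)
    (x : MonoidAlgebra ℂ (Equiv.Perm Ω)) :
    f (charMap p x) = charMap (fun j => f (p j)) x := by
  suffices h : f.toLinearMap ∘ₗ charMap p = charMap (Ω := Ω) (fun j => f (p j)) from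
    LinearMap.congr_fun h x
  refine linearMap_eq_of_of fun g => ?_
  simp [charMap_of, cycProd, map_multiset_prod, Multiset.map_map,
    -MonoidAlgebra.of_apply]

end CharacteristicMap

/-! ### The universal flow variables -/

section Universal

/-- The exponent of the monomial `∏_i t_{m_i}`; the variable `t_j` has index `j - 1`. -/
def flowExponent (m : Multiset ℕ) : ℕ →₀ ℕ := Multiset.toFinsupp (m.map fun j => j - 1)

theorem flowExponent_injOn {m m' : Multiset ℕ} (hm : ∀ j ∈ m, 0 < j) (hm' : ∀ j ∈ m', 0 < j)
    (h : flowExponent m = flowExponent m') : m = m' := by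
  have h1 := congrArg (Multiset.map (· + 1)) (Multiset.toFinsupp.injective h)
  rw [Multiset.map_map, Multiset.map_map] at h1
  have key : ∀ s : Multiset ℕ, (∀ j ∈ s, 0 < j) →
      s.map ((· + 1) ∘ fun j => j - 1) = s := fun s hs => by
    conv_rhs => rw [← Multiset.map_id s]
    exact Multiset.map_congr rfl fun j hj => Nat.sub_add_cancel (hs j hj)
  rwa [key m hm, key m' hm'] at h1

theorem prod_map_powerSum_X (m : Multiset ℕ) :
    (m.map (powerSum (MvPolynomial.X : ℕ → MvPolynomial ℕ ℂ))).prod =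
      MvPolynomial.monomial (flowExponent m) (m.prod : ℂ) := by
  induction m using Multiset.induction_on with
  | empty => simp [flowExponent]
  | cons a m ih =>
    rw [Multiset.map_cons, Multiset.prod_cons, ih, powerSum, flowExponent, flowExponent,
      Multiset.map_cons, ← Multiset.singleton_add, map_add, Multiset.toFinsupp_singleton,
      Multiset.prod_cons,
      ← map_natCast (MvPolynomial.C (σ := ℕ) (R := ℂ)), MvPolynomial.X,
      MvPolynomial.C_mul_monomial, MvPolynomial.monomial_mul]
    simp

variable {Ω : Type*} [Fintype Ω] [DecidableEq Ω]

theorem cycProd_X (g : Equiv.Perm Ω) :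
    cycProd (powerSum (MvPolynomial.X : ℕ → MvPolynomial ℕ ℂ)) g =
      MvPolynomial.monomial (flowExponent g.partition.parts) (g.partition.parts.prod : ℂ) :=
  prod_map_powerSum_X _

/-- As the products of power sums of distinct cycle types are linearly independent, a class
function factors through the characteristic map. -/
theorem exists_linearMap_cycProd {V : Type*} [AddCommGroup V] [Module ℂ V]
    (F : Equiv.Perm Ω → V) (hF : ∀ g h, F (h * g * h⁻¹) = F g) :
    ∃ T : MvPolynomial ℕ ℂ →ₗ[ℂ] V,
      ∀ g, T (cycProd (powerSum MvPolynomial.X) g) = F g := by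
  classical
  refine ⟨(MvPolynomial.basisMonomials ℕ ℂ).constr ℂ fun e =>
    if h : ∃ g : Equiv.Perm Ω, flowExponent g.partition.parts = e then
      (h.choose.partition.parts.prod : ℂ)⁻¹ • F h.choose else 0, fun g => ?_⟩
  have h : ∃ g' : Equiv.Perm Ω,
    flowExponent g'.partition.parts = flowExponent g.partition.parts := ⟨g, rfl⟩
  have hp : h.choose.partition.parts = g.partition.parts :=
    flowExponent_injOn (fun _ => h.choose.partition.parts_pos) (fun _ => g.partition.parts_pos)
      h.choose_spec
  have hc : F h.choose = F g := by
    obtain ⟨k, hk⟩ := isConj_iff.1 (Equiv.Perm.partition_eq_of_isConj.2 (Nat.Partition.ext hp))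
    exact (hF _ k).symm.trans (congrArg F hk)
  have h0 : (g.partition.parts.prod : ℂ) ≠ 0 :=
    Nat.cast_ne_zero.2 (Multiset.prod_ne_zero fun h0 => (g.partition.parts_pos h0).ne' rfl)
  have hm : MvPolynomial.monomial (flowExponent g.partition.parts) (g.partition.parts.prod : ℂ) =
      (g.partition.parts.prod : ℂ) •
        MvPolynomial.basisMonomials ℕ ℂ (flowExponent g.partition.parts) := by
    simp [MvPolynomial.smul_monomial]
  rw [cycProd_X, hm, map_smul, Module.Basis.constr_basis, dif_pos h, hp, hc, smul_smul,
    mul_inv_cancel₀ h0, one_smul]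

/-- Multiplication by a central element descends along the characteristic map. -/
theorem exists_linearMap_charMap_mul (z : MonoidAlgebra ℂ (Equiv.Perm Ω))
    (hz : ∀ g, Commute z (MonoidAlgebra.of ℂ _ g)) :
    ∃ T : MvPolynomial ℕ ℂ →ₗ[ℂ] MvPolynomial ℕ ℂ, ∀ y : MonoidAlgebra ℂ (Equiv.Perm Ω),
      T (charMap (powerSum MvPolynomial.X) y) = charMap (powerSum MvPolynomial.X) (z * y) := by
  obtain ⟨T, hT⟩ := exists_linearMap_cycProd
    (fun g : Equiv.Perm Ω => charMap (powerSum MvPolynomial.X : ℕ → MvPolynomial ℕ ℂ)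
      (z * MonoidAlgebra.of ℂ _ g)) fun g h => by
        rw [map_mul (MonoidAlgebra.of ℂ (Equiv.Perm Ω)),
          map_mul (MonoidAlgebra.of ℂ (Equiv.Perm Ω)), ← mul_assoc, charMap_mul_comm,
          ← mul_assoc, ← mul_assoc,
          ← (hz _).eq, mul_assoc z, ← map_mul (MonoidAlgebra.of ℂ (Equiv.Perm Ω)), inv_mul_cancel,
          map_one, mul_one]
  refine ⟨T, fun y => ?_⟩
  suffices h : T ∘ₗ charMap (powerSum MvPolynomial.X) =
      charMap (powerSum MvPolynomial.X) ∘ₗ LinearMap.mulLeft ℂ z from LinearMap.congr_fun h y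
  refine linearMap_eq_of_of fun g => ?_
  simp only [LinearMap.comp_apply, charMap_of, hT, LinearMap.mulLeft_apply]

end Universal

/-! ### Euler operators on polynomials -/

section Euler

variable {A : Type*} [CommRing A] {N : ℕ}

/-- The Euler operator `x_i ∂/∂x_i`. -/
def euler (i : Fin N) : Derivation A (MvPolynomial (Fin N) A) (MvPolynomial (Fin N) A) :=
  (MvPolynomial.X i : MvPolynomial (Fin N) A) • MvPolynomial.pderiv i

theorem coeff_euler (i : Fin N) (f : MvPolynomial (Fin N) A) (α : Fin N →₀ ℕ) :
    (euler i f).coeff α = (α i : A) * f.coeff α := by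
  induction f using MvPolynomial.induction_on' with
  | add f g hf hg => simp [hf, hg, mul_add]
  | monomial β a =>
    have : euler i (MvPolynomial.monomial β a) = (β i : A) • MvPolynomial.monomial β a := by
      rw [euler, Derivation.smul_apply, MvPolynomial.pderiv_monomial, smul_eq_mul]
      by_cases hb : β i = 0
      · simp [hb]
      · rw [MvPolynomial.X, MvPolynomial.monomial_mul, MvPolynomial.smul_monomial,
          add_tsub_cancel_of_le (by simpa [Nat.one_le_iff_ne_zero] using hb)]
        congr 1; simp [mul_comm]
    rw [this, MvPolynomial.coeff_smul, smul_eq_mul, MvPolynomial.coeff_monomial]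
    split_ifs with h
    · rw [h]
    · simp

theorem euler_X (i j : Fin N) :
    euler (A := A) i (MvPolynomial.X j) = if i = j then MvPolynomial.X i else 0 := by
  rw [euler, Derivation.smul_apply, MvPolynomial.pderiv_X, Pi.single_apply]
  aesop

theorem euler_prod_X {Ω : Type*} [Fintype Ω] (i : Fin N) (w : Ω → Fin N) :
    euler (A := A) i (∏ ω, MvPolynomial.X (w ω)) =
      ((Finset.univ.filter fun ω => w ω = i).card : MvPolynomial (Fin N) A) *
        ∏ ω, MvPolynomial.X (w ω) := by
  have : (∏ ω, MvPolynomial.X (w ω) : MvPolynomial (Fin N) A) =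
      MvPolynomial.monomial (∑ ω, Finsupp.single (w ω) 1) 1 := by
    rw [MvPolynomial.monomial_sum_one]; rfl
  rw [this]
  ext α
  rw [coeff_euler, ← map_natCast (MvPolynomial.C (σ := Fin N) (R := A)),
    MvPolynomial.coeff_C_mul, MvPolynomial.coeff_monomial]
  split_ifs with h
  · rw [← h, Finsupp.finsetSum_apply, Finset.card_filter]
    simp [Finsupp.single_apply]
  · simp

theorem euler_C (i : Fin N) (a : A) : euler i (MvPolynomial.C a) = 0 := by
  simp [euler]

end Euler

/-! ### The class of transpositions acting on Young symmetrizers -/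

section Colourings

variable {A : Type*} [CommRing A] [Algebra ℂ A] {Ω : Type*} [Fintype Ω] [DecidableEq Ω] {N : ℕ}

/-- The sum of the elements of the Young subgroup of permutations preserving a colouring `w`. -/
def youngSum (w : Ω → Fin N) : MonoidAlgebra ℂ (Equiv.Perm Ω) :=
  ∑ h ∈ Finset.univ.filter (fun h : Equiv.Perm Ω => w ∘ h = w), MonoidAlgebra.of ℂ _ h

/-- The part of `youngSum w` fixing the point `v`. -/
def youngSumFix (v : Ω) (w : Ω → Fin N) : MonoidAlgebra ℂ (Equiv.Perm Ω) :=
  ∑ h ∈ Finset.univ.filter (fun h : Equiv.Perm Ω => w ∘ h = w ∧ h v = v), MonoidAlgebra.of ℂ _ h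

/-- The sum of the transpositions of `v` with the other points of colour `i`. -/
def swapSum (v : Ω) (w : Ω → Fin N) (i : Fin N) : MonoidAlgebra ℂ (Equiv.Perm Ω) :=
  ∑ u ∈ Finset.univ.filter (fun u => u ≠ v ∧ w u = i), MonoidAlgebra.of ℂ _ (Equiv.swap u v)

/-- Twice the class sum of the transpositions. -/
def twiceTranspositions (Ω : Type*) [Fintype Ω] [DecidableEq Ω] :
    MonoidAlgebra ℂ (Equiv.Perm Ω) :=
  ∑ v : Ω, ∑ u ∈ Finset.univ.filter (fun u => u ≠ v), MonoidAlgebra.of ℂ _ (Equiv.swap u v)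

theorem swapSum_update (v : Ω) (w : Ω → Fin N) (i j : Fin N) :
    swapSum v (Function.update w v j) i = swapSum v w i := by
  unfold swapSum
  congr 1
  ext u
  simp only [Finset.mem_filter, Finset.mem_univ, true_and]
  constructor <;> rintro ⟨h1, h2⟩ <;> refine ⟨h1, ?_⟩ <;>
    simpa [Function.update_of_ne h1] using h2

theorem youngSumFix_update (v : Ω) (w : Ω → Fin N) (j : Fin N) :
    youngSumFix v (Function.update w v j) = youngSumFix v w := by
  unfold youngSumFix
  congr 1
  ext h
  simp only [Finset.mem_filter, Finset.mem_univ, true_and, and_congr_left_iff]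
  intro hv
  constructor <;> intro hw <;> ext u : 1 <;> by_cases hu : u = v
  · simp [hu, hv]
  · have hu' : h u ≠ v := fun h' => hu (h.injective (h'.trans hv.symm))
    simpa [Function.update_of_ne hu, Function.update_of_ne hu'] using congrFun hw u
  · simp [hu, hv]
  · have hu' : h u ≠ v := fun h' => hu (h.injective (h'.trans hv.symm))
    simpa [Function.update_of_ne hu, Function.update_of_ne hu'] using congrFun hw u

/-- Coset decomposition of a Young subgroup with respect to the stabilizer of a point. -/
theorem youngSum_eq (v : Ω) (w : Ω → Fin N) :
    youngSum w = (1 + swapSum v w (w v)) * youngSumFix v w := by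
  have h1 : (1 : MonoidAlgebra ℂ (Equiv.Perm Ω)) + swapSum v w (w v) =
      ∑ u ∈ Finset.univ.filter (fun u => w u = w v), MonoidAlgebra.of ℂ _ (Equiv.swap u v) := by
    rw [← Finset.add_sum_erase (Finset.univ.filter fun u => w u = w v) _
      (Finset.mem_filter.2 ⟨Finset.mem_univ v, rfl⟩), Equiv.swap_self, swapSum]
    congr 1
    refine Finset.sum_congr ?_ fun _ _ => rfl
    ext u; simp
  rw [h1, Finset.sum_mul, youngSum,
    ← Finset.sum_fiberwise_of_maps_to (g := fun h : Equiv.Perm Ω => h v)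
      (t := Finset.univ.filter (fun u => w u = w v))
      (fun h hh => by
        simp only [Finset.mem_filter, Finset.mem_univ, true_and] at hh ⊢
        exact congrFun hh v)]
  refine Finset.sum_congr rfl fun u hu => ?_
  have hwu : w u = w v := (Finset.mem_filter.1 hu).2
  have hsw : w ∘ Equiv.swap u v = w := by
    ext x : 1
    simp only [Function.comp_apply, Equiv.swap_apply_def]
    split_ifs with h1 h2
    · rw [h1, hwu]
    · rw [h2, hwu]
    · rfl
  rw [youngSumFix, Finset.mul_sum]
  refine Finset.sum_bij' (fun h _ => Equiv.swap u v * h) (fun h _ => Equiv.swap u v * h)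
    ?_ ?_ ?_ ?_ ?_
  · intro h hh
    simp only [Finset.mem_filter, Finset.mem_univ, true_and] at hh ⊢
    refine ⟨?_, by simp [hh.2]⟩
    rw [Equiv.Perm.coe_mul, ← Function.comp_assoc, hsw, hh.1]
  · intro h hh
    simp only [Finset.mem_filter, Finset.mem_univ, true_and] at hh ⊢
    refine ⟨?_, by simp [hh.2]⟩
    rw [Equiv.Perm.coe_mul, ← Function.comp_assoc, hsw, hh.1]
  · intro h _; simp [← mul_assoc]
  · intro h _; simp [← mul_assoc]
  · intro h _
    rw [← map_mul, ← mul_assoc, Equiv.swap_mul_self, one_mul]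

theorem of_swap_mul_youngSum {w : Ω → Fin N} {u v : Ω} (h : w u = w v) :
    MonoidAlgebra.of ℂ _ (Equiv.swap u v) * youngSum w = youngSum w := by
  have hsw : w ∘ Equiv.swap u v = w := by
    ext x : 1
    simp only [Function.comp_apply, Equiv.swap_apply_def]
    split_ifs with h1 h2
    · rw [h1, h]
    · rw [h2, h]
    · rfl
  rw [youngSum, Finset.mul_sum]
  refine Finset.sum_bij' (fun h _ => Equiv.swap u v * h) (fun h _ => Equiv.swap u v * h)
    ?_ ?_ ?_ ?_ ?_
  · intro h hh
    simp only [Finset.mem_filter, Finset.mem_univ, true_and] at hh ⊢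
    rw [Equiv.Perm.coe_mul, ← Function.comp_assoc, hsw, hh]
  · intro h hh
    simp only [Finset.mem_filter, Finset.mem_univ, true_and] at hh ⊢
    rw [Equiv.Perm.coe_mul, ← Function.comp_assoc, hsw, hh]
  · intro h _; simp [← mul_assoc]
  · intro h _; simp [← mul_assoc]
  · intro h _; rw [map_mul]

theorem commute_swapSum_youngSumFix (v : Ω) (w : Ω → Fin N) (i : Fin N) :
    Commute (swapSum v w i) (youngSumFix v w) := by
  refine Commute.sum_right _ _ _ fun h hh => ?_
  simp only [Finset.mem_filter, Finset.mem_univ, true_and] at hh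
  have hinv : ∀ x, w (h.symm x) = w x := fun x => by
    simpa using (congrFun hh.1 (h.symm x)).symm
  have hv : h.symm v = v := by rw [Equiv.symm_apply_eq, hh.2]
  rw [Commute, SemiconjBy, swapSum, Finset.sum_mul, Finset.mul_sum]
  refine Finset.sum_bij' (fun u _ => h.symm u) (fun u _ => h u) ?_ ?_ ?_ ?_ ?_
  · intro u hu
    simp only [Finset.mem_filter, Finset.mem_univ, true_and] at hu ⊢
    exact ⟨fun h' => hu.1 (by rw [← hh.2, ← h', Equiv.apply_symm_apply]), by rw [hinv, hu.2]⟩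
  · intro u hu
    simp only [Finset.mem_filter, Finset.mem_univ, true_and] at hu ⊢
    exact ⟨fun h' => hu.1 (h.injective (h'.trans hh.2.symm)),
      by rw [← hu.2]; exact congrFun hh.1 u⟩
  · intro u _; simp
  · intro u _; simp
  · intro u _
    rw [← map_mul, ← map_mul]
    congr 1
    have := Equiv.swap_apply_apply h (h.symm u) v
    rw [Equiv.apply_symm_apply, hh.2] at this
    rw [this]; group

/-- The trace property makes the two ways of enlarging the Young subgroup of `w` on the
complement of `v` agree. -/
theorem charMap_one_add_swapSum_mul_youngSum (p : ℕ → A) (v : Ω) (w : Ω → Fin N) (j : Fin N) :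
    charMap p ((1 + swapSum v (Function.update w v j) (w v)) *
        youngSum (Function.update w v j)) =
      charMap p ((1 + swapSum v w j) * youngSum w) := by
  rw [youngSum_eq v (Function.update w v j), youngSum_eq v w, Function.update_self,
    swapSum_update, swapSum_update, youngSumFix_update]
  have h : Commute (1 + swapSum v w j) (youngSumFix v w) :=
    (Commute.one_left _).add_left (commute_swapSum_youngSumFix v w _)
  rw [h.eq, ← mul_assoc, charMap_mul_comm]

/-- The generating polynomial `∑_w x^w Φ(y E(w))` over all colourings `w` of `Ω` by `N` colours,
where `E(w)` is the Young symmetrizer of `w` and `Φ` the characteristic map. -/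
def colourSum (N : ℕ) (p : ℕ → A) (y : MonoidAlgebra ℂ (Equiv.Perm Ω)) :
    MvPolynomial (Fin N) A :=
  ∑ w : Ω → Fin N, (∏ ω, MvPolynomial.X (w ω)) * MvPolynomial.C (charMap p (y * youngSum w))

theorem euler_colourSum (N : ℕ) (p : ℕ → A) (y : MonoidAlgebra ℂ (Equiv.Perm Ω)) (i : Fin N) :
    euler i (colourSum N p y) = ∑ v : Ω, ∑ w ∈ Finset.univ.filter (fun w : Ω → Fin N => w v = i),
      (∏ ω, MvPolynomial.X (w ω)) * MvPolynomial.C (charMap p (y * youngSum w)) := by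
  simp_rw [Finset.sum_filter]
  rw [Finset.sum_comm, colourSum, map_sum]
  refine Finset.sum_congr rfl fun w _ => ?_
  rw [Derivation.leibniz, euler_C, smul_zero, zero_add, euler_prod_X, smul_eq_mul,
    ← Finset.sum_filter, Finset.sum_const, nsmul_eq_mul]
  ring

/-- The contribution to `colourSum N p (twiceTranspositions Ω)` of the transpositions of a point of
colour `i` with a point of colour `j`. -/
def crossSum (N : ℕ) (p : ℕ → A) (Ω : Type*) [Fintype Ω] [DecidableEq Ω] (i j : Fin N) :
    MvPolynomial (Fin N) A :=
  ∑ v : Ω, ∑ w ∈ Finset.univ.filter (fun w : Ω → Fin N => w v = j),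
    (∏ ω, MvPolynomial.X (w ω)) * MvPolynomial.C (charMap p (swapSum v w i * youngSum w))

theorem twiceTranspositions_eq (w : Ω → Fin N) :
    twiceTranspositions Ω = ∑ v : Ω, ∑ i, swapSum v w i := by
  unfold twiceTranspositions swapSum
  refine Finset.sum_congr rfl fun v _ => ?_
  rw [← Finset.sum_fiberwise _ w]
  simp_rw [Finset.filter_filter]

theorem colourSum_twiceTranspositions (p : ℕ → A) :
    colourSum N p (twiceTranspositions Ω) = ∑ i, ∑ j, crossSum N p Ω i j := by
  have h : ∀ i, ∑ j, crossSum N p Ω i j = ∑ v : Ω, ∑ w : Ω → Fin N,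
      (∏ ω, MvPolynomial.X (w ω)) * MvPolynomial.C (charMap p (swapSum v w i * youngSum w)) := by
    intro i
    simp_rw [crossSum]
    rw [Finset.sum_comm]
    refine Finset.sum_congr rfl fun v _ => ?_
    exact Finset.sum_fiberwise Finset.univ (fun w : Ω → Fin N => w v) _
  simp_rw [h]
  unfold colourSum
  rw [Finset.sum_congr rfl fun w _ => by
      rw [twiceTranspositions_eq w],
    Finset.sum_comm (s := (Finset.univ : Finset (Fin N)))]
  simp_rw [Finset.sum_mul, map_sum, Finset.mul_sum]
  rw [Finset.sum_comm]
  exact Finset.sum_congr rfl fun v _ => Finset.sum_comm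

/-- A transposition inside a colour class is absorbed by the Young symmetrizer, so the diagonal
terms count the ordered pairs of points of colour `i`. -/
theorem crossSum_self (p : ℕ → A) (i : Fin N) :
    crossSum N p Ω i i = euler i (euler i (colourSum N p (1 : MonoidAlgebra ℂ (Equiv.Perm Ω)))) -
      euler i (colourSum N p (1 : MonoidAlgebra ℂ (Equiv.Perm Ω))) := by
  rw [eq_sub_iff_add_eq, euler_colourSum, crossSum, map_sum, ← Finset.sum_add_distrib]
  refine Finset.sum_congr rfl fun v _ => ?_
  rw [map_sum, ← Finset.sum_add_distrib]
  refine Finset.sum_congr rfl fun w hw => ?_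
  have hwv : w v = i := (Finset.mem_filter.1 hw).2
  rw [Derivation.leibniz, euler_C, smul_zero, zero_add, euler_prod_X, smul_eq_mul, swapSum,
    Finset.sum_mul, Finset.sum_congr rfl fun u hu => of_swap_mul_youngSum
      (((Finset.mem_filter.1 hu).2.2).trans hwv.symm), Finset.sum_const, one_mul,
    ← Finset.card_erase_add_one (Finset.mem_filter.2 ⟨Finset.mem_univ v, hwv⟩ :
      v ∈ Finset.univ.filter fun ω => w ω = i)]
  have : Finset.univ.filter (fun u => u ≠ v ∧ w u = i) =
      (Finset.univ.filter fun ω => w ω = i).erase v := by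
    ext u; simp
  rw [this, map_nsmul, map_nsmul, nsmul_eq_mul]
  push_cast
  ring

theorem crossSum_comm (p : ℕ → A) (i j : Fin N) :
    crossSum N p Ω i j = crossSum N p Ω j i := by
  have h : ∀ i j, crossSum N p Ω i j = ∑ w : Ω → Fin N, ∑ v : Ω, ∑ u : Ω,
      if u ≠ v ∧ w u = i ∧ w v = j then (∏ ω, MvPolynomial.X (w ω)) *
        MvPolynomial.C (charMap p (MonoidAlgebra.of ℂ _ (Equiv.swap u v) * youngSum w)) else 0 := by
    intro i j
    unfold crossSum
    simp_rw [Finset.sum_filter]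
    rw [Finset.sum_comm]
    refine Finset.sum_congr rfl fun w _ => ?_
    refine Finset.sum_congr rfl fun v _ => ?_
    rw [swapSum, Finset.sum_mul, map_sum, map_sum, Finset.mul_sum, Finset.sum_filter]
    split_ifs with hv
    · simp [hv]
    · simp [hv]
  rw [h, h]
  refine Finset.sum_congr rfl fun w _ => ?_
  rw [Finset.sum_comm]
  refine Finset.sum_congr rfl fun u _ => ?_
  refine Finset.sum_congr rfl fun v _ => ?_
  rw [Equiv.swap_comm u v]
  refine if_congr ?_ rfl rfl
  rw [and_comm (a := w u = i), ne_comm]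

/-- Compare the colourings that differ in the colour, `i` or `j`, of one point `v` only: multiplied
by `1 + ∑_u (u v)`, where `u` runs over the points other than `v` in the class of the other colour,
their Young symmetrizers have the same image under the characteristic map. -/
theorem X_mul_crossSum_add (p : ℕ → A) (i j : Fin N) :
    MvPolynomial.X i * (crossSum N p Ω i j +
        euler j (colourSum N p (1 : MonoidAlgebra ℂ (Equiv.Perm Ω)))) =
      MvPolynomial.X j * (crossSum N p Ω j i +
        euler i (colourSum N p (1 : MonoidAlgebra ℂ (Equiv.Perm Ω)))) := by
  have h : ∀ i j, crossSum N p Ω i j +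
        euler j (colourSum N p (1 : MonoidAlgebra ℂ (Equiv.Perm Ω))) =
      ∑ v : Ω, ∑ w ∈ Finset.univ.filter (fun w : Ω → Fin N => w v = j),
        (∏ ω, MvPolynomial.X (w ω)) *
          MvPolynomial.C (charMap p ((1 + swapSum v w i) * youngSum w)) := by
    intro i j
    rw [crossSum, euler_colourSum, ← Finset.sum_add_distrib]
    refine Finset.sum_congr rfl fun v _ => ?_
    rw [← Finset.sum_add_distrib]
    refine Finset.sum_congr rfl fun w _ => ?_
    rw [add_mul, map_add, map_add]; ring
  rw [h, h, Finset.mul_sum, Finset.mul_sum]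
  refine Finset.sum_congr rfl fun v _ => ?_
  rw [Finset.mul_sum, Finset.mul_sum]
  refine Finset.sum_bij' (fun w _ => Function.update w v i) (fun w _ => Function.update w v j)
    (by simp) (by simp) ?_ ?_ ?_
  · intro w hw
    simp [← (Finset.mem_filter.1 hw).2]
  · intro w hw
    simp [← (Finset.mem_filter.1 hw).2]
  · intro w hw
    have hwv : w v = j := (Finset.mem_filter.1 hw).2
    have key := charMap_one_add_swapSum_mul_youngSum p v w i
    rw [hwv] at key
    rw [key, ← mul_assoc, ← mul_assoc]
    congr 1
    rw [← Finset.mul_prod_erase _ _ (Finset.mem_univ v),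
      ← Finset.mul_prod_erase _ (fun ω => MvPolynomial.X (Function.update w v i ω))
        (Finset.mem_univ v), Function.update_self, hwv,
      Finset.prod_congr rfl fun ω hω => by
        rw [← Function.update_of_ne (Finset.ne_of_mem_erase hω) i w]]
    ring

end Colourings

/-! ### Schur functions as coefficients, and the eigenvalue of the class of transpositions -/

section Vandermonde

variable {A : Type*} [CommRing A] {N : ℕ}

/-- The Vandermonde polynomial `∏_{i < j} (x_j - x_i)`. -/
def vanPoly (A : Type*) [CommRing A] (N : ℕ) : MvPolynomial (Fin N) A :=
  (Matrix.vandermonde (MvPolynomial.X : Fin N → MvPolynomial (Fin N) A)).det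

/-- The exponent of the monomial of the Vandermonde polynomial belonging to `σ`. -/
def vanExponent (σ : Equiv.Perm (Fin N)) : Fin N →₀ ℕ :=
  Finsupp.equivFunOnFinite.symm fun k => (σ.symm k : ℕ)

theorem vanExponent_apply (σ : Equiv.Perm (Fin N)) (k : Fin N) :
    vanExponent σ k = (σ.symm k : ℕ) := rfl

theorem vanPoly_eq_sum :
    vanPoly A N = ∑ σ : Equiv.Perm (Fin N),
      Equiv.Perm.sign σ • MvPolynomial.monomial (vanExponent σ) 1 := by
  rw [vanPoly, Matrix.det_apply]
  refine Finset.sum_congr rfl fun σ _ => ?_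
  congr 1
  rw [MvPolynomial.monomial_eq, Finsupp.prod_fintype _ _ (by simp), map_one, one_mul,
    ← Equiv.prod_comp σ (fun k => (MvPolynomial.X k : MvPolynomial (Fin N) A) ^ vanExponent σ k)]
  simp [Matrix.vandermonde, vanExponent_apply]

theorem vanPoly_eq_prod :
    vanPoly A N = ∏ x ∈ Finset.univ.filter (fun x : Fin N × Fin N => x.1 < x.2),
      (MvPolynomial.X x.2 - MvPolynomial.X x.1) := by
  rw [vanPoly, Matrix.det_vandermonde, Finset.prod_sigma']
  refine Finset.prod_bij' (fun x _ => (x.1, x.2)) (fun x _ => ⟨x.1, x.2⟩) ?_ ?_ ?_ ?_ ?_ <;> simp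

theorem coeff_vanPoly_mul (G : MvPolynomial (Fin N) A) (β : Fin N →₀ ℕ) :
    (vanPoly A N * G).coeff β = ∑ σ : Equiv.Perm (Fin N), (Equiv.Perm.sign σ : ℤ) •
      if vanExponent σ ≤ β then G.coeff (β - vanExponent σ) else 0 := by
  rw [vanPoly_eq_sum, Finset.sum_mul, MvPolynomial.coeff_sum]
  refine Finset.sum_congr rfl fun σ _ => ?_
  rw [smul_mul_assoc, Units.smul_def, MvPolynomial.coeff_smul, MvPolynomial.coeff_monomial_mul']
  simp

theorem euler_monomial (i : Fin N) (α : Fin N →₀ ℕ) (a : A) :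
    euler i (MvPolynomial.monomial α a) = (α i : A) • MvPolynomial.monomial α a := by
  ext β
  rw [coeff_euler, MvPolynomial.coeff_smul, MvPolynomial.coeff_monomial, smul_eq_mul]
  split_ifs with h
  · rw [h]
  · simp

theorem sum_euler_vanPoly :
    ∑ i, euler i (vanPoly A N) = ((∑ i : Fin N, (i : ℕ) : ℕ) : A) • vanPoly A N := by
  rw [vanPoly_eq_sum, Finset.smul_sum]
  simp_rw [map_sum, Units.smul_def, map_zsmul, euler_monomial]
  rw [Finset.sum_comm]
  refine Finset.sum_congr rfl fun σ _ => ?_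
  rw [← Finset.smul_sum, ← Finset.sum_smul, smul_comm, ← σ.symm.sum_comp (fun i => (i : ℕ))]
  push_cast
  rfl

theorem sum_euler_euler_vanPoly :
    ∑ i, euler i (euler i (vanPoly A N)) =
      ((∑ i : Fin N, (i : ℕ) ^ 2 : ℕ) : A) • vanPoly A N := by
  rw [vanPoly_eq_sum, Finset.smul_sum]
  simp_rw [map_sum, Units.smul_def, map_zsmul, euler_monomial, Derivation.map_smul, euler_monomial]
  rw [Finset.sum_comm]
  refine Finset.sum_congr rfl fun σ _ => ?_
  simp_rw [smul_smul]
  rw [← Finset.smul_sum, ← Finset.sum_smul, smul_comm, ← σ.symm.sum_comp (fun i => (i : ℕ) ^ 2)]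
  push_cast
  simp_rw [← sq]
  rfl

theorem sum_sum_eq_sum_diag_add {M : Type*} [AddCommMonoid M] (f : Fin N → Fin N → M) :
    ∑ i, ∑ j, f i j = ∑ i, f i i +
      ∑ x ∈ Finset.univ.filter (fun x : Fin N × Fin N => x.1 < x.2), (f x.1 x.2 + f x.2 x.1) := by
  rw [← Fintype.sum_prod_type', Finset.sum_add_distrib,
    ← Finset.sum_filter_add_sum_filter_not Finset.univ (fun x : Fin N × Fin N => x.1 = x.2),
    ← Finset.sum_filter_add_sum_filter_not
      (Finset.univ.filter fun x : Fin N × Fin N => ¬ x.1 = x.2)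
      (fun x : Fin N × Fin N => x.1 < x.2)]
  congr 1
  · refine Finset.sum_bij' (fun x _ => x.1) (fun i _ => (i, i)) ?_ ?_ ?_ ?_ ?_ <;> aesop
  · congr 1
    · refine Finset.sum_congr ?_ fun _ _ => rfl
      ext x
      simp only [Finset.mem_filter, Finset.mem_univ, true_and]
      exact ⟨fun h => h.2, fun h => ⟨h.ne, h⟩⟩
    · refine Finset.sum_bij' (fun x _ => (x.2, x.1)) (fun x _ => (x.2, x.1)) ?_ ?_ ?_ ?_ ?_
      · intro x hx
        simp only [Finset.mem_filter, Finset.mem_univ, true_and] at hx ⊢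
        exact lt_of_le_of_ne (not_lt.1 hx.2) (Ne.symm hx.1)
      · intro x hx
        simp only [Finset.mem_filter, Finset.mem_univ, true_and] at hx ⊢
        exact ⟨hx.ne', hx.not_gt⟩
      all_goals simp

theorem derivation_prod {R B ι : Type*} [CommRing R] [CommRing B] [Algebra R B] [DecidableEq ι]
    (D : Derivation R B B) (s : Finset ι) (f : ι → B) :
    D (∏ i ∈ s, f i) = ∑ i ∈ s, (∏ j ∈ s.erase i, f j) * D (f i) := by
  induction s using Finset.induction_on with
  | empty => simp
  | insert a s ha ih =>
    rw [Finset.prod_insert ha, Derivation.leibniz, Finset.sum_insert ha, Finset.erase_insert ha,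
      ih, smul_eq_mul, smul_eq_mul, Finset.mul_sum, add_comm]
    congr 1
    refine Finset.sum_congr rfl fun i hi => ?_
    rw [Finset.erase_insert_of_ne (fun h : a = i => ha (h ▸ hi)),
      Finset.prod_insert (fun h => ha (Finset.mem_of_mem_erase h)), mul_assoc]

end Vandermonde

section Eigen

variable {A : Type*} [CommRing A] [Algebra ℂ A] {Ω : Type*} [Fintype Ω] [DecidableEq Ω] {N : ℕ}

/-- After multiplication by the Vandermonde polynomial, the class of transpositions acts on the
generating polynomial of the Young symmetrizers by a polynomial in the Euler operators. -/
theorem vanPoly_mul_colourSum_twiceTranspositions (p : ℕ → A) :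
    vanPoly A N * colourSum N p (twiceTranspositions Ω) =
      ∑ i, euler i (euler i
        (vanPoly A N * colourSum N p (1 : MonoidAlgebra ℂ (Equiv.Perm Ω)))) -
      ((∑ i : Fin N, (i : ℕ) ^ 2 : ℕ) : A) •
        (vanPoly A N * colourSum N p (1 : MonoidAlgebra ℂ (Equiv.Perm Ω))) -
      (2 * N - 1 : A) • (∑ i, euler i
        (vanPoly A N * colourSum N p (1 : MonoidAlgebra ℂ (Equiv.Perm Ω))) -
      ((∑ i : Fin N, (i : ℕ) : ℕ) : A) •
        (vanPoly A N * colourSum N p (1 : MonoidAlgebra ℂ (Equiv.Perm Ω)))) := by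
  set F := colourSum N p (1 : MonoidAlgebra ℂ (Equiv.Perm Ω))
  set a := vanPoly A N with ha
  set P := Finset.univ.filter (fun x : Fin N × Fin N => x.1 < x.2)
  set b : Fin N × Fin N → MvPolynomial (Fin N) A := fun x =>
    ∏ y ∈ P.erase x, (MvPolynomial.X y.2 - MvPolynomial.X y.1) with hb
  have hab : ∀ x ∈ P, a = b x * (MvPolynomial.X x.2 - MvPolynomial.X x.1) := fun x hx => by
    rw [ha, vanPoly_eq_prod, ← Finset.prod_erase_mul _ _ hx]
  -- the logarithmic derivative of the Vandermonde polynomial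
  have hda : ∀ k, euler k a = ∑ x ∈ P, b x *
      ((if k = x.2 then MvPolynomial.X k else 0) - if k = x.1 then MvPolynomial.X k else 0) := by
    intro k
    rw [ha, vanPoly_eq_prod, derivation_prod]
    refine Finset.sum_congr rfl fun x _ => ?_
    rw [map_sub, euler_X, euler_X]
  have hcross : ∑ k, euler k a * euler k F =
      ∑ x ∈ P, b x * (MvPolynomial.X x.2 * euler x.2 F - MvPolynomial.X x.1 * euler x.1 F) := by
    simp_rw [hda, Finset.sum_mul]
    rw [Finset.sum_comm]
    refine Finset.sum_congr rfl fun x _ => ?_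
    simp_rw [mul_assoc, ← Finset.mul_sum, sub_mul, ite_mul, zero_mul]
    rw [Finset.sum_sub_distrib, Finset.sum_ite_eq', Finset.sum_ite_eq']
    simp
  have hpair : ∀ x ∈ P, a * crossSum N p Ω x.1 x.2 =
      b x * (MvPolynomial.X x.2 * euler x.2 F - MvPolynomial.X x.1 * euler x.1 F) -
        a * (euler x.1 F + euler x.2 F) := by
    intro x hx
    have h := X_mul_crossSum_add (Ω := Ω) p x.1 x.2
    rw [crossSum_comm p x.2 x.1] at h
    rw [hab x hx]
    linear_combination (-b x) * h
  have hcount : ∑ x ∈ P, (euler x.1 F + euler x.2 F) = ((N : A) - 1) • ∑ k, euler k F := by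
    have h := sum_sum_eq_sum_diag_add (fun i _ : Fin N => euler i F)
    simp only [Finset.sum_const, Finset.card_univ, Fintype.card_fin, nsmul_eq_mul] at h
    rw [← Finset.mul_sum] at h
    rw [MvPolynomial.smul_eq_C_mul, map_sub, map_natCast, map_one, sub_mul, h]
    ring
  have hdiag : ∑ i, ∑ j, crossSum N p Ω i j =
      ∑ i, crossSum N p Ω i i + 2 * ∑ x ∈ P, crossSum N p Ω x.1 x.2 := by
    rw [sum_sum_eq_sum_diag_add, Finset.mul_sum]
    congr 1
    refine Finset.sum_congr rfl fun x _ => ?_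
    rw [crossSum_comm p x.2 x.1, two_mul]
  have h1 : ∑ i, euler i (a * F) = (∑ i, euler i a) * F + a * ∑ i, euler i F := by
    simp_rw [Derivation.leibniz, smul_eq_mul]
    rw [Finset.sum_add_distrib, Finset.mul_sum, Finset.sum_mul, add_comm]
    simp_rw [mul_comm F]
  have h2 : ∑ i, euler i (euler i (a * F)) = (∑ i, euler i (euler i a)) * F +
      2 * ∑ i, euler i a * euler i F + a * ∑ i, euler i (euler i F) := by
    rw [Finset.mul_sum, Finset.mul_sum, Finset.sum_mul, ← Finset.sum_add_distrib,
      ← Finset.sum_add_distrib]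
    refine Finset.sum_congr rfl fun i _ => ?_
    simp only [Derivation.leibniz, smul_eq_mul, map_add]
    ring
  rw [h1, h2, sum_euler_vanPoly, sum_euler_euler_vanPoly, colourSum_twiceTranspositions, hdiag,
    mul_add, mul_left_comm, Finset.mul_sum (s := P), Finset.sum_congr rfl hpair,
    Finset.sum_sub_distrib, ← hcross, ← Finset.mul_sum, hcount]
  simp_rw [crossSum_self]
  rw [Finset.sum_sub_distrib]
  simp only [MvPolynomial.smul_eq_C_mul, map_sub, map_mul, map_one, map_natCast, map_ofNat]
  ring

/-- The eigenvalue of twice the class of transpositions. -/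
def twiceContent (β : Fin N →₀ ℕ) : ℤ :=
  ∑ i, ((β i : ℤ) ^ 2 - (i : ℤ) ^ 2) - (2 * N - 1) * ∑ i, ((β i : ℤ) - (i : ℤ))

theorem coeff_vanPoly_mul_colourSum_twiceTranspositions (p : ℕ → A) (β : Fin N →₀ ℕ) :
    (vanPoly A N * colourSum N p (twiceTranspositions Ω)).coeff β = (twiceContent β : A) *
      (vanPoly A N * colourSum N p (1 : MonoidAlgebra ℂ (Equiv.Perm Ω))).coeff β := by
  rw [vanPoly_mul_colourSum_twiceTranspositions]
  simp only [MvPolynomial.coeff_sub, MvPolynomial.coeff_smul, MvPolynomial.coeff_sum, coeff_euler,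
    smul_eq_mul, twiceContent]
  simp_rw [← mul_assoc, ← Finset.sum_mul]
  push_cast
  simp_rw [← sq, Finset.sum_sub_distrib]
  ring

/-- The coefficients of the generating polynomial of the Young symmetrizers are, up to `n!`, the
products of complete functions. -/
theorem coeff_colourSum_one (p : ℕ → A) (α : Fin N →₀ ℕ) :
    (colourSum N p (1 : MonoidAlgebra ℂ (Equiv.Perm Ω))).coeff α =
      if ∑ i, α i = Fintype.card Ω then
        ((Fintype.card Ω).factorial : A) * ∏ i, hSum p (α i) else 0 := by
  -- summing over the permutations first, the colourings fixed by `h` contribute a power sum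
  have h1 : colourSum N p (1 : MonoidAlgebra ℂ (Equiv.Perm Ω)) =
      ∑ h : Equiv.Perm Ω,
        cycProd (fun j => ∑ i : Fin N, MvPolynomial.C (p j) * MvPolynomial.X i ^ j) h := by
    have h2 : ∀ w : Ω → Fin N, (∏ ω, MvPolynomial.X (w ω)) *
        MvPolynomial.C (charMap p ((1 : MonoidAlgebra ℂ (Equiv.Perm Ω)) * youngSum w)) =
        ∑ h : Equiv.Perm Ω, if w ∘ h = w then
          MvPolynomial.C (cycProd p h) * (∏ ω, MvPolynomial.X (w ω)) else 0 := by
      intro w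
      rw [one_mul, youngSum, map_sum, map_sum, Finset.mul_sum, Finset.sum_filter]
      simp_rw [charMap_of, mul_comm]
    unfold colourSum
    simp_rw [h2]
    rw [Finset.sum_comm]
    refine Finset.sum_congr rfl fun h _ => ?_
    rw [← Finset.sum_filter, ← Finset.mul_sum, sum_prod_comp_eq_self]
    simp_rw [← Finset.mul_sum]
    rw [cycProd, cycProd, cycProd, Multiset.prod_map_mul, map_multiset_prod, Multiset.map_map]
    rfl
  have h3 : hSum (fun j => ∑ i : Fin N, MvPolynomial.C (p j) * MvPolynomial.X i ^ j)
      (Fintype.card Ω) = ∑ l ∈ Finset.finsuppAntidiag Finset.univ (Fintype.card Ω),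
        ∏ i, (MvPolynomial.C (hSum p (l i)) * MvPolynomial.X i ^ l i) := by
    have h4 := congrArg (PowerSeries.coeff (Fintype.card Ω)) (hSeries_sum Finset.univ
      (fun (i : Fin N) (j : ℕ) => (MvPolynomial.C (p j) * MvPolynomial.X i ^ j :
        MvPolynomial (Fin N) A)))
    rw [PowerSeries.coeff_prod] at h4
    simp only [hSeries, PowerSeries.coeff_mk, hSum_mul_pow] at h4
    convert h4 using 1
    · congr 1
      ext j
      simp
    · refine Finset.sum_congr rfl fun l _ => Finset.prod_congr rfl fun i _ => ?_
      congr 1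
      exact map_hSum (IsScalarTower.toAlgHom ℂ A (MvPolynomial (Fin N) A)) p (l i)
  rw [h1, sum_cycProd, h3, ← map_natCast (MvPolynomial.C (σ := Fin N) (R := A)),
    MvPolynomial.coeff_C_mul, MvPolynomial.coeff_sum]
  have h5 : ∀ l : Fin N →₀ ℕ, MvPolynomial.coeff α
      (∏ i, (MvPolynomial.C (hSum p (l i)) * MvPolynomial.X i ^ l i)) =
      if l = α then ∏ i, hSum p (α i) else 0 := by
    intro l
    rw [Finset.prod_mul_distrib, ← map_prod, MvPolynomial.coeff_C_mul,
      ← Finsupp.prod_fintype l (fun i k => (MvPolynomial.X i : MvPolynomial (Fin N) A) ^ k)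
        (by simp)]
    have := MvPolynomial.monomial_eq (s := l) (a := (1 : A))
    rw [MvPolynomial.C_1, one_mul] at this
    rw [← this, MvPolynomial.coeff_monomial]
    split_ifs with h
    · rw [h, mul_one]
    · simp
  simp_rw [h5]
  rw [Finset.sum_ite_eq', mul_ite, mul_zero]
  refine if_congr ?_ rfl rfl
  rw [Finset.mem_finsuppAntidiag]
  simp

end Eigen

/-! ### Jacobi-Trudi determinants -/

section Determinants

variable {A : Type*} [CommRing A] {n : Type*} [Fintype n] [DecidableEq n]

/-- Both sides are the derivative of `det (M + x M')` at `x = 0`, expanded by rows and by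
columns. -/
theorem sum_det_updateRow_eq_sum_det_updateCol (M M' : Matrix n n A) :
    ∑ i, (M.updateRow i (M' i)).det = ∑ j, (M.updateCol j fun i => M' i j).det := by
  have h1 : ∀ i, (M.updateRow i (M' i)).det = ∑ j, M' i j * M.adjugate j i := by
    intro i
    rw [← Matrix.cramer_transpose_apply, Matrix.cramer_eq_adjugate_mulVec,
      ← Matrix.adjugate_transpose]
    simp [Matrix.mulVec, dotProduct, mul_comm]
  have h2 : ∀ j, (M.updateCol j fun i => M' i j).det = ∑ i, M' i j * M.adjugate j i := by
    intro j
    rw [← Matrix.cramer_apply, Matrix.cramer_eq_adjugate_mulVec]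
    simp [Matrix.mulVec, dotProduct, mul_comm]
  simp_rw [h1, h2]
  exact Finset.sum_comm

theorem derivation_det {R : Type*} [CommRing R] [Algebra R A] (D : Derivation R A A)
    (M : Matrix n n A) :
    D M.det = ∑ i, (M.updateRow i fun j => D (M i j)).det := by
  simp_rw [Matrix.det_apply, map_sum, Units.smul_def, map_zsmul]
  rw [Finset.sum_comm]
  refine Finset.sum_congr rfl fun σ _ => ?_
  rw [← Finset.smul_sum]
  congr 1
  rw [derivation_prod, ← Equiv.sum_comp σ fun i =>
    ∏ k, (M.updateRow i fun j => D (M i j)) (σ k) k]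
  refine Finset.sum_congr rfl fun k _ => ?_
  rw [← Finset.prod_erase_mul _ _ (Finset.mem_univ k), Matrix.updateRow_self]
  congr 1
  refine Finset.prod_congr rfl fun j hj => ?_
  rw [Matrix.updateRow_ne]
  exact fun h => Finset.ne_of_mem_erase hj (σ.injective h)

theorem updateRow_eq_of_add_single {B : Type*} {N : ℕ} (f : ℤ → ℕ → B) (β : Fin N → ℤ) (i : Fin N)
    (a : ℤ) :
    (Matrix.of fun k j : Fin N => f (β k) j).updateRow i (fun j => f (β i + a) j) =
      Matrix.of fun k j : Fin N => f ((β + Pi.single i a : Fin N → ℤ) k) j := by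
  ext k j
  by_cases h : k = i
  · subst h; simp
  · simp [h]

end Determinants

section SchurVector

variable {A : Type*} [CommRing A] [Algebra ℂ A] {N : ℕ}

/-- The Jacobi-Trudi determinant `det (h_{β_i - j})`, `0 ≤ i, j < N`, of an integer vector `β`.
It is alternating in `β`; for weakly increasing `m` and `β_i = m_i + i` it is the Schur function of
the partition with parts `m_i`. -/
def schurVec (u : ℕ → A) (β : Fin N → ℤ) : A :=
  Matrix.det (Matrix.of fun i j : Fin N => complete u (β i - (j : ℤ)))

theorem complete_zero (u : ℕ → A) : complete u 0 = 1 := by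
  simpa [hSum_zero] using complete_natCast u 0

theorem complete_one (u : ℕ → A) : complete u 1 = powerSum u 1 := by
  have h := natCast_mul_hSum_succ (powerSum u) 0
  simp only [zero_add, Nat.cast_one, one_mul, Finset.range_one, Finset.sum_singleton, tsub_self,
    hSum_zero, mul_one] at h
  simpa [h] using complete_natCast u 1

theorem schurVec_eq_zero_of_eq (u : ℕ → A) {β : Fin N → ℤ} {i j : Fin N} (hij : i ≠ j)
    (h : β i = β j) : schurVec u β = 0 :=
  Matrix.det_zero_of_row_eq hij (by ext k; simp [h])

theorem schurVec_eq_zero_of_neg (u : ℕ → A) {β : Fin N → ℤ} {i : Fin N} (h : β i < 0) :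
    schurVec u β = 0 :=
  Matrix.det_eq_zero_of_row_eq_zero i fun j => complete_of_neg u (by omega)

/-- Shifting all the indices in one column of a Jacobi-Trudi matrix to those of another column
gives a vanishing determinant. -/
theorem det_updateCol_eq_zero (u : ℕ → A) (β : Fin N → ℤ) {j j' : Fin N} (h : j ≠ j') :
    ((Matrix.of fun i j : Fin N => complete u (β i - (j : ℤ))).updateCol j
      fun i => complete u (β i - (j' : ℤ))).det = 0 :=
  Matrix.det_zero_of_column_eq h fun i => by
    rw [Matrix.updateCol_self, Matrix.updateCol_ne h.symm, Matrix.of_apply]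

theorem schurVec_add_single (u : ℕ → A) (β : Fin N → ℤ) (i : Fin N) (a : ℤ) :
    schurVec u (β + Pi.single i a) = ((Matrix.of fun i j : Fin N =>
      complete u (β i - (j : ℤ))).updateRow i fun j => complete u (β i + a - (j : ℤ))).det := by
  rw [schurVec, updateRow_eq_of_add_single (fun b j => complete u (b - (j : ℤ)))]

/-- Pieri's rule for `p_1`, before removing the vanishing terms. -/
theorem powerSum_one_mul_schurVec (u : ℕ → A) (β : Fin (N + 1) → ℤ) (hβ : β 0 = 0) :
    powerSum u 1 * schurVec u β = ∑ i, schurVec u (β + Pi.single i 1) := by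
  simp_rw [schurVec_add_single]
  rw [sum_det_updateRow_eq_sum_det_updateCol _
    (fun i j => complete u (β i + 1 - (j : ℤ))), Fin.sum_univ_succ, Finset.sum_eq_zero, add_zero]
  · rw [schurVec, Matrix.det_succ_row_zero, Matrix.det_succ_row_zero, Fin.sum_univ_succ,
      Fin.sum_univ_succ, Finset.sum_eq_zero, Finset.sum_eq_zero]
    · have h : (Matrix.updateCol (Matrix.of fun i j : Fin (N + 1) => complete u (β i - (j : ℤ))) 0
          fun i => complete u (β i + 1 - ((0 : Fin (N + 1)) : ℤ))).submatrix
            (Fin.succ : Fin N → _) (Fin.succAbove 0) =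
          (Matrix.of fun i j : Fin (N + 1) => complete u (β i - (j : ℤ))).submatrix
            (Fin.succ : Fin N → _) (Fin.succAbove 0) := by
        ext i j
        simp [Matrix.submatrix_apply]
      rw [h]
      simp [hβ, complete_zero, complete_one]
    · intro j _
      have : complete u (-1 + -((j : ℕ) : ℤ)) = 0 := complete_of_neg u (by omega)
      simp [hβ, this]
    · intro j _
      have : complete u (-1 + -((j : ℕ) : ℤ)) = 0 := complete_of_neg u (by omega)
      simp [hβ, this]
  · intro j _
    convert det_updateCol_eq_zero u β (Fin.castSucc_lt_succ (i := j)).ne' using 4 with i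
    congr 1
    simp

variable (D : Derivation ℂ A A) {u : ℕ → A}

theorem derivation_complete_of_nonpos {k : ℤ} (hk : k ≤ 0) : D (complete u k) = 0 := by
  rcases hk.lt_or_eq with h | h
  · rw [complete_of_neg u h, map_zero]
  · rw [h, complete_zero, Derivation.map_one_eq_zero]

theorem derivation_complete_succ (n : ℕ) :
    D (complete u (n + 1 : ℕ)) =
      ∑ i ∈ Finset.range (n + 1), D (u i) * hSum (powerSum u) (n - i) := by
  rw [complete_natCast]
  refine derivation_hSum D _ (fun j => D (u j)) (fun j => ?_) n
  rw [powerSum, Derivation.leibniz]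
  simp

/-- The derivation `∂/∂t_1`. -/
theorem derivation_complete_of_lower (hD : ∀ k, D (u k) = if k = 0 then 1 else 0) (k : ℤ) :
    D (complete u k) = complete u (k - 1) := by
  rcases le_or_gt k 0 with hk | hk
  · rw [derivation_complete_of_nonpos D hk, complete_of_neg u (by omega)]
  · obtain ⟨n, rfl⟩ : ∃ n : ℕ, k = (n + 1 : ℕ) := ⟨(k - 1).toNat, by omega⟩
    rw [derivation_complete_succ]
    simp_rw [hD]
    rw [show (((n + 1 : ℕ) : ℤ) - 1) = (n : ℕ) by push_cast; ring, complete_natCast]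
    simp

/-- The derivation `∑_m m t_m ∂/∂t_{m+1}`. -/
theorem derivation_complete_of_lower' (hD : ∀ k, D (u k) = powerSum u k) (k : ℤ) :
    D (complete u k) = ((k - 1 : ℤ) : A) * complete u (k - 1) := by
  rcases le_or_gt k 0 with hk | hk
  · rw [derivation_complete_of_nonpos D hk, complete_of_neg u (by omega), mul_zero]
  · obtain ⟨n, rfl⟩ : ∃ n : ℕ, k = (n + 1 : ℕ) := ⟨(k - 1).toNat, by omega⟩
    rw [derivation_complete_succ]
    simp_rw [hD]
    rw [show (((n + 1 : ℕ) : ℤ) - 1) = (n : ℕ) by push_cast; ring, complete_natCast]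
    cases n with
    | zero => simp [powerSum]
    | succ n =>
      rw [Finset.sum_range_succ', Int.cast_natCast, natCast_mul_hSum_succ]
      simp [powerSum]

/-- The derivation `∑_m (m + 1) t_{m+1} ∂/∂t_m`. -/
theorem derivation_complete_of_raise (hD : ∀ k, D (u k) = powerSum u (k + 2)) (k : ℤ) :
    D (complete u k) =
      ((k + 1 : ℤ) : A) * complete u (k + 1) - powerSum u 1 * complete u k := by
  rcases lt_trichotomy k 0 with hk | rfl | hk
  · rw [derivation_complete_of_nonpos D hk.le, complete_of_neg u hk, mul_zero, sub_zero]
    rcases (show k + 1 < 0 ∨ k + 1 = 0 by omega) with h | h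
    · rw [complete_of_neg u h, mul_zero]
    · simp [h]
  · rw [derivation_complete_of_nonpos D le_rfl]
    simp [complete_zero, complete_one]
  · obtain ⟨n, rfl⟩ : ∃ n : ℕ, k = (n + 1 : ℕ) := ⟨(k - 1).toNat, by omega⟩
    rw [derivation_complete_succ]
    simp_rw [hD]
    rw [show (((n + 1 : ℕ) : ℤ) + 1) = (n + 2 : ℕ) by push_cast; ring, complete_natCast,
      complete_natCast, Int.cast_natCast, natCast_mul_hSum_succ, Finset.sum_range_succ' _ (n + 1)]
    simp

/-- `∂/∂t_1` removes boxes. -/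
theorem derivation_schurVec_of_lower (hD : ∀ k, D (u k) = if k = 0 then 1 else 0)
    (β : Fin N → ℤ) : D (schurVec u β) = ∑ i, schurVec u (β - Pi.single i 1) := by
  simp_rw [sub_eq_add_neg, ← Pi.single_neg, schurVec_add_single]
  rw [schurVec, derivation_det]
  simp_rw [Matrix.of_apply, derivation_complete_of_lower D hD]
  refine Finset.sum_congr rfl fun i _ => ?_
  congr 3
  ext j
  congr 1
  ring

/-- `∑_m m t_m ∂/∂t_{m+1}` removes boxes, each weighted by its content. -/
theorem derivation_schurVec_of_lower' (hD : ∀ k, D (u k) = powerSum u k) (β : Fin N → ℤ) :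
    D (schurVec u β) = ∑ i, ((β i - N : ℤ) : A) * schurVec u (β - Pi.single i 1) := by
  set M := Matrix.of fun i j : Fin N => complete u (β i - (j : ℤ)) with hM
  have h1 : ∀ i, schurVec u (β - Pi.single i 1) =
      (M.updateRow i fun j => complete u (β i + (-1) - (j : ℤ))).det := fun i => by
    rw [sub_eq_add_neg, ← Pi.single_neg, schurVec_add_single]
  have h2 : ∀ i, (M.updateRow i fun j => D (M i j)).det =
      ((β i - 1 : ℤ) : A) * schurVec u (β - Pi.single i 1) -
        (M.updateRow i fun j => ((j : ℕ) : A) * complete u (β i + (-1) - (j : ℤ))).det := by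
    intro i
    have hrow : (fun j => D (M i j)) =
        ((β i - 1 : ℤ) : A) • (fun j : Fin N => complete u (β i + (-1) - (j : ℤ))) +
          (-1 : A) • fun j : Fin N => ((j : ℕ) : A) * complete u (β i + (-1) - (j : ℤ)) := by
      ext j
      simp only [hM, Matrix.of_apply, derivation_complete_of_lower' D hD, Pi.add_apply,
        Pi.smul_apply, smul_eq_mul]
      rw [show β i - (j : ℤ) - 1 = β i + (-1) - j by ring]
      push_cast
      ring
    rw [h1, hrow, Matrix.det_updateRow_add, Matrix.det_updateRow_smul,
      Matrix.det_updateRow_smul]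
    ring
  have hcol : ∀ j : Fin N, (M.updateCol j fun i =>
      ((j : ℕ) : A) * complete u (β i + (-1) - (j : ℤ))).det =
        ((N : A) - 1) * (M.updateCol j fun i => complete u (β i + (-1) - (j : ℤ))).det := by
    intro j
    have hsm := Matrix.det_updateCol_smul M j ((j : ℕ) : A)
      (fun i => complete u (β i + (-1) - (j : ℤ)))
    refine Eq.trans hsm ?_
    by_cases hj : (j : ℕ) + 1 = N
    · congr 1
      have h : (N : A) = (j : ℕ) + 1 := by exact_mod_cast congrArg Nat.cast hj.symm
      rw [h]; ring
    · have : (M.updateCol j fun i => complete u (β i + (-1) - (j : ℤ))).det = 0 := by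
        convert det_updateCol_eq_zero u β (j := j) (j' := ⟨j + 1, by omega⟩)
          (by simp [Fin.ext_iff]) using 4 with i
        congr 1
        push_cast; ring
      rw [this, mul_zero, mul_zero]
  rw [schurVec, derivation_det]
  simp_rw [← hM, h2]
  rw [Finset.sum_sub_distrib, sum_det_updateRow_eq_sum_det_updateCol M
    (fun i j => ((j : ℕ) : A) * complete u (β i + (-1) - (j : ℤ)))]
  simp_rw [hcol]
  rw [← Finset.mul_sum, ← sum_det_updateRow_eq_sum_det_updateCol M
    (fun i j => complete u (β i + (-1) - (j : ℤ))), Finset.mul_sum, ← Finset.sum_sub_distrib]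
  refine Finset.sum_congr rfl fun i _ => ?_
  rw [← h1]
  push_cast; ring

/-- `∑_m (m + 1) t_{m+1} ∂/∂t_m` adds boxes, each weighted by its content. The condition on `β 0`
says that there is an empty row. -/
theorem derivation_schurVec_of_raise (hD : ∀ k, D (u k) = powerSum u (k + 2))
    (β : Fin (N + 1) → ℤ) (hβ : β 0 = 0) :
    D (schurVec u β) =
      ∑ i, ((β i - N : ℤ) : A) * schurVec u (β + Pi.single i 1) := by
  set M := Matrix.of fun i j : Fin (N + 1) => complete u (β i - (j : ℤ)) with hM
  have h2 : ∀ i, (M.updateRow i fun j => D (M i j)).det =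
      ((β i + 1 : ℤ) : A) * schurVec u (β + Pi.single i 1) -
        (M.updateRow i fun j => ((j : ℕ) : A) * complete u (β i + 1 - (j : ℤ))).det -
        powerSum u 1 * schurVec u β := by
    intro i
    have hrow : (fun j => D (M i j)) =
        ((β i + 1 : ℤ) : A) • (fun j : Fin (N + 1) => complete u (β i + 1 - (j : ℤ))) +
          (-1 : A) • (fun j : Fin (N + 1) => ((j : ℕ) : A) * complete u (β i + 1 - (j : ℤ))) +
          (-powerSum u 1) • M i := by
      ext j
      simp only [hM, Matrix.of_apply, derivation_complete_of_raise D hD, Pi.add_apply,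
        Pi.smul_apply, smul_eq_mul]
      rw [show β i - (j : ℤ) + 1 = β i + 1 - j by ring]
      push_cast
      ring
    rw [schurVec_add_single, hrow, Matrix.det_updateRow_add, Matrix.det_updateRow_add,
      Matrix.det_updateRow_smul, Matrix.det_updateRow_smul, Matrix.det_updateRow_smul,
      Matrix.updateRow_eq_self, schurVec, ← hM]
    ring
  have hcol : ∀ j : Fin (N + 1), (M.updateCol j fun i =>
      ((j : ℕ) : A) * complete u (β i + 1 - (j : ℤ))).det = 0 := by
    intro j
    have hsm := Matrix.det_updateCol_smul M j ((j : ℕ) : A)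
      (fun i => complete u (β i + 1 - (j : ℤ)))
    refine Eq.trans hsm ?_
    induction j using Fin.cases with
    | zero => simp
    | succ j =>
      convert mul_zero _ using 2
      convert det_updateCol_eq_zero u β (Fin.castSucc_lt_succ (i := j)).ne' using 4 with i
      congr 1
      simp
  rw [schurVec, derivation_det]
  simp_rw [← hM, h2]
  rw [Finset.sum_sub_distrib, Finset.sum_sub_distrib, sum_det_updateRow_eq_sum_det_updateCol M
    (fun i j => ((j : ℕ) : A) * complete u (β i + 1 - (j : ℤ)))]
  simp_rw [hcol]
  rw [Finset.sum_const_zero, sub_zero, Finset.sum_const, Finset.card_univ, Fintype.card_fin,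
    powerSum_one_mul_schurVec u β hβ, nsmul_eq_mul, Finset.mul_sum, ← Finset.sum_sub_distrib]
  refine Finset.sum_congr rfl fun i _ => ?_
  push_cast; ring

end SchurVector

/-! ### The Cauchy identity -/

/-- The partitions of `n` with at most `N` parts, as weakly increasing vectors. -/
def monoVec (N n : ℕ) : Finset (Fin N → ℕ) :=
  (Finset.piAntidiag Finset.univ n).filter Monotone

theorem mem_monoVec {N n : ℕ} {m : Fin N → ℕ} :
    m ∈ monoVec N n ↔ ∑ i, m i = n ∧ Monotone m := by
  simp [monoVec, Finset.mem_piAntidiag]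

/-- The strictly increasing vector `m_i + i`. -/
def shiftVec {N : ℕ} (m : Fin N → ℕ) (i : Fin N) : ℤ := m i + (i : ℕ)

theorem shiftVec_add_single {N : ℕ} (m : Fin N → ℕ) (i : Fin N) :
    shiftVec (m + Pi.single i 1) = shiftVec m + Pi.single i 1 := by
  ext k
  by_cases h : k = i
  · subst h; simp [shiftVec]; ring
  · simp [shiftVec, h]

theorem zero_eq_of_mem_monoVec {N n : ℕ} {m : Fin (N + 1) → ℕ} (hm : m ∈ monoVec (N + 1) n)
    (hn : n ≤ N) : m 0 = 0 := by
  obtain ⟨h1, h2⟩ := mem_monoVec.1 hm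
  by_contra h
  have : ∑ _i : Fin (N + 1), 1 ≤ ∑ i, m i :=
    Finset.sum_le_sum fun i _ => (Nat.one_le_iff_ne_zero.2 h).trans (h2 (Fin.zero_le i))
  simp at this
  omega

/-- Either adding a box in row `i` gives a partition again, or two entries of the shifted vector
collide. -/
theorem monotone_add_single_or {N : ℕ} {m : Fin N → ℕ} (hm : Monotone m) (i : Fin N) :
    Monotone (m + Pi.single i 1) ∨
      ∃ j k, j ≠ k ∧ shiftVec (m + Pi.single i 1) j = shiftVec (m + Pi.single i 1) k := by
  by_cases hi : ∃ j : Fin N, (j : ℕ) = i + 1 ∧ m j = m i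
  · obtain ⟨j, hj, hji⟩ := hi
    have hne : j ≠ i := by rintro rfl; omega
    refine Or.inr ⟨i, j, hne.symm, ?_⟩
    simp [shiftVec, hne, hj, hji]
    ring
  · refine Or.inl fun a b hab => ?_
    rcases hab.eq_or_lt with rfl | hlt
    · rfl
    have h1 := hm hab
    by_cases ha : a = i
    · subst ha
      have hlt' : (a : ℕ) < b := hlt
      have hb : b ≠ a := hlt.ne'
      have h2 : m a ≤ m ⟨a + 1, by omega⟩ := hm (by rw [Fin.le_def]; simp)
      have h3 : m ⟨a + 1, by omega⟩ ≤ m b := hm (by rw [Fin.le_def]; simpa using hlt')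
      have h4 : m ⟨a + 1, by omega⟩ ≠ m a := fun h => hi ⟨_, rfl, h⟩
      simp [hb]
      omega
    · simp [ha]
      omega

theorem monotone_sub_single_or {N : ℕ} {m : Fin N → ℕ} (hm : Monotone m) (i : Fin N) :
    (∃ m', Monotone m' ∧ m = m' + Pi.single i 1) ∨
      (∃ j k, j ≠ k ∧ (shiftVec m - Pi.single i 1 : Fin N → ℤ) j =
        (shiftVec m - Pi.single i 1 : Fin N → ℤ) k) ∨
      (shiftVec m - Pi.single i 1 : Fin N → ℤ) i < 0 := by
  by_cases h0 : m i = 0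
  · by_cases hi : (i : ℕ) = 0
    · right; right
      simp [shiftVec, h0, hi]
    · right; left
      have hj : m ⟨i - 1, by omega⟩ = 0 :=
        Nat.le_zero.1 (h0 ▸ hm (by rw [Fin.le_def]; simp))
      have hne : (⟨i - 1, by omega⟩ : Fin N) ≠ i := by
        rw [Ne, Fin.ext_iff]; simp; omega
      refine ⟨⟨i - 1, by omega⟩, i, hne, ?_⟩
      simp [shiftVec, h0, hne, hj]
      omega
  by_cases hi : ∃ j : Fin N, (j : ℕ) + 1 = i ∧ m j = m i
  · obtain ⟨j, hj, hji⟩ := hi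
    have hne : j ≠ i := by rintro rfl; omega
    refine Or.inr (Or.inl ⟨j, i, hne, ?_⟩)
    simp [shiftVec, hne, hji]
    omega
  · left
    have hle : Pi.single i 1 ≤ m := by
      intro k
      by_cases hk : k = i
      · subst hk; simp; omega
      · simp [hk]
    refine ⟨m - Pi.single i 1, fun a b hab => ?_, (tsub_add_cancel_of_le hle).symm⟩
    rcases hab.eq_or_lt with rfl | hlt
    · rfl
    have h1 := hm hab
    by_cases hb : b = i
    · subst hb
      have hlt' : (a : ℕ) < b := hlt
      have ha : a ≠ b := hlt.ne
      have h2 : m a ≤ m ⟨b - 1, by omega⟩ := hm (by rw [Fin.le_def]; simp; omega)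
      have h3 : m ⟨b - 1, by omega⟩ ≤ m b := hm (by rw [Fin.le_def]; simp)
      have h4 : m ⟨b - 1, by omega⟩ ≠ m b := fun h => hi ⟨_, by simp; omega, h⟩
      simp [ha]
      omega
    · simp [hb]
      omega

section Reindex

variable {A : Type*} [CommRing A] [Algebra ℂ A] {N : ℕ}

/-- Removing a box from the first factor and adding a box to the second one amount to the same. -/
theorem sum_schurVec_sub_single_mul (u v : ℕ → A) (w : ℤ → A) (n : ℕ) :
    ∑ m ∈ monoVec N (n + 1), ∑ i, w (shiftVec m i) *
        (schurVec u (shiftVec m - Pi.single i 1) * schurVec v (shiftVec m)) =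
      ∑ m ∈ monoVec N n, ∑ i, w (shiftVec m i + 1) *
        (schurVec u (shiftVec m) * schurVec v (shiftVec m + Pi.single i 1)) := by
  rw [Finset.sum_comm, Finset.sum_comm (s := monoVec N n)]
  refine Finset.sum_congr rfl fun i _ => ?_
  symm
  rw [← Finset.sum_filter_of_ne (p := fun m => Monotone (m + Pi.single i 1))]
  · refine Finset.sum_of_injOn (· + Pi.single i 1) ?_ ?_ ?_ ?_
    · intro a _ b _ h
      exact add_right_cancel h
    · intro m hm
      obtain ⟨hm, hm'⟩ := Finset.mem_filter.1 hm
      obtain ⟨h1, h2⟩ := mem_monoVec.1 hm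
      exact mem_monoVec.2 ⟨by simp [Finset.sum_add_distrib, h1], hm'⟩
    · intro m hm hmi
      obtain ⟨h1, h2⟩ := mem_monoVec.1 hm
      rcases monotone_sub_single_or h2 i with ⟨m', hm', rfl⟩ | ⟨j, k, hjk, h⟩ | h
      · refine absurd ?_ hmi
        refine ⟨m', Finset.mem_coe.2 (Finset.mem_filter.2 ⟨mem_monoVec.2 ⟨?_, hm'⟩, h2⟩), rfl⟩
        simpa [Finset.sum_add_distrib] using h1
      · rw [schurVec_eq_zero_of_eq u hjk h]; simp
      · rw [schurVec_eq_zero_of_neg u h]; simp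
    · intro m _
      simp [shiftVec_add_single]
  · intro m hm h
    obtain ⟨h1, h2⟩ := mem_monoVec.1 hm
    by_contra hc
    obtain ⟨j, k, hjk, h'⟩ := (monotone_add_single_or h2 i).resolve_left hc
    rw [shiftVec_add_single] at h'
    rw [schurVec_eq_zero_of_eq v hjk h'] at h
    simp at h

theorem map_complete {B : Type*} [CommRing B] [Algebra ℂ B] (f : A →ₐ[ℂ] B) (u : ℕ → A) (k : ℤ) :
    f (complete u k) = complete (fun i => f (u i)) k := by
  simp only [complete, powerSumPart, apply_ite f, map_sum, map_mul, AlgHom.commutes, map_zero,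
    map_multiset_prod, Multiset.map_map, Function.comp_def, powerSum, map_natCast]

theorem map_schurVec {B : Type*} [CommRing B] [Algebra ℂ B] (f : A →ₐ[ℂ] B) (u : ℕ → A)
    (β : Fin N → ℤ) : f (schurVec u β) = schurVec (fun i => f (u i)) β := by
  rw [schurVec, AlgHom.map_det]
  congr 1
  ext i j
  simp [map_complete]

theorem complete_flow_zero {k : ℤ} (hk : k ≠ 0) : complete (0 : ℕ → A) k = 0 := by
  rcases lt_or_ge k 0 with h | h
  · exact complete_of_neg _ h
  · obtain ⟨n, rfl⟩ : ∃ n : ℕ, k = (n + 1 : ℕ) := ⟨(k - 1).toNat, by omega⟩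
    rw [complete_natCast]
    have := natCast_mul_hSum_succ (powerSum (0 : ℕ → A)) n
    rw [Finset.sum_eq_zero (fun i _ => by simp [powerSum])] at this
    exact (natCast_succ_isUnit (A := A) n).mul_right_eq_zero.1 this

theorem schurVec_flow_zero {β : Fin N → ℤ} (h : ∑ i, β i ≠ ∑ i : Fin N, ((i : ℕ) : ℤ)) :
    schurVec (0 : ℕ → A) β = 0 := by
  rw [schurVec, Matrix.det_apply]
  refine Finset.sum_eq_zero fun σ _ => ?_
  obtain ⟨i, hi⟩ : ∃ i, β (σ i) - (i : ℕ) ≠ 0 := by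
    by_contra! hc
    apply h
    rw [← Equiv.sum_comp σ]
    exact Finset.sum_congr rfl fun i _ => by linarith [hc i]
  rw [Finset.prod_eq_zero (Finset.mem_univ i), smul_zero]
  rw [Matrix.of_apply, complete_flow_zero hi]

theorem schurVec_shiftVec_zero (u : ℕ → A) : schurVec u (shiftVec (0 : Fin N → ℕ)) = 1 := by
  rw [schurVec, Matrix.det_of_isLowerTriangular]
  · simp [shiftVec, complete_zero]
  · intro i j hij
    have : (i : ℕ) < j := hij
    exact complete_of_neg u (by simp [shiftVec]; omega)

end Reindex

section Constant

variable {A : Type*} [CommRing A] [Algebra ℂ A] {N : ℕ} (D : Derivation ℂ A A) {u : ℕ → A}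

theorem derivation_powerSum_of_const (hD : ∀ k, D (u k) = 0) (j : ℕ) :
    D (powerSum u j) = 0 := by
  rw [powerSum, Derivation.leibniz, hD]
  simp

theorem derivation_schurVec_of_const (hD : ∀ k, D (u k) = 0) (β : Fin N → ℤ) :
    D (schurVec u β) = 0 := by
  have h : ∀ k : ℤ, D (complete u k) = 0 := fun k => by
    rcases le_or_gt k 0 with hk | hk
    · exact derivation_complete_of_nonpos D hk
    · obtain ⟨n, rfl⟩ : ∃ n : ℕ, k = (n + 1 : ℕ) := ⟨(k - 1).toNat, by omega⟩
      rw [derivation_complete_succ]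
      simp [hD]
  rw [schurVec, derivation_det]
  refine Finset.sum_eq_zero fun i _ => Matrix.det_eq_zero_of_row_eq_zero i fun j => ?_
  simp [h]

end Constant

section Cauchy

/-- The flow variables `t` as polynomials. -/
abbrev polyT (k : ℕ) : MvPolynomial (ℕ ⊕ ℕ) ℂ := MvPolynomial.X (Sum.inl k)

/-- The flow variables `s` as polynomials. -/
abbrev polyS (k : ℕ) : MvPolynomial (ℕ ⊕ ℕ) ℂ := MvPolynomial.X (Sum.inr k)

/-- The derivation `∑_m m t_m ∂/∂t_{m+1}`. -/
def lowerT : Derivation ℂ (MvPolynomial (ℕ ⊕ ℕ) ℂ) (MvPolynomial (ℕ ⊕ ℕ) ℂ) :=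
  MvPolynomial.mkDerivation ℂ (Sum.elim (powerSum polyT) 0)

/-- The derivation `∑_m (m + 1) s_{m+1} ∂/∂s_m`. -/
def raiseS : Derivation ℂ (MvPolynomial (ℕ ⊕ ℕ) ℂ) (MvPolynomial (ℕ ⊕ ℕ) ℂ) :=
  MvPolynomial.mkDerivation ℂ (Sum.elim 0 fun k => powerSum polyS (k + 2))

theorem lowerT_polyT (k : ℕ) : lowerT (polyT k) = powerSum polyT k := by simp [lowerT]

theorem lowerT_polyS (k : ℕ) : lowerT (polyS k) = 0 := by simp [lowerT]

theorem raiseS_polyT (k : ℕ) : raiseS (polyT k) = 0 := by simp [raiseS]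

theorem raiseS_polyS (k : ℕ) : raiseS (polyS k) = powerSum polyS (k + 2) := by simp [raiseS]

theorem pderiv_polyT (k : ℕ) :
    MvPolynomial.pderiv (Sum.inl 0) (polyT k) = if k = 0 then 1 else 0 := by
  rw [MvPolynomial.pderiv_X]
  simp [Pi.single_apply]

theorem pderiv_polyS (k : ℕ) : MvPolynomial.pderiv (Sum.inl 0 : ℕ ⊕ ℕ) (polyS k) = 0 := by
  rw [MvPolynomial.pderiv_X]
  simp

theorem pderiv_lowerT (k : ℕ) (f : MvPolynomial (ℕ ⊕ ℕ) ℂ) :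
    MvPolynomial.pderiv (Sum.inl k) (lowerT f) - lowerT (MvPolynomial.pderiv (Sum.inl k) f) =
      ((k : ℂ) + 1) • MvPolynomial.pderiv (Sum.inl (k + 1)) f := by
  have h : ⁅MvPolynomial.pderiv (R := ℂ) (Sum.inl k : ℕ ⊕ ℕ), lowerT⁆ =
      ((k : ℂ) + 1) • MvPolynomial.pderiv (Sum.inl (k + 1)) := by
    refine MvPolynomial.derivation_ext fun i => ?_
    rw [Derivation.commutator_apply]
    rcases i with j | j
    · rw [lowerT_polyT, powerSum, Derivation.leibniz]
      simp only [Derivation.coe_smul, Pi.smul_apply, MvPolynomial.pderiv_X, Pi.single_apply,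
        Sum.inl.injEq, Derivation.map_natCast, smul_zero, add_zero, apply_ite lowerT, map_zero,
        Derivation.map_one_eq_zero, ite_self, sub_zero, smul_eq_mul, mul_ite, mul_one, mul_zero,
        smul_ite]
      rcases j with - | j
      · simp
      · simp only [Nat.add_sub_cancel, add_left_inj]
        split_ifs with h
        · subst h
          rw [MvPolynomial.smul_eq_C_mul]
          simp
        · rfl
    · rw [lowerT_polyS]
      simp [MvPolynomial.pderiv_X]
  rw [← Derivation.commutator_apply, h]
  rfl

/-- A polynomial killed by `∂/∂t_1` and `∑_m m t_m ∂/∂t_{m+1}` does not depend on `t`; hence it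
vanishes if it does so at `t = 0`. -/
theorem eq_zero_of_pderiv_of_lowerT {f : MvPolynomial (ℕ ⊕ ℕ) ℂ}
    (h1 : MvPolynomial.pderiv (Sum.inl 0) f = 0) (h2 : lowerT f = 0)
    (h3 : MvPolynomial.aeval (Sum.elim (fun _ => (0 : MvPolynomial (ℕ ⊕ ℕ) ℂ)) polyS) f = 0) :
    f = 0 := by
  have hp : ∀ k, MvPolynomial.pderiv (Sum.inl k) f = 0 := by
    intro k
    induction k with
    | zero => exact h1
    | succ k ih =>
      have h := pderiv_lowerT k f
      rw [ih, h2, map_zero, map_zero, sub_zero] at h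
      exact (smul_eq_zero.1 h.symm).resolve_left (Nat.cast_add_one_ne_zero k)
  have hc : ∀ g : MvPolynomial (ℕ ⊕ ℕ) ℂ, ∀ α : ℕ ⊕ ℕ →₀ ℕ, (∀ k, α (Sum.inl k) = 0) →
      (MvPolynomial.aeval (Sum.elim (fun _ => (0 : MvPolynomial (ℕ ⊕ ℕ) ℂ)) polyS) g).coeff α =
        g.coeff α := by
    intro g α hα
    induction g using MvPolynomial.induction_on' with
    | add p q hp hq => rw [map_add, MvPolynomial.coeff_add, MvPolynomial.coeff_add, hp, hq]
    | monomial e a =>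
      rw [MvPolynomial.aeval_monomial]
      by_cases he : ∃ k, e (Sum.inl k) ≠ 0
      · obtain ⟨k, hk⟩ := he
        rw [Finsupp.prod, Finset.prod_eq_zero (Finsupp.mem_support_iff.2 hk) (by simp [hk]),
          mul_zero, MvPolynomial.coeff_zero, MvPolynomial.coeff_monomial, if_neg]
        rintro rfl
        exact hk (hα k)
      · push Not at he
        rw [MvPolynomial.monomial_eq, MvPolynomial.algebraMap_eq]
        congr 2
        refine Finset.prod_congr rfl fun i hi => ?_
        rcases i with i | i
        · exact absurd (he i) (Finsupp.mem_support_iff.1 hi)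
        · rfl
  ext α
  by_cases hα : ∀ k, α (Sum.inl k) = 0
  · rw [← hc f α hα, h3]
  · push Not at hα
    obtain ⟨k, hk⟩ := hα
    have h := congrArg (MvPolynomial.coeff (α - Finsupp.single (Sum.inl k) 1)) (hp k)
    rw [MvPolynomial.coeff_pderiv, tsub_add_cancel_of_le
      (Finsupp.single_le_iff.2 (Nat.one_le_iff_ne_zero.2 hk)), MvPolynomial.coeff_zero] at h
    rw [MvPolynomial.coeff_zero]
    refine (mul_eq_zero.1 h).resolve_right ?_
    exact Nat.cast_add_one_ne_zero _

/-- The Cauchy identity in degree `n`, by induction on `n`: both derivations of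
`eq_zero_of_pderiv_of_lowerT` reduce the degree, and removing a box in `t` is adjoint to adding one
in `s`. -/
theorem cauchy_identity (N n : ℕ) (hn : n ≤ N + 1) :
    ∑ m ∈ monoVec (N + 1) n, schurVec polyT (shiftVec m) * schurVec polyS (shiftVec m) =
      hSum (fun j => powerSum polyT j * powerSum polyS j) n := by
  induction n with
  | zero =>
    have h : monoVec (N + 1) 0 = {0} := by
      ext m
      rw [mem_monoVec, Finset.mem_singleton, Finset.sum_eq_zero_iff]
      refine ⟨fun h => funext fun i => h.1 i (Finset.mem_univ i), ?_⟩
      rintro rfl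
      exact ⟨fun _ _ => rfl, monotone_const⟩
    rw [h, Finset.sum_singleton, schurVec_shiftVec_zero, schurVec_shiftVec_zero, hSum_zero,
      one_mul]
  | succ n ih =>
    specialize ih (by omega)
    have h0 : ∀ m ∈ monoVec (N + 1) n, shiftVec m 0 = 0 := fun m hm => by
      simp [shiftVec, zero_eq_of_mem_monoVec hm (by omega)]
    rw [← sub_eq_zero]
    refine eq_zero_of_pderiv_of_lowerT ?_ ?_ ?_
    -- `∂/∂t_1` reduces the identity to Pieri's rule for multiplication by `s_1`
    · rw [map_sub, map_sum, sub_eq_zero,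
        derivation_hSum (MvPolynomial.pderiv (Sum.inl 0)) _
          (fun j => (if j = 0 then 1 else 0) * powerSum polyS (j + 1)) (fun j => by
            rw [Derivation.leibniz, derivation_powerSum_of_const _ pderiv_polyS, powerSum,
              Derivation.leibniz, pderiv_polyT]
            simp; ring_nf)]
      have h : ∀ m ∈ monoVec (N + 1) (n + 1), MvPolynomial.pderiv (Sum.inl 0)
          (schurVec polyT (shiftVec m) * schurVec polyS (shiftVec m)) =
          ∑ i, (1 : MvPolynomial (ℕ ⊕ ℕ) ℂ) * (schurVec polyT (shiftVec m - Pi.single i 1) *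
            schurVec polyS (shiftVec m)) := fun m _ => by
        rw [Derivation.leibniz, derivation_schurVec_of_const _ pderiv_polyS,
          derivation_schurVec_of_lower _ pderiv_polyT]
        simp only [smul_eq_mul, mul_zero, zero_add, one_mul]
        rw [mul_comm, Finset.sum_mul]
      rw [Finset.sum_congr rfl h, sum_schurVec_sub_single_mul _ _ (fun _ => 1),
        Finset.sum_range_succ', Finset.sum_eq_zero (s := Finset.range n) (fun i _ => by simp)]
      simp only [if_true, one_mul, zero_add, Nat.sub_zero]
      rw [← ih, Finset.mul_sum]
      refine Finset.sum_congr rfl fun m hm => ?_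
      rw [← Finset.mul_sum, ← powerSum_one_mul_schurVec _ _ (h0 m hm)]
      ring
    -- on both sides `lowerT` in degree `n + 1` equals `raiseS` in degree `n`
    · rw [map_sub, map_sum, sub_eq_zero,
        derivation_hSum lowerT _
          (fun j => powerSum polyT j * powerSum polyS (j + 1)) (fun j => by
            rw [Derivation.leibniz, derivation_powerSum_of_const _ lowerT_polyS,
              show powerSum polyT (j + 1) = ((j + 1 : ℕ) : _) * polyT (j + 1 - 1) from rfl,
              Derivation.leibniz, Nat.add_sub_cancel, lowerT_polyT]
            simp; ring)]
      have h : ∀ m ∈ monoVec (N + 1) (n + 1), lowerT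
          (schurVec polyT (shiftVec m) * schurVec polyS (shiftVec m)) =
          ∑ i, ((shiftVec m i - (N + 1 : ℕ) : ℤ) : MvPolynomial (ℕ ⊕ ℕ) ℂ) *
            (schurVec polyT (shiftVec m - Pi.single i 1) * schurVec polyS (shiftVec m)) :=
          fun m _ => by
        rw [Derivation.leibniz, derivation_schurVec_of_const _ lowerT_polyS,
          derivation_schurVec_of_lower' _ lowerT_polyT]
        simp only [smul_eq_mul, mul_zero, zero_add]
        rw [mul_comm, Finset.sum_mul]
        exact Finset.sum_congr rfl fun i _ => mul_assoc _ _ _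
      rw [Finset.sum_congr rfl h, sum_schurVec_sub_single_mul _ _
        (fun b => ((b - (N + 1 : ℕ) : ℤ) : MvPolynomial (ℕ ⊕ ℕ) ℂ))]
      have h' : ∀ m ∈ monoVec (N + 1) n, ∑ i,
          ((shiftVec m i + 1 - (N + 1 : ℕ) : ℤ) : MvPolynomial (ℕ ⊕ ℕ) ℂ) *
            (schurVec polyT (shiftVec m) * schurVec polyS (shiftVec m + Pi.single i 1)) =
          raiseS (schurVec polyT (shiftVec m) * schurVec polyS (shiftVec m)) := fun m hm => by
        rw [Derivation.leibniz, derivation_schurVec_of_const _ raiseS_polyT,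
          derivation_schurVec_of_raise _ raiseS_polyS _ (h0 m hm)]
        simp only [smul_eq_mul, mul_zero, add_zero]
        rw [Finset.mul_sum]
        refine Finset.sum_congr rfl fun i _ => ?_
        push_cast; ring
      rw [Finset.sum_congr rfl h', ← map_sum, ih]
      cases n with
      | zero => simp [hSum_zero, powerSum]
      | succ n =>
        rw [derivation_hSum raiseS _
          (fun j => powerSum polyT (j + 1) * powerSum polyS (j + 2)) (fun j => by
            rw [Derivation.leibniz, derivation_powerSum_of_const _ raiseS_polyT,
              show powerSum polyS (j + 1) = ((j + 1 : ℕ) : _) * polyS (j + 1 - 1) from rfl,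
              Derivation.leibniz, Nat.add_sub_cancel, raiseS_polyS]
            simp; ring), Finset.sum_range_succ' _ (n + 1)]
        simp only [Nat.add_sub_add_right, Nat.sub_zero, powerSum, Nat.cast_zero, zero_mul, add_zero]
    -- at `t = 0` both sides vanish
    · rw [map_sub, map_sum, sub_eq_zero]
      have hT : (fun k => MvPolynomial.aeval
          (Sum.elim (fun _ => (0 : MvPolynomial (ℕ ⊕ ℕ) ℂ)) polyS) (polyT k)) = 0 := by
        ext1 k; simp
      rw [Finset.sum_eq_zero]
      · rw [map_hSum]
        have h := natCast_mul_hSum_succ (fun j => MvPolynomial.aeval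
          (Sum.elim (fun _ => (0 : MvPolynomial (ℕ ⊕ ℕ) ℂ)) polyS)
            (powerSum polyT j * powerSum polyS j)) n
        rw [Finset.sum_eq_zero (fun i _ => by simp [powerSum])] at h
        exact ((natCast_succ_isUnit n).mul_right_eq_zero.1 h).symm
      · intro m hm
        rw [map_mul, map_schurVec, hT, schurVec_flow_zero, zero_mul]
        have := (mem_monoVec.1 hm).1
        simp only [shiftVec, Finset.sum_add_distrib]
        rw [← Nat.cast_sum, this]
        push_cast
        intro hc
        linarith [(Nat.cast_nonneg n : (0 : ℤ) ≤ n)]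

end Cauchy

/-! ### Transpositions act on Schur functions by contents -/

section Eigenvector

variable {A : Type*} [CommRing A] [Algebra ℂ A] {N : ℕ} {Ω : Type*} [Fintype Ω] [DecidableEq Ω]

/-- The vector `m_i + i`, as an exponent. -/
def shiftExponent (m : Fin N → ℕ) : Fin N →₀ ℕ :=
  Finsupp.equivFunOnFinite.symm fun i => m i + i

theorem shiftExponent_apply (m : Fin N → ℕ) (i : Fin N) : shiftExponent m i = m i + i := rfl

/-- The Schur function as a coefficient: expanding the Vandermonde polynomial over the permutations
gives the Jacobi-Trudi determinant. -/
theorem coeff_vanPoly_mul_colourSum_one (u : ℕ → A) (m : Fin N → ℕ)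
    (hm : ∑ i, m i = Fintype.card Ω) :
    (vanPoly A N * colourSum N (powerSum u) (1 : MonoidAlgebra ℂ (Equiv.Perm Ω))).coeff
      (shiftExponent m) = ((Fintype.card Ω).factorial : A) * schurVec u (shiftVec m) := by
  rw [coeff_vanPoly_mul, schurVec, Matrix.det_apply', Finset.mul_sum]
  refine Finset.sum_congr rfl fun σ _ => ?_
  rw [zsmul_eq_mul, mul_left_comm]
  congr 1
  split_ifs with h
  · have hle : ∀ i : Fin N, (i : ℕ) ≤ m (σ i) + (σ i : ℕ) := fun i => by
      have := h (σ i)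
      rwa [vanExponent_apply, Equiv.symm_apply_apply] at this
    rw [coeff_colourSum_one, if_pos, ← Equiv.prod_comp σ]
    · congr 1
      refine Finset.prod_congr rfl fun i _ => ?_
      rw [Matrix.of_apply, shiftVec, Finsupp.tsub_apply, vanExponent_apply,
        Equiv.symm_apply_apply, shiftExponent_apply, ← complete_natCast, Nat.cast_sub (hle i)]
      push_cast; rfl
    · have h1 : ∑ i, (shiftExponent m - vanExponent σ) i + ∑ i : Fin N, (i : ℕ) =
          ∑ i, m i + ∑ i : Fin N, (i : ℕ) := by
        rw [← Equiv.sum_comp σ.symm (fun i : Fin N => (i : ℕ)), ← Finset.sum_add_distrib]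
        conv_rhs => rw [Equiv.sum_comp σ.symm (fun i : Fin N => (i : ℕ)), ← Finset.sum_add_distrib]
        refine Finset.sum_congr rfl fun i _ => ?_
        exact tsub_add_cancel_of_le (h i)
      rw [← hm]
      exact Nat.add_right_cancel h1
  · obtain ⟨k, hk⟩ : ∃ k, ¬ vanExponent σ k ≤ shiftExponent m k := by
      by_contra! hc
      exact h hc
    rw [vanExponent_apply, shiftExponent_apply, not_le] at hk
    rw [Finset.prod_eq_zero (Finset.mem_univ (σ.symm k)), mul_zero]
    rw [Matrix.of_apply, Equiv.apply_symm_apply, shiftVec]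
    exact complete_of_neg u (by omega)

/-- The coefficients of `vanPoly * colourSum y` are the images under the characteristic map of
`y * Y` for fixed `Y`. -/
theorem exists_coeff_vanPoly_mul_colourSum (β : Fin N →₀ ℕ) (p : ℕ → A) :
    ∃ Y : MonoidAlgebra ℂ (Equiv.Perm Ω), ∀ y,
      (vanPoly A N * colourSum N p y).coeff β = charMap p (y * Y) := by
  have h1 : ∀ α : Fin N →₀ ℕ, ∃ Y : MonoidAlgebra ℂ (Equiv.Perm Ω), ∀ y,
      (colourSum N p y).coeff α = charMap p (y * Y) := by
    intro α
    refine ⟨∑ w : Ω → Fin N,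
      if ∑ ω, Finsupp.single (w ω) 1 = α then youngSum w else 0, fun y => ?_⟩
    rw [colourSum, MvPolynomial.coeff_sum, Finset.mul_sum, map_sum]
    refine Finset.sum_congr rfl fun w _ => ?_
    have h2 : ∏ ω, (MvPolynomial.X (w ω) : MvPolynomial (Fin N) A) =
        MvPolynomial.monomial (∑ ω, Finsupp.single (w ω) 1) 1 := by
      rw [MvPolynomial.monomial_sum_one]
      rfl
    rw [h2, mul_comm, MvPolynomial.coeff_C_mul, MvPolynomial.coeff_monomial]
    split_ifs <;> simp
  choose Y hY using h1
  refine ⟨∑ σ : Equiv.Perm (Fin N), (Equiv.Perm.sign σ : ℤ) •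
    if vanExponent σ ≤ β then Y (β - vanExponent σ) else 0, fun y => ?_⟩
  rw [coeff_vanPoly_mul, Finset.mul_sum, map_sum]
  refine Finset.sum_congr rfl fun σ _ => ?_
  rw [mul_smul_comm, map_zsmul]
  split_ifs
  · rw [hY]
  · simp

theorem twiceTranspositions_commute (g : Equiv.Perm Ω) :
    Commute (twiceTranspositions Ω) (MonoidAlgebra.of ℂ _ g) := by
  rw [Commute, SemiconjBy, twiceTranspositions, Finset.sum_mul, Finset.mul_sum]
  refine Fintype.sum_equiv g.symm _ _ fun v => ?_
  rw [Finset.sum_mul, Finset.mul_sum]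
  refine Finset.sum_equiv g.symm (by simp) fun u _ => ?_
  rw [← map_mul (MonoidAlgebra.of ℂ (Equiv.Perm Ω)),
    ← map_mul (MonoidAlgebra.of ℂ (Equiv.Perm Ω)), Equiv.mul_swap_eq_swap_mul]
  simp

/-- The sum of all transpositions acts on the Schur function of a partition of `n` by the sum of
its contents. -/
theorem exists_linearMap_twiceTranspositions (Ω : Type*) [Fintype Ω] [DecidableEq Ω] (N : ℕ) :
    ∃ T : MvPolynomial ℕ ℂ →ₗ[ℂ] MvPolynomial ℕ ℂ,
      (∀ y : MonoidAlgebra ℂ (Equiv.Perm Ω), T (charMap (powerSum MvPolynomial.X) y) =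
        charMap (powerSum MvPolynomial.X) (twiceTranspositions Ω * y)) ∧
      ∀ m : Fin N → ℕ, ∑ i, m i = Fintype.card Ω →
        T (schurVec MvPolynomial.X (shiftVec m)) =
          (twiceContent (shiftExponent m) : ℂ) • schurVec MvPolynomial.X (shiftVec m) := by
  obtain ⟨T, hT⟩ := exists_linearMap_charMap_mul (twiceTranspositions Ω)
    twiceTranspositions_commute
  refine ⟨T, hT, fun m hm => ?_⟩
  obtain ⟨Y, hY⟩ := exists_coeff_vanPoly_mul_colourSum (Ω := Ω) (shiftExponent m)
    (powerSum (MvPolynomial.X : ℕ → MvPolynomial ℕ ℂ))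
  have h1 := hY 1
  have h2 := hY (twiceTranspositions Ω)
  rw [coeff_vanPoly_mul_colourSum_twiceTranspositions, h1, one_mul, ← hT] at h2
  rw [coeff_vanPoly_mul_colourSum_one _ _ hm, one_mul] at h1
  have h3 : ((Fintype.card Ω).factorial : ℂ) • schurVec MvPolynomial.X (shiftVec m) =
      charMap (powerSum (MvPolynomial.X : ℕ → MvPolynomial ℕ ℂ)) Y := by
    rw [← h1, MvPolynomial.smul_eq_C_mul]; simp
  have h4 : ((Fintype.card Ω).factorial : ℂ) ≠ 0 := by exact_mod_cast Nat.factorial_ne_zero _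
  rw [← h3, map_smul] at h2
  refine smul_right_injective _ h4 ?_
  dsimp only
  rw [← h2, smul_comm, MvPolynomial.smul_eq_C_mul _ (twiceContent _ : ℂ)]
  simp

theorem twiceContent_shiftExponent (m : Fin N → ℕ) :
    twiceContent (shiftExponent m) = ∑ i, (m i : ℤ) * (m i + 2 * (i : ℕ) - 2 * N + 1) := by
  rw [twiceContent, Finset.mul_sum, ← Finset.sum_sub_distrib]
  refine Finset.sum_congr rfl fun i _ => ?_
  rw [shiftExponent_apply]
  push_cast
  ring

theorem twiceContent_add_single (m : Fin N → ℕ) (i : Fin N) :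
    twiceContent (shiftExponent (m + Pi.single i 1)) =
      twiceContent (shiftExponent m) + 2 * (m i + (i : ℕ) + 1 - N) := by
  rw [twiceContent_shiftExponent, twiceContent_shiftExponent,
    ← Finset.add_sum_erase _ _ (Finset.mem_univ i),
    ← Finset.add_sum_erase (a := i) Finset.univ (fun i => (m i : ℤ) * _) (Finset.mem_univ i),
    Finset.sum_congr rfl (fun j hj => by
      rw [Pi.add_apply, Pi.single_eq_of_ne (Finset.ne_of_mem_erase hj), add_zero])]
  simp
  ring

/-- The contents of the boxes of the diagram with rows `m_i`, the row `N - 1` being the first. -/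
def contents (m : Fin N → ℕ) : Multiset ℤ :=
  ∑ i, (Multiset.range (m i)).map fun j : ℕ => (j : ℤ) + (i : ℕ) + 1 - N

theorem contents_add_single (m : Fin N → ℕ) (i : Fin N) :
    contents (m + Pi.single i 1) = contents m + {(m i : ℤ) + (i : ℕ) + 1 - N} := by
  rw [contents, contents, ← Finset.add_sum_erase _ _ (Finset.mem_univ i),
    ← Finset.add_sum_erase (a := i) Finset.univ (fun i => (Multiset.range (m i)).map _)
      (Finset.mem_univ i),
    Finset.sum_congr rfl (fun j hj => by
      rw [Pi.add_apply, Pi.single_eq_of_ne (Finset.ne_of_mem_erase hj), add_zero])]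
  rw [Pi.add_apply, Pi.single_eq_same, Multiset.range_succ, Multiset.map_cons,
    ← Multiset.singleton_add, add_comm, ← add_assoc, add_comm]
  abel

end Eigenvector

/-! ### Jucys-Murphy elements -/

section JucysMurphy

/-- The group algebra of the symmetric group. -/
abbrev PermAlgebra (n : ℕ) : Type := MonoidAlgebra ℂ (Equiv.Perm (Fin n))

/-- The Jucys-Murphy element `∑_{a < b} (a b)`. -/
def jucysMurphy (n : ℕ) (b : Fin n) : PermAlgebra n :=
  ∑ a ∈ Finset.univ.filter (· < b), MonoidAlgebra.of ℂ _ (Equiv.swap a b)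

theorem jucysMurphy_commute_of {n : ℕ} {b : Fin n} {g : Equiv.Perm (Fin n)}
    (hg : ∀ a, g a < b ↔ a < b) (hb : g b = b) :
    Commute (jucysMurphy n b) (MonoidAlgebra.of ℂ _ g) := by
  rw [Commute, SemiconjBy, jucysMurphy, Finset.sum_mul, Finset.mul_sum]
  symm
  refine Finset.sum_equiv g (by simp [hg]) fun a _ => ?_
  rw [← map_mul (MonoidAlgebra.of ℂ (Equiv.Perm (Fin n))),
    ← map_mul (MonoidAlgebra.of ℂ (Equiv.Perm (Fin n))), Equiv.mul_swap_eq_swap_mul, hb]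

theorem jucysMurphy_commute {n : ℕ} (a b : Fin n) :
    Commute (jucysMurphy n a) (jucysMurphy n b) := by
  have h : ∀ a b : Fin n, a < b → Commute (jucysMurphy n b) (jucysMurphy n a) := by
    intro a b hab
    rw [jucysMurphy.eq_def n a]
    refine Commute.sum_right _ _ _ fun c hc => ?_
    have hcb : c < b := (Finset.mem_filter.1 hc).2.trans hab
    refine jucysMurphy_commute_of (fun d => ?_) ?_
    · rw [Equiv.swap_apply_def]
      split_ifs with h1 h2
      · simp [h1, hab, hcb]
      · simp [h2, hab, hcb]
      · rfl
    · exact Equiv.swap_apply_of_ne_of_ne hcb.ne' hab.ne'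
  rcases lt_trichotomy a b with hab | rfl | hab
  · exact (h a b hab).symm
  · rfl
  · exact h b a hab

open scoped IsMulCommutative in
/-- Evaluation of polynomials at the commuting Jucys-Murphy elements. -/
def evalJM (n : ℕ) : MvPolynomial (Fin n) ℂ →ₐ[ℂ] PermAlgebra n :=
  haveI : IsMulCommutative (Algebra.adjoin ℂ (Set.range (jucysMurphy n))) :=
    Algebra.isMulCommutative_adjoin ℂ (by
      rintro _ ⟨a, rfl⟩ _ ⟨b, rfl⟩
      exact jucysMurphy_commute a b)
  (Algebra.adjoin ℂ (Set.range (jucysMurphy n))).val.comp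
    (MvPolynomial.aeval fun b => ⟨jucysMurphy n b, Algebra.subset_adjoin ⟨b, rfl⟩⟩)

theorem evalJM_X (n : ℕ) (b : Fin n) : evalJM n (MvPolynomial.X b) = jucysMurphy n b := by
  simp [evalJM]

theorem twiceTranspositions_eq_evalJM (n : ℕ) :
    twiceTranspositions (Fin n) = 2 • evalJM n (∑ b, MvPolynomial.X b) := by
  have h : ∀ v : Fin n, ∑ u ∈ Finset.univ.filter (fun u => u ≠ v),
      MonoidAlgebra.of ℂ _ (Equiv.swap u v) = jucysMurphy n v +
        ∑ u ∈ Finset.univ.filter (fun u => v < u), MonoidAlgebra.of ℂ _ (Equiv.swap v u) := by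
    intro v
    have hd : Finset.univ.filter (fun u => u ≠ v) = Finset.univ.filter (fun u => u < v) ∪
        Finset.univ.filter (fun u => v < u) := by
      ext u
      simp [lt_or_lt_iff_ne]
    rw [hd, Finset.sum_union, jucysMurphy]
    · congr 1
      exact Finset.sum_congr rfl fun u _ => by rw [Equiv.swap_comm]
    · rw [Finset.disjoint_filter]
      intro u _ h
      exact h.asymm
  rw [twiceTranspositions, Finset.sum_congr rfl fun v _ => h v, Finset.sum_add_distrib,
    map_sum, two_smul]
  simp_rw [evalJM_X]
  congr 1
  simp_rw [jucysMurphy, Finset.sum_filter]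
  exact Finset.sum_comm

/-- The embedding of the symmetric group on `n` points as the stabilizer of the last of `n + 1`
points, on the group algebras. -/
def permInclusion (n : ℕ) : PermAlgebra n →ₐ[ℂ] PermAlgebra (n + 1) :=
  MonoidAlgebra.mapDomainAlgHom ℂ ℂ
    (Equiv.Perm.extendDomainHom (finSuccAboveEquiv (Fin.last n)))

theorem permInclusion_of {n : ℕ} (g : Equiv.Perm (Fin n)) :
    permInclusion n (MonoidAlgebra.of ℂ _ g) = MonoidAlgebra.of ℂ _
      (g.extendDomain (finSuccAboveEquiv (Fin.last n))) := by
  simp [permInclusion, Equiv.Perm.extendDomainHom]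

theorem extendDomain_castSucc {n : ℕ} (g : Equiv.Perm (Fin n)) (a : Fin n) :
    g.extendDomain (finSuccAboveEquiv (Fin.last n)) a.castSucc = (g a).castSucc := by
  have h := Equiv.Perm.extendDomain_apply_image g (finSuccAboveEquiv (Fin.last n)) a
  simpa [finSuccAboveEquiv_apply] using h

theorem extendDomain_last {n : ℕ} (g : Equiv.Perm (Fin n)) :
    g.extendDomain (finSuccAboveEquiv (Fin.last n)) (Fin.last n) = Fin.last n :=
  Equiv.Perm.extendDomain_apply_not_subtype _ _ (by simp)

theorem permInclusion_jucysMurphy {n : ℕ} (b : Fin n) :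
    permInclusion n (jucysMurphy n b) = jucysMurphy (n + 1) b.castSucc := by
  have hfilter : Finset.univ.filter (fun a : Fin (n + 1) => a < b.castSucc) =
      (Finset.univ.filter (fun a : Fin n => a < b)).map Fin.castSuccEmb := by
    ext a
    induction a using Fin.lastCases with
    | last => simp [Fin.le_last]
    | cast a => simp
  rw [jucysMurphy, map_sum, jucysMurphy, hfilter, Finset.sum_map]
  refine Finset.sum_congr rfl fun a _ => ?_
  rw [permInclusion_of]
  congr 1
  ext x : 1
  induction x using Fin.lastCases with
  | last =>
    rw [extendDomain_last, Equiv.swap_apply_of_ne_of_ne] <;>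
    simp [(Fin.castSucc_lt_last _).ne']
  | cast x =>
    rw [extendDomain_castSucc, Equiv.swap_apply_def, Equiv.swap_apply_def]
    simp only [Fin.castSuccEmb_apply, Fin.castSucc_inj]
    split_ifs <;> rfl

theorem jucysMurphy_last_commute {n : ℕ} (x : PermAlgebra n) :
    Commute (jucysMurphy (n + 1) (Fin.last n)) (permInclusion n x) := by
  induction x using MonoidAlgebra.induction_linear with
  | zero => rw [map_zero]; exact Commute.zero_right _
  | add x y hx hy => rw [map_add]; exact hx.add_right hy
  | single g a =>
    have h : (MonoidAlgebra.single g a : PermAlgebra n) = a • MonoidAlgebra.of ℂ _ g := by simp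
    rw [h, map_smul, permInclusion_of]
    refine (jucysMurphy_commute_of (fun c => ?_) (extendDomain_last g)).smul_right a
    induction c using Fin.lastCases with
    | last => rw [extendDomain_last]
    | cast c => rw [extendDomain_castSucc]; simp [Fin.castSucc_lt_last]

theorem permInclusion_evalJM {n : ℕ} (f : MvPolynomial (Fin n) ℂ) :
    permInclusion n (evalJM n f) = evalJM (n + 1) (MvPolynomial.rename Fin.castSucc f) := by
  have h : (permInclusion n).comp (evalJM n) =
      (evalJM (n + 1)).comp (MvPolynomial.rename Fin.castSucc) :=
    MvPolynomial.algHom_ext fun b => by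
      simp [evalJM_X, permInclusion_jucysMurphy]
  exact DFunLike.congr_fun h f

theorem charMap_permInclusion {A : Type*} [CommRing A] [Algebra ℂ A] (p : ℕ → A) {n : ℕ}
    (x : PermAlgebra n) : charMap p (permInclusion n x) = p 1 * charMap p x := by
  suffices h : charMap p ∘ₗ (permInclusion n).toLinearMap =
      LinearMap.mulLeft ℂ (p 1) ∘ₗ charMap p from LinearMap.congr_fun h x
  refine linearMap_eq_of_of fun g => ?_
  simp only [LinearMap.comp_apply, AlgHom.toLinearMap_apply, permInclusion_of, charMap_of,
    cycProd_extendDomain, LinearMap.mulLeft_apply]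
  simp

end JucysMurphy

section ContentVectors

theorem two_nsmul_jucysMurphy_last (n : ℕ) :
    2 • jucysMurphy (n + 1) (Fin.last n) =
      twiceTranspositions (Fin (n + 1)) - permInclusion n (twiceTranspositions (Fin n)) := by
  rw [twiceTranspositions_eq_evalJM, twiceTranspositions_eq_evalJM, map_nsmul, ← smul_sub,
    Fin.sum_univ_castSucc, permInclusion_evalJM, map_sum (MvPolynomial.rename _), map_add,
    evalJM_X]
  simp

/-- The characteristic map with values in the polynomials in the flow variables. -/
abbrev polyCharMap (n : ℕ) : PermAlgebra n →ₗ[ℂ] MvPolynomial ℕ ℂ :=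
  charMap (powerSum MvPolynomial.X)

/-- The Schur function of the partition with parts `m_i`, as a polynomial in the flow
variables. -/
abbrev polySchur {N : ℕ} (m : Fin N → ℕ) : MvPolynomial ℕ ℂ :=
  schurVec MvPolynomial.X (shiftVec m)

/-- The branching rule: multiplication by the last Jucys-Murphy element weights the addition of a
box by its content. -/
theorem polyCharMap_mul_jucysMurphy_pow {N n : ℕ} (hn : n ≤ N) {m : Fin (N + 1) → ℕ}
    (hm : m ∈ monoVec (N + 1) n) (k : ℕ) (y : PermAlgebra n) (a : ℂ)
    (hy : polyCharMap n y = a • polySchur m) :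
    polyCharMap (n + 1) (permInclusion n y * jucysMurphy (n + 1) (Fin.last n) ^ k) =
      a • ∑ i, ((m i : ℂ) + (i : ℕ) - N) ^ k • polySchur (m + Pi.single i 1) := by
  have hsum := (mem_monoVec.1 hm).1
  induction k generalizing y a with
  | zero =>
    have h0 : shiftVec m 0 = 0 := by simp [shiftVec, zero_eq_of_mem_monoVec hm hn]
    rw [pow_zero, mul_one, charMap_permInclusion, hy, mul_smul_comm,
      powerSum_one_mul_schurVec _ _ h0]
    simp [polySchur, QuantumHurwitz.shiftVec_add_single]
  | succ k ih =>
    obtain ⟨T, hT, hTm⟩ := exists_linearMap_twiceTranspositions (Fin n) (N + 1)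
    obtain ⟨T', hT', hTm'⟩ := exists_linearMap_twiceTranspositions (Fin (n + 1)) (N + 1)
    have hy' : polyCharMap n (y * twiceTranspositions (Fin n)) =
        (a * twiceContent (shiftExponent m)) • polySchur m := by
      rw [charMap_mul_comm, ← hT, hy, map_smul, hTm m (by simpa using hsum), smul_smul]
    set J := jucysMurphy (n + 1) (Fin.last n)
    have h2 : 2 • (permInclusion n y * J ^ (k + 1)) =
        permInclusion n y * J ^ k * twiceTranspositions (Fin (n + 1)) -
          permInclusion n (y * twiceTranspositions (Fin n)) * J ^ k := by
      rw [pow_succ, ← mul_assoc, ← mul_smul_comm, two_nsmul_jucysMurphy_last, mul_sub,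
        map_mul (permInclusion n), mul_assoc _ (J ^ k) (permInclusion n _),
        ((jucysMurphy_last_commute _).pow_left k).eq, ← mul_assoc]
    have h3 := congrArg (polyCharMap (n + 1)) h2
    rw [map_nsmul, map_sub, ih _ _ hy', charMap_mul_comm _ _ (twiceTranspositions _), ← hT',
      ih _ _ hy, map_smul, map_sum, mul_smul, ← smul_sub, Finset.smul_sum,
      ← Finset.sum_sub_distrib] at h3
    refine smul_right_injective _ (two_ne_zero (α := ℕ)) ?_
    dsimp only
    rw [h3, smul_comm (2 : ℕ) a]
    congr 1
    rw [Finset.smul_sum]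
    refine Finset.sum_congr rfl fun i _ => ?_
    rw [map_smul, hTm' (m + Pi.single i 1) (by simp [Finset.sum_add_distrib, hsum]),
      twiceContent_add_single, smul_smul, smul_smul, ← sub_smul, ← Nat.cast_smul_eq_nsmul ℂ,
      smul_smul]
    congr 1
    push_cast
    ring

theorem polyCharMap_mul_aeval_jucysMurphy {N n : ℕ} (hn : n ≤ N) {m : Fin (N + 1) → ℕ}
    (hm : m ∈ monoVec (N + 1) n) (P : Polynomial ℂ) (y : PermAlgebra n) (a : ℂ)
    (hy : polyCharMap n y = a • polySchur m) :
    polyCharMap (n + 1)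
        (permInclusion n y * Polynomial.aeval (jucysMurphy (n + 1) (Fin.last n)) P) =
      a • ∑ i, P.eval ((m i : ℂ) + (i : ℕ) - N) • polySchur (m + Pi.single i 1) := by
  induction P using Polynomial.induction_on' with
  | add P Q hP hQ =>
    rw [map_add, mul_add, map_add, hP, hQ, ← smul_add, ← Finset.sum_add_distrib]
    simp_rw [Polynomial.eval_add, add_smul]
  | monomial k b =>
    rw [Polynomial.aeval_monomial, ← Algebra.smul_def, mul_smul_comm, map_smul,
      polyCharMap_mul_jucysMurphy_pow hn hm k y a hy, smul_comm, Finset.smul_sum]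
    simp_rw [Polynomial.eval_monomial, smul_smul]

theorem evalJM_monomial_castSucc {n : ℕ} (e : Fin (n + 1) →₀ ℕ) (a : ℂ) :
    evalJM (n + 1) (MvPolynomial.monomial e a) =
      permInclusion n (evalJM n (MvPolynomial.C a *
        ∏ b : Fin n, MvPolynomial.X b ^ e b.castSucc)) *
          jucysMurphy (n + 1) (Fin.last n) ^ e (Fin.last n) := by
  rw [permInclusion_evalJM, ← evalJM_X, ← map_pow (evalJM (n + 1)), ← map_mul (evalJM (n + 1)),
    MvPolynomial.monomial_eq, Finsupp.prod_fintype _ _ (by simp), Fin.prod_univ_castSucc]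
  simp [map_prod, mul_assoc]

theorem exists_monotone_add_single {N n : ℕ} {m : Fin N → ℕ} (hm : m ∈ monoVec N (n + 1)) :
    ∃ m' ∈ monoVec N n, ∃ i, m = m' + Pi.single i 1 := by
  obtain ⟨h1, h2⟩ := mem_monoVec.1 hm
  have hne : (Finset.univ.filter fun i => m i ≠ 0).Nonempty := by
    by_contra hc
    rw [Finset.not_nonempty_iff_eq_empty, Finset.filter_eq_empty_iff] at hc
    rw [Finset.sum_eq_zero (fun i hi => not_not.1 (hc hi))] at h1
    omega
  -- the first nonempty row is the shortest one
  set i := (Finset.univ.filter fun i => m i ≠ 0).min' hne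
  have hi : m i ≠ 0 := (Finset.mem_filter.1 (Finset.min'_mem _ hne)).2
  have hlt : ∀ j < i, m j = 0 := fun j hj => by
    by_contra hc
    exact absurd (Finset.min'_le _ j (Finset.mem_filter.2 ⟨Finset.mem_univ j, hc⟩)) (not_le.2 hj)
  have hle : Pi.single i 1 ≤ m := by
    intro k
    by_cases hk : k = i
    · subst hk; simpa using Nat.one_le_iff_ne_zero.2 hi
    · simp [hk]
  have heq : m = m - Pi.single i 1 + Pi.single i 1 := (tsub_add_cancel_of_le hle).symm
  refine ⟨m - Pi.single i 1, mem_monoVec.2 ⟨?_, fun a b hab => ?_⟩, i, heq⟩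
  · rw [heq] at h1
    simpa [Finset.sum_add_distrib] using h1
  · have hab' := h2 hab
    rcases lt_trichotomy a i with ha | rfl | ha
    · simp [hlt a ha]
    · rcases hab.eq_or_lt with hb | hb
      · rw [← hb]
      · simp [hb.ne']; omega
    · simp [ha.ne', (ha.trans_le hab).ne', hab']

/-- Every Schur function is the image of a common eigenvector of the Jucys-Murphy elements whose
eigenvalues are the contents. The eigenvector is obtained from one for a smaller diagram by
Lagrange interpolation in the last Jucys-Murphy element. -/
theorem exists_content_eigenvector {N n : ℕ} (hn : n ≤ N + 1) {m : Fin (N + 1) → ℕ}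
    (hm : m ∈ monoVec (N + 1) n) :
    ∃ (c : Fin n → ℤ) (x : PermAlgebra n), Finset.univ.val.map c = contents m ∧
      ∀ f : MvPolynomial (Fin n) ℂ, polyCharMap n (evalJM n f * x) =
        MvPolynomial.eval (fun b => (c b : ℂ)) f • polySchur m := by
  induction n generalizing m with
  | zero =>
    obtain rfl : m = 0 := funext fun i =>
      Finset.sum_eq_zero_iff.1 (mem_monoVec.1 hm).1 i (Finset.mem_univ i)
    refine ⟨Fin.elim0, 1, by simp [contents], fun f => ?_⟩
    obtain ⟨a, rfl⟩ := MvPolynomial.C_surjective (Fin 0) f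
    rw [mul_one, MvPolynomial.eval_C, polySchur, schurVec_shiftVec_zero,
      ← MvPolynomial.algebraMap_eq, AlgHom.commutes, Algebra.algebraMap_eq_smul_one, map_smul,
      ← map_one (MonoidAlgebra.of ℂ (Equiv.Perm (Fin 0))), charMap_of, cycProd_eq]
    simp
  | succ n ih =>
    obtain ⟨m', hm', i, rfl⟩ := exists_monotone_add_single hm
    obtain ⟨c, x, hc, hx⟩ := ih (by omega) hm'
    set v : Fin (N + 1) → ℂ := fun j => (m' j : ℂ) + (j : ℕ) - N
    have hv : Function.Injective v := by
      have hmono : StrictMono fun j : Fin (N + 1) => m' j + (j : ℕ) := fun a b hab =>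
        add_lt_add_of_le_of_lt ((mem_monoVec.1 hm').2 hab.le) hab
      intro a b hab
      apply hmono.injective
      have : ((m' a + (a : ℕ) : ℕ) : ℂ) = ((m' b + (b : ℕ) : ℕ) : ℂ) := by
        push_cast
        exact sub_left_injective hab
      exact_mod_cast this
    set P := Lagrange.basis Finset.univ v i
    refine ⟨Fin.snoc c ((m' i : ℤ) + (i : ℕ) - N), permInclusion n x *
      Polynomial.aeval (jucysMurphy (n + 1) (Fin.last n)) P, ?_, fun f => ?_⟩
    · rw [contents_add_single, ← hc, Fin.univ_castSuccEmb]
      rw [Finset.cons_val, Multiset.map_cons, Fin.snoc_last, Finset.map_val, Multiset.map_map,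
        ← Multiset.singleton_add, add_comm]
      congr 2
      · ext b
        simp
      · push_cast
        ring
    induction f using MvPolynomial.induction_on' with
    | add f g hf hg => rw [map_add, add_mul, map_add, hf, hg, map_add, add_smul]
    | monomial e a =>
      set f' : MvPolynomial (Fin n) ℂ := MvPolynomial.C a *
        ∏ b : Fin n, MvPolynomial.X b ^ e b.castSucc with hf'
      have h1 : evalJM (n + 1) (MvPolynomial.monomial e a) * (permInclusion n x *
          Polynomial.aeval (jucysMurphy (n + 1) (Fin.last n)) P) =
          permInclusion n (evalJM n f' * x) * Polynomial.aeval
            (jucysMurphy (n + 1) (Fin.last n)) (Polynomial.X ^ e (Fin.last n) * P) := by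
        rw [evalJM_monomial_castSucc, map_mul (permInclusion n), map_mul (Polynomial.aeval _),
          map_pow, Polynomial.aeval_X, mul_assoc, mul_assoc, ← mul_assoc _ (permInclusion n x),
          ((jucysMurphy_last_commute x).pow_left _).eq, mul_assoc]
      rw [h1, polyCharMap_mul_aeval_jucysMurphy (by omega) hm' _ _ _ (hx f'),
        Finset.sum_eq_single i]
      · rw [Polynomial.eval_mul, Lagrange.eval_basis_self hv.injOn (Finset.mem_univ i), mul_one,
          smul_smul]
        congr 1
        rw [hf', MvPolynomial.eval_monomial, Finsupp.prod_fintype _ _ (by simp),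
          Fin.prod_univ_castSucc]
        simp [map_prod, mul_assoc]
      · intro j _ hj
        rw [Polynomial.eval_mul,
          show ((m' j : ℂ) + (j : ℕ) - N) = v j from rfl,
          Lagrange.eval_basis_of_ne hj.symm (Finset.mem_univ j), mul_zero, zero_smul]
      · simp

end ContentVectors

/-! ### Symmetric polynomials in the Jucys-Murphy elements are central -/

section Central

/-- `(n n+1) J_{n+1} = J_n (n n+1) + 1`. -/
theorem swap_mul_jucysMurphy_succ {n : ℕ} (i : Fin n) :
    MonoidAlgebra.of ℂ _ (Equiv.swap i.castSucc i.succ) * jucysMurphy (n + 1) i.succ =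
      jucysMurphy (n + 1) i.castSucc * MonoidAlgebra.of ℂ _ (Equiv.swap i.castSucc i.succ) + 1 := by
  have hd : Finset.univ.filter (· < i.succ) =
      insert i.castSucc (Finset.univ.filter (· < i.castSucc)) := by
    ext a
    simp [Fin.lt_def, Fin.ext_iff]
    omega
  rw [jucysMurphy, hd, Finset.sum_insert (by simp), mul_add, ← map_mul (MonoidAlgebra.of ℂ _),
    Equiv.swap_mul_self, map_one, add_comm (1 : PermAlgebra (n + 1)), jucysMurphy,
    Finset.mul_sum, Finset.sum_mul]
  congr 1
  refine Finset.sum_congr rfl fun a ha => ?_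
  have ha' : a < i.castSucc := (Finset.mem_filter.1 ha).2
  rw [← map_mul (MonoidAlgebra.of ℂ _), ← map_mul (MonoidAlgebra.of ℂ _),
    Equiv.mul_swap_eq_swap_mul, Equiv.swap_apply_right, Equiv.swap_apply_of_ne_of_ne ha'.ne
      (ha'.trans (Fin.castSucc_lt_succ)).ne]

theorem jucysMurphy_succ_mul_swap {n : ℕ} (i : Fin n) :
    jucysMurphy (n + 1) i.succ * MonoidAlgebra.of ℂ _ (Equiv.swap i.castSucc i.succ) =
      MonoidAlgebra.of ℂ _ (Equiv.swap i.castSucc i.succ) * jucysMurphy (n + 1) i.castSucc + 1 := by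
  set s := MonoidAlgebra.of ℂ _ (Equiv.swap i.castSucc i.succ)
  have hs : s * s = 1 := by
    rw [← map_mul (MonoidAlgebra.of ℂ _), Equiv.swap_mul_self, map_one]
  have h := congrArg (fun z => s * z * s) (swap_mul_jucysMurphy_succ i)
  simp only [mul_add, add_mul, mul_one, mul_assoc] at h
  rw [hs] at h
  rwa [mul_one, ← mul_assoc s s, hs, one_mul] at h

theorem swap_commute_jucysMurphy {n : ℕ} (i : Fin n) {b : Fin (n + 1)} (h1 : b ≠ i.castSucc)
    (h2 : b ≠ i.succ) :
    Commute (MonoidAlgebra.of ℂ _ (Equiv.swap i.castSucc i.succ)) (jucysMurphy (n + 1) b) := by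
  refine (jucysMurphy_commute_of (fun a => ?_) (Equiv.swap_apply_of_ne_of_ne h1 h2)).symm
  rw [Ne, Fin.ext_iff] at h1 h2
  rw [Equiv.swap_apply_def]
  split_ifs with h h
  · subst h; simp only [Fin.lt_def, Fin.val_succ, Fin.val_castSucc] at h1 h2 ⊢; omega
  · subst h; simp only [Fin.lt_def, Fin.val_succ, Fin.val_castSucc] at h1 h2 ⊢; omega
  · rfl

/-- An adjacent transposition commutes with the sum and the product of the two Jucys-Murphy elements
concerned, hence with all symmetric polynomials in them. -/
theorem swap_commute_evalJM_symm {n : ℕ} (i : Fin n) (p q : ℕ) :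
    Commute (MonoidAlgebra.of ℂ _ (Equiv.swap i.castSucc i.succ)) (evalJM (n + 1)
      (MvPolynomial.X i.castSucc ^ p * MvPolynomial.X i.succ ^ q +
        MvPolynomial.X i.castSucc ^ q * MvPolynomial.X i.succ ^ p)) := by
  set s := MonoidAlgebra.of ℂ _ (Equiv.swap i.castSucc i.succ) with hs
  set X : MvPolynomial (Fin (n + 1)) ℂ := MvPolynomial.X i.castSucc with hX
  set Y : MvPolynomial (Fin (n + 1)) ℂ := MvPolynomial.X i.succ with hY
  have hsx := jucysMurphy_succ_mul_swap i
  have hsy := swap_mul_jucysMurphy_succ i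
  rw [← hs, ← evalJM_X, ← evalJM_X, ← hX, ← hY] at hsx hsy
  have hadd : Commute s (evalJM (n + 1) (X + Y)) := by
    rw [Commute, SemiconjBy, map_add, mul_add, add_mul, hsy, hsx]
    abel
  have hmul : Commute s (evalJM (n + 1) (X * Y)) := by
    have h : s * evalJM (n + 1) X = evalJM (n + 1) Y * s - 1 := by rw [hsx, add_sub_cancel_right]
    rw [Commute, SemiconjBy, map_mul, ← mul_assoc, h, sub_mul, mul_assoc, hsy, mul_add,
      ← mul_assoc, ← map_mul, mul_comm Y X]
    simp
  have hpow : ∀ k, Commute s (evalJM (n + 1) (X ^ k + Y ^ k)) := by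
    intro k
    induction k using Nat.strong_induction_on with
    | _ k ih =>
      match k with
      | 0 =>
        simp only [pow_zero, map_add, map_one]
        exact (Commute.one_right s).add_right (.one_right s)
      | 1 => simpa using hadd
      | k + 2 =>
        have h : X ^ (k + 2) + Y ^ (k + 2) =
            (X + Y) * (X ^ (k + 1) + Y ^ (k + 1)) - X * Y * (X ^ k + Y ^ k) := by ring
        rw [h, map_sub, map_mul, map_mul]
        exact (hadd.mul_right (ih _ (by omega))).sub_right (hmul.mul_right (ih _ (by omega)))
  wlog hpq : p ≤ q generalizing p q
  · rw [add_comm (X ^ p * Y ^ q)]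
    exact this q p (by omega)
  obtain ⟨k, rfl⟩ := Nat.exists_eq_add_of_le hpq
  have h : X ^ p * Y ^ (p + k) + X ^ (p + k) * Y ^ p = (X * Y) ^ p * (X ^ k + Y ^ k) := by ring
  rw [h, map_mul, map_pow]
  exact (hmul.pow_right p).mul_right (hpow k)

theorem swap_commute_evalJM_add_rename {n : ℕ} (i : Fin n) (f : MvPolynomial (Fin (n + 1)) ℂ) :
    Commute (MonoidAlgebra.of ℂ _ (Equiv.swap i.castSucc i.succ))
      (evalJM (n + 1) (f + MvPolynomial.rename (Equiv.swap i.castSucc i.succ) f)) := by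
  induction f using MvPolynomial.induction_on' with
  | add f g hf hg =>
    rw [map_add (MvPolynomial.rename _), add_add_add_comm, map_add]
    exact hf.add_right hg
  | monomial e a =>
    have hne : i.castSucc ≠ i.succ := (Fin.castSucc_lt_succ).ne
    have h1 : (MvPolynomial.monomial e a : MvPolynomial (Fin (n + 1)) ℂ) =
        MvPolynomial.C a * ((∏ b ∈ ({i.castSucc, i.succ} : Finset (Fin (n + 1)))ᶜ,
          MvPolynomial.X b ^ e b) *
          (MvPolynomial.X i.castSucc ^ e i.castSucc * MvPolynomial.X i.succ ^ e i.succ)) := by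
      rw [MvPolynomial.monomial_eq, Finsupp.prod_fintype _ _ (by simp),
        ← Finset.prod_mul_prod_compl {i.castSucc, i.succ}, Finset.prod_pair hne,
        mul_comm (∏ _ ∈ _, _)]
    have h2 : MvPolynomial.rename (Equiv.swap i.castSucc i.succ)
        (∏ b ∈ ({i.castSucc, i.succ} : Finset (Fin (n + 1)))ᶜ,
          (MvPolynomial.X b ^ e b : MvPolynomial (Fin (n + 1)) ℂ)) =
        ∏ b ∈ ({i.castSucc, i.succ} : Finset (Fin (n + 1)))ᶜ, MvPolynomial.X b ^ e b := by
      rw [map_prod]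
      refine Finset.prod_congr rfl fun b hb => ?_
      simp only [Finset.mem_compl, Finset.mem_insert, Finset.mem_singleton, not_or] at hb
      rw [map_pow, MvPolynomial.rename_X, Equiv.swap_apply_of_ne_of_ne hb.1 hb.2]
    rw [h1, map_mul (MvPolynomial.rename _), map_mul (MvPolynomial.rename _), h2,
      MvPolynomial.rename_C, map_mul (MvPolynomial.rename _), map_pow, map_pow,
      MvPolynomial.rename_X, MvPolynomial.rename_X, Equiv.swap_apply_left,
      Equiv.swap_apply_right, ← mul_add, ← mul_add, mul_comm (MvPolynomial.X i.succ ^ _)]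
    rw [map_mul (evalJM _), map_mul (evalJM _)]
    refine Commute.mul_right ?_ (Commute.mul_right ?_ (swap_commute_evalJM_symm i _ _))
    · rw [← MvPolynomial.algebraMap_eq, AlgHom.commutes]
      exact (Algebra.commutes _ _).symm
    · refine Finset.prod_induction _ (fun f => Commute (MonoidAlgebra.of ℂ _
        (Equiv.swap i.castSucc i.succ)) (evalJM (n + 1) f)) (fun f g hf hg => ?_) ?_ fun b hb => ?_
      · rw [map_mul]; exact hf.mul_right hg
      · rw [map_one]; exact Commute.one_right _
      · simp only [Finset.mem_compl, Finset.mem_insert, Finset.mem_singleton, not_or] at hb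
        rw [map_pow, evalJM_X]
        exact (swap_commute_jucysMurphy i hb.1 hb.2).pow_right _

/-- Symmetric polynomials in the Jucys-Murphy elements are central. -/
theorem evalJM_commute_of_isSymmetric {n : ℕ} {f : MvPolynomial (Fin n) ℂ} (hf : f.IsSymmetric)
    (g : Equiv.Perm (Fin n)) : Commute (evalJM n f) (MonoidAlgebra.of ℂ _ g) := by
  cases n with
  | zero =>
    rw [Subsingleton.elim g 1, map_one]
    exact Commute.one_right _
  | succ n =>
    have hg : g ∈ Submonoid.closure
        (Set.range fun i : Fin n => Equiv.swap i.castSucc i.succ) := by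
      rw [Equiv.Perm.mclosure_swap_castSucc_succ]
      trivial
    induction hg using Submonoid.closure_induction with
    | mem g hg =>
      obtain ⟨i, rfl⟩ := hg
      have h := swap_commute_evalJM_add_rename i f
      rw [hf (Equiv.swap i.castSucc i.succ), ← two_smul ℂ f, map_smul] at h
      have h' := (h.smul_right (2 : ℂ)⁻¹).symm
      rwa [smul_smul, inv_mul_cancel₀ two_ne_zero, one_smul] at h'
    | one => rw [map_one]; exact Commute.one_right _
    | mul g h _ _ hg hh => rw [map_mul]; exact hg.mul_right hh

/-- The polynomial `∑_{|e| = d} ∏_b g_{e_b} x_b ^ e_b`, the coefficient of `z ^ d` in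
`∏_b ∑_j g_j (x_b z) ^ j`. -/
def weightPoly (g : ℕ → ℂ) (n d : ℕ) : MvPolynomial (Fin n) ℂ :=
  ∑ e ∈ Finset.finsuppAntidiag Finset.univ d, MvPolynomial.monomial e (∏ b, g (e b))

theorem weightPoly_isSymmetric (g : ℕ → ℂ) (n d : ℕ) : (weightPoly g n d).IsSymmetric := by
  intro σ
  rw [weightPoly, map_sum]
  refine Finset.sum_equiv (Finsupp.domCongr σ).toEquiv (fun e => ?_) fun e _ => ?_
  · simp only [Finset.mem_finsuppAntidiag, Finset.subset_univ, and_true]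
    rw [show Finset.univ.sum ⇑((Finsupp.domCongr σ).toEquiv e) = Finset.univ.sum ⇑e from
      Equiv.sum_comp σ.symm (fun b => e b)]
  · rw [MvPolynomial.rename_monomial, ← Equiv.prod_comp σ.symm]
    simp [Finsupp.equivMapDomain_eq_mapDomain]

theorem eval_weightPoly (g : ℕ → ℂ) (n d : ℕ) (c : Fin n → ℂ) :
    MvPolynomial.eval c (weightPoly g n d) =
      PowerSeries.coeff d (∏ b, PowerSeries.rescale (c b) (PowerSeries.mk g)) := by
  rw [PowerSeries.coeff_prod, weightPoly, map_sum]
  refine Finset.sum_congr rfl fun e _ => ?_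
  rw [MvPolynomial.eval_monomial, Finsupp.prod_fintype _ _ (by simp), ← Finset.prod_mul_distrib]
  exact Finset.prod_congr rfl fun b _ => by simp [mul_comm]

end Central

/-! ### Paths in the Cayley graph -/

section Paths

variable {n d : ℕ}

/-- The numbers of times that each element of `Fin n` occurs in a sequence. -/
def seqCount (b : Fin d → Fin n) (i : Fin n) : ℕ := Nat.card {k : Fin d // b k = i}

theorem seqCount_eq_card (b : Fin d → Fin n) (i : Fin n) :
    seqCount b i = (Finset.univ.filter fun k => b k = i).card := by
  rw [seqCount, Nat.card_eq_fintype_card, Fintype.card_subtype]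

theorem sum_seqCount (b : Fin d → Fin n) : ∑ i, seqCount b i = d := by
  simp_rw [seqCount_eq_card]
  rw [← Finset.card_eq_sum_card_fiberwise (fun _ _ => Finset.mem_coe.2 (Finset.mem_univ _))]
  simp

theorem prod_X_seq (b : Fin d → Fin n) :
    ∏ k, (MvPolynomial.X (b k) : MvPolynomial (Fin n) ℂ) =
      MvPolynomial.monomial (Finsupp.equivFunOnFinite.symm (seqCount b)) 1 := by
  rw [MvPolynomial.monomial_eq, Finsupp.prod_fintype _ _ (by simp), map_one, one_mul,
    ← Finset.prod_fiberwise Finset.univ b]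
  refine Finset.prod_congr rfl fun i _ => ?_
  rw [Finset.prod_congr rfl fun k hk => by rw [(Finset.mem_filter.1 hk).2], Finset.prod_const]
  simp [seqCount_eq_card]

/-- The weight of a path whose larger elements form the sequence `b`. -/
def seqWeight (g : ℕ → ℂ) (b : Fin d → Fin n) : ℂ :=
  (∏ i, g (seqCount b i)) * ((∏ i, ((seqCount b i).factorial : ℂ)) / (d.factorial : ℂ))

/-- The weights divide the contribution of an exponent evenly between the
`d! / ∏ e_i!` sequences with these multiplicities. -/
theorem sum_seqWeight (g : ℕ → ℂ) (n d : ℕ) :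
    ∑ b : Fin d → Fin n, seqWeight g b • ∏ k, (MvPolynomial.X (b k) : MvPolynomial (Fin n) ℂ) =
      weightPoly g n d := by
  have hcard : ∀ e : Fin n →₀ ℕ, ∑ i, e i = d →
      ((Finset.univ.filter fun b : Fin d → Fin n =>
        Finsupp.equivFunOnFinite.symm (seqCount b) = e).card : ℂ) * ∏ i, ((e i).factorial : ℂ) =
      d.factorial := by
    intro e he
    have h1 : (∑ i, MvPolynomial.X i : MvPolynomial (Fin n) ℂ) ^ d =
        ∑ b : Fin d → Fin n, ∏ k, MvPolynomial.X (b k) := Fintype.sum_pow _ _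
    rw [Finset.sum_pow_eq_sum_piAntidiag] at h1
    have h2 := congrArg (MvPolynomial.coeff e) h1
    rw [MvPolynomial.coeff_sum, MvPolynomial.coeff_sum, Finset.sum_eq_single (e : Fin n → ℕ)] at h2
    · have h3 : ∏ i, (MvPolynomial.X i : MvPolynomial (Fin n) ℂ) ^ e i =
          MvPolynomial.monomial e 1 := by
        rw [MvPolynomial.monomial_eq, Finsupp.prod_fintype _ _ (by simp), map_one, one_mul]
      simp_rw [prod_X_seq, MvPolynomial.coeff_monomial] at h2
      rw [h3, ← nsmul_eq_mul, MvPolynomial.coeff_smul, MvPolynomial.coeff_monomial, if_pos rfl,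
        Finset.sum_boole] at h2
      rw [← h2, ← he, ← Nat.multinomial_spec]
      push_cast
      simp [mul_comm]
    · intro f _ hf
      have h3 : ∏ i, (MvPolynomial.X i : MvPolynomial (Fin n) ℂ) ^ f i =
          MvPolynomial.monomial (Finsupp.equivFunOnFinite.symm f) 1 := by
        rw [MvPolynomial.monomial_eq, Finsupp.prod_fintype _ _ (by simp), map_one, one_mul]
        rfl
      rw [h3, ← nsmul_eq_mul, MvPolynomial.coeff_smul, MvPolynomial.coeff_monomial, if_neg,
        smul_zero]
      rintro rfl
      exact hf rfl
    · intro h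
      exact absurd (Finset.mem_piAntidiag.2 ⟨he, fun i _ => Finset.mem_univ i⟩) h
  rw [weightPoly, ← Finset.sum_fiberwise_of_maps_to (t := Finset.finsuppAntidiag Finset.univ d)
    (g := fun b : Fin d → Fin n => Finsupp.equivFunOnFinite.symm (seqCount b))
    (fun b _ => Finset.mem_finsuppAntidiag.2 ⟨sum_seqCount b, Finset.subset_univ _⟩)]
  refine Finset.sum_congr rfl fun e he => ?_
  have he' := (Finset.mem_finsuppAntidiag.1 he).1
  have hb : ∀ b ∈ Finset.univ.filter (fun b : Fin d → Fin n =>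
      Finsupp.equivFunOnFinite.symm (seqCount b) = e),
      seqWeight g b • ∏ k, (MvPolynomial.X (b k) : MvPolynomial (Fin n) ℂ) =
        MvPolynomial.monomial e
          ((∏ i, g (e i)) * ((∏ i, ((e i).factorial : ℂ)) / (d.factorial : ℂ))) := by
    intro b hb
    obtain rfl := (Finset.mem_filter.1 hb).2
    rw [prod_X_seq, MvPolynomial.smul_monomial, smul_eq_mul, mul_one]
    rfl
  rw [Finset.sum_congr rfl hb, Finset.sum_const, ← map_nsmul, nsmul_eq_mul]
  congr 1
  have h0 : (d.factorial : ℂ) ≠ 0 := by exact_mod_cast Nat.factorial_ne_zero d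
  rw [mul_left_comm, ← mul_div_assoc, hcard e he', div_self h0, mul_one]

/-- The transpositions of `Fin n`, as pairs with the smaller element first. -/
abbrev TransPair (n : ℕ) : Type := {x : Fin n × Fin n // x.1 < x.2}

theorem sum_transPair {V : Type*} [AddCommMonoid V] (F : Fin n → Fin n → V) :
    ∑ x : TransPair n, F x.1.1 x.1.2 = ∑ b, ∑ a ∈ Finset.univ.filter (· < b), F a b := by
  rw [← Finset.sum_subtype (Finset.univ.filter fun x : Fin n × Fin n => x.1 < x.2) (by simp)
    (fun x => F x.1 x.2), Finset.sum_filter, Fintype.sum_prod_type, Finset.sum_comm]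
  simp_rw [Finset.sum_filter]

theorem sum_transPair_prod (W : (Fin d → Fin n) → ℂ) :
    ∑ x : Fin d → TransPair n, W (fun k => (x k).1.2) •
        MonoidAlgebra.of ℂ (Equiv.Perm (Fin n))
          (List.ofFn fun k => Equiv.swap (x k).1.1 (x k).1.2).prod =
      ∑ b : Fin d → Fin n, W b • evalJM n (∏ k, MvPolynomial.X (b k)) := by
  induction d with
  | zero =>
    simp only [Finset.univ_unique, Finset.sum_singleton, List.ofFn_zero, List.prod_nil,
      Finset.univ_eq_empty, Finset.prod_empty, map_one]
    exact congrArg (· • 1) (congrArg W (Subsingleton.elim _ _))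
  | succ d ih =>
    rw [← Equiv.sum_comp (Fin.consEquiv fun _ => TransPair n), Fintype.sum_prod_type,
      ← Equiv.sum_comp (Fin.consEquiv fun _ => Fin n), Fintype.sum_prod_type]
    have h : ∀ x : TransPair n, ∑ y : Fin d → TransPair n,
        W (fun k => (Fin.consEquiv (fun _ => TransPair n) (x, y) k).1.2) •
        MonoidAlgebra.of ℂ (Equiv.Perm (Fin n)) (List.ofFn fun k =>
          Equiv.swap (Fin.consEquiv (fun _ => TransPair n) (x, y) k).1.1
            (Fin.consEquiv (fun _ => TransPair n) (x, y) k).1.2).prod =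
        MonoidAlgebra.of ℂ (Equiv.Perm (Fin n)) (Equiv.swap x.1.1 x.1.2) *
          ∑ b : Fin d → Fin n, W (Fin.cons x.1.2 b) • evalJM n (∏ k, MvPolynomial.X (b k)) := by
      intro x
      rw [← ih fun b => W (Fin.cons x.1.2 b), Finset.mul_sum]
      refine Finset.sum_congr rfl fun y _ => ?_
      rw [mul_smul_comm, ← map_mul (MonoidAlgebra.of ℂ _), List.ofFn_succ, List.prod_cons]
      congr 2
      ext k
      refine Fin.cases ?_ (fun k => ?_) k <;> simp [Fin.consEquiv]
    rw [Finset.sum_congr rfl fun x _ => h x, sum_transPair (fun a b' =>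
      MonoidAlgebra.of ℂ (Equiv.Perm (Fin n)) (Equiv.swap a b') *
        ∑ b : Fin d → Fin n, W (Fin.cons b' b) • evalJM n (∏ k, MvPolynomial.X (b k)))]
    refine Finset.sum_congr rfl fun b' _ => ?_
    rw [← Finset.sum_mul, ← jucysMurphy, Finset.mul_sum]
    refine Finset.sum_congr rfl fun b _ => ?_
    rw [Fin.prod_univ_succ, map_mul, mul_smul_comm]
    simp [Fin.consEquiv, evalJM_X]

/-- The weighted sum over sequences of transpositions is a central element. -/
theorem sum_seqWeight_transPair (g : ℕ → ℂ) (n d : ℕ) :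
    ∑ x : Fin d → TransPair n, seqWeight g (fun k => (x k).1.2) •
        MonoidAlgebra.of ℂ (Equiv.Perm (Fin n))
          (List.ofFn fun k => Equiv.swap (x k).1.1 (x k).1.2).prod =
      evalJM n (weightPoly g n d) := by
  rw [sum_transPair_prod, ← sum_seqWeight, map_sum]
  simp_rw [map_smul]

/-- A path consists of a sequence of transpositions and a starting point. -/
def cayleyPathEquiv (n d : ℕ) :
    CayleyPath n d ≃ (Fin d → TransPair n) × Equiv.Perm (Fin n) where
  toFun P := (fun k => ⟨(P.fst k, P.snd k), P.fst_lt_snd k⟩, P.start)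
  invFun x := ⟨x.2, fun k => (x.1 k).1.1, fun k => (x.1 k).1.2, fun k => (x.1 k).2⟩
  left_inv _ := rfl
  right_inv _ := rfl

instance : Fintype (CayleyPath n d) := Fintype.ofEquiv _ (cayleyPathEquiv n d).symm

/-- The cycle type as a partition of `n`. -/
def permPart (h : Equiv.Perm (Fin n)) : n.Partition where
  parts := h.partition.parts
  parts_pos := h.partition.parts_pos
  parts_sum := h.partition.parts_sum.trans (Fintype.card_fin n)

theorem mem_cyc_iff (h : Equiv.Perm (Fin n)) (μ : n.Partition) : h ∈ cyc μ ↔ permPart h = μ :=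
  (Nat.Partition.ext_iff (x := permPart h) (y := μ)).symm

open scoped Classical in
/-- Every path has exactly one signature. -/
theorem sum_hasSignature {q t : ℂ} {c : ℕ → ℂ} (P : CayleyPath n d) :
    ∑ lam : d.Partition, (gPart q t c lam *
      ((lam.parts.map fun i => (i.factorial : ℂ)).prod / (d.factorial : ℂ)) *
        if P.HasSignature lam then 1 else 0) = seqWeight (gOne q t c) P.snd := by
  have hfilter : ∀ (s : Multiset ℕ) (f : ℕ → ℂ), f 0 = 1 →
      ((s.filter fun m => m ≠ 0).map f).prod = (s.map f).prod := by
    intro s f hf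
    induction s using Multiset.induction_on with
    | empty => simp
    | cons a s ih =>
      by_cases ha : a = 0
      · simp [ha, hf, ih]
      · simp [ha, ih]
  have hsum : (Finset.univ.val.map fun b => seqCount P.snd b).sum = d := sum_seqCount P.snd
  rw [Finset.sum_eq_single (Nat.Partition.ofSums d _ hsum)]
  · rw [if_pos, mul_one, gPart, seqWeight]
    · simp only [Nat.Partition.ofSums]
      rw [hfilter _ _ (gOne_zero q t c), hfilter _ _ (by simp), Multiset.map_map, Multiset.map_map]
      rfl
    · rfl
  · intro lam _ hlam
    rw [if_neg, mul_zero]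
    intro h
    exact hlam (Nat.Partition.ext h.symm)
  · simp

open scoped Classical in
theorem hurwitzF_eq (q t : ℂ) (c : ℕ → ℂ) (μ ν : n.Partition) :
    hurwitzF q t c d μ ν = (n.factorial : ℂ)⁻¹ * ∑ P : CayleyPath n d,
      if permPart P.start = ν ∧ permPart P.finish = μ then seqWeight (gOne q t c) P.snd
        else 0 := by
  have h : ∀ lam : d.Partition, (pathCount lam μ ν : ℂ) = ∑ P : CayleyPath n d,
      if permPart P.start = ν ∧ permPart P.finish = μ then
        if P.HasSignature lam then 1 else 0 else 0 := by
    intro lam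
    rw [pathCount, Nat.card_eq_fintype_card, Fintype.card_subtype, ← Finset.sum_boole]
    refine Finset.sum_congr rfl fun P _ => ?_
    simp only [mem_cyc_iff, ← ite_and, and_assoc]
  rw [hurwitzF]
  congr 1
  simp_rw [mCoeff, h, Finset.mul_sum]
  rw [Finset.sum_comm]
  refine Finset.sum_congr rfl fun P _ => ?_
  split_ifs
  · rw [← sum_hasSignature]
    simp_rw [mul_assoc]
  · simp

/-- The generating function of the Hurwitz numbers in terms of the central element
`evalJM (weightPoly g n d)`. -/
theorem sum_hurwitzF {A : Type*} [CommRing A] [Algebra ℂ A] (q t : ℂ) (c : ℕ → ℂ) (n d : ℕ)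
    (u v : ℕ → A) :
    ∑ x : n.Partition × n.Partition, algebraMap ℂ A (hurwitzF q t c d x.1 x.2) *
        powerSumPart u x.1 * powerSumPart v x.2 =
      algebraMap ℂ A (n.factorial : ℂ)⁻¹ * ∑ h : Equiv.Perm (Fin n),
        charMap (powerSum u) (evalJM n (weightPoly (gOne q t c) n d) * MonoidAlgebra.of ℂ _ h) *
          cycProd (powerSum v) h := by
  classical
  have h1 : ∀ x : n.Partition × n.Partition, algebraMap ℂ A (hurwitzF q t c d x.1 x.2) *
        powerSumPart u x.1 * powerSumPart v x.2 = algebraMap ℂ A (n.factorial : ℂ)⁻¹ *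
      ∑ P : CayleyPath n d, if (permPart P.finish, permPart P.start) = x then
        algebraMap ℂ A (seqWeight (gOne q t c) P.snd) *
          (cycProd (powerSum u) P.finish * cycProd (powerSum v) P.start) else 0 := by
    rintro ⟨μ, ν⟩
    rw [hurwitzF_eq, map_mul, map_sum, mul_assoc, mul_assoc, Finset.sum_mul]
    congr 1
    refine Finset.sum_congr rfl fun P _ => ?_
    rcases eq_or_ne (permPart P.finish, permPart P.start) (μ, ν) with h | h
    · obtain ⟨rfl, rfl⟩ := Prod.mk.inj h
      rw [if_pos ⟨rfl, rfl⟩, if_pos rfl]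
      rfl
    · rw [if_neg (fun h' => h (Prod.ext h'.2 h'.1)), if_neg h, map_zero, zero_mul]
  simp_rw [h1]
  rw [← Finset.mul_sum, Finset.sum_comm]
  congr 1
  simp_rw [Finset.sum_ite_eq, Finset.mem_univ, if_true]
  rw [← Equiv.sum_comp (cayleyPathEquiv n d).symm, Fintype.sum_prod_type, Finset.sum_comm]
  refine Finset.sum_congr rfl fun h _ => ?_
  rw [← sum_seqWeight_transPair, Finset.sum_mul, map_sum, Finset.sum_mul]
  refine Finset.sum_congr rfl fun x _ => ?_
  rw [smul_mul_assoc, map_smul, ← map_mul (MonoidAlgebra.of ℂ _), charMap_of, Algebra.smul_def,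
    mul_assoc]
  rfl

end Paths

/-! ### The weighted Cauchy identity -/

section WeightedCauchy

/-- A linear operator on polynomials in `t` extends to polynomials in `t` and `s`. -/
theorem exists_linearMap_rename_inl (T : MvPolynomial ℕ ℂ →ₗ[ℂ] MvPolynomial ℕ ℂ) :
    ∃ T' : MvPolynomial (ℕ ⊕ ℕ) ℂ →ₗ[ℂ] MvPolynomial (ℕ ⊕ ℕ) ℂ, ∀ a b : MvPolynomial ℕ ℂ,
      T' (MvPolynomial.rename Sum.inl a * MvPolynomial.rename Sum.inr b) =
        MvPolynomial.rename Sum.inl (T a) * MvPolynomial.rename Sum.inr b := by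
  refine ⟨(MvPolynomial.basisMonomials (ℕ ⊕ ℕ) ℂ).constr ℂ fun e =>
    MvPolynomial.rename Sum.inl (T (MvPolynomial.monomial
      (Finsupp.sumFinsuppEquivProdFinsupp e).1 1)) *
    MvPolynomial.rename Sum.inr (MvPolynomial.monomial
      (Finsupp.sumFinsuppEquivProdFinsupp e).2 1), fun a b => ?_⟩
  induction a using MvPolynomial.induction_on' with
  | add a a' ha ha' => rw [map_add, add_mul, map_add, ha, ha', map_add, map_add, add_mul]
  | monomial α x =>
    induction b using MvPolynomial.induction_on' with
    | add b b' hb hb' => rw [map_add, mul_add, map_add, hb, hb', mul_add]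
    | monomial β y =>
      have h1 : Finsupp.sumFinsuppEquivProdFinsupp
          (Finsupp.mapDomain Sum.inl α + Finsupp.mapDomain Sum.inr β) = (α, β) := by
        refine Prod.ext (Finsupp.ext fun i => ?_) (Finsupp.ext fun i => ?_)
        · rw [Finsupp.fst_sumFinsuppEquivProdFinsupp, Finsupp.add_apply,
            Finsupp.mapDomain_apply Sum.inl_injective,
            Finsupp.mapDomain_of_notMem_range _ _ (by simp),
            add_zero]
        · rw [Finsupp.snd_sumFinsuppEquivProdFinsupp, Finsupp.add_apply,
            Finsupp.mapDomain_apply Sum.inr_injective,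
            Finsupp.mapDomain_of_notMem_range _ _ (by simp),
            zero_add]
      have h2 : ∀ (γ : ℕ →₀ ℕ) (z : ℂ), (MvPolynomial.monomial γ z : MvPolynomial ℕ ℂ) =
          z • MvPolynomial.monomial γ 1 := fun γ z => by simp [MvPolynomial.smul_monomial]
      have h3 : (MvPolynomial.monomial (Finsupp.mapDomain Sum.inl α + Finsupp.mapDomain Sum.inr β)
          (x * y) : MvPolynomial (ℕ ⊕ ℕ) ℂ) = (x * y) • MvPolynomial.basisMonomials (ℕ ⊕ ℕ) ℂ
            (Finsupp.mapDomain Sum.inl α + Finsupp.mapDomain Sum.inr β) := by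
        simp [MvPolynomial.smul_monomial]
      rw [MvPolynomial.rename_monomial, MvPolynomial.rename_monomial, MvPolynomial.monomial_mul,
        h3, map_smul, Module.Basis.constr_basis, h1, h2 α x, map_smul, map_smul,
        ← MvPolynomial.rename_monomial, h2 β y, map_smul, smul_mul_smul_comm]

theorem cycProd_mul {A : Type*} [CommRing A] {Ω : Type*} [Fintype Ω] [DecidableEq Ω]
    (p p' : ℕ → A) (g : Equiv.Perm Ω) :
    cycProd (fun j => p j * p' j) g = cycProd p g * cycProd p' g :=
  Multiset.prod_map_mul

theorem map_powerSum_rename {σ : Type*} (f : ℕ → σ) :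
    (fun j => MvPolynomial.rename f (powerSum (MvPolynomial.X : ℕ → MvPolynomial ℕ ℂ) j)) =
      powerSum fun k => (MvPolynomial.X (f k) : MvPolynomial σ ℂ) := by
  ext1 j
  simp [powerSum]

theorem rename_charMap {σ : Type*} (f : ℕ → σ) {n : ℕ} (x : PermAlgebra n) :
    MvPolynomial.rename f (polyCharMap n x) =
      charMap (powerSum fun k => (MvPolynomial.X (f k) : MvPolynomial σ ℂ)) x := by
  rw [map_charMap, map_powerSum_rename]

theorem rename_polySchur {σ : Type*} (f : ℕ → σ) {N : ℕ} (m : Fin N → ℕ) :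
    MvPolynomial.rename f (polySchur m) =
      schurVec (fun k => (MvPolynomial.X (f k) : MvPolynomial σ ℂ)) (shiftVec m) := by
  rw [map_schurVec]
  simp

/-- The coefficient of `z ^ d` in the product of `G (k z)` over a multiset of integers `k`. -/
def contentCoeff (G : PowerSeries ℂ) (s : Multiset ℤ) (d : ℕ) : ℂ :=
  PowerSeries.coeff d (s.map fun k : ℤ => PowerSeries.rescale (k : ℂ) G).prod

/-- The central element `evalJM (weightPoly g n d)` is applied to both sides of the Cauchy
identity. -/
theorem weighted_cauchy_identity (q t : ℂ) (c : ℕ → ℂ) (d : ℕ) {N n : ℕ} (hn : n ≤ N + 1) :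
    ∑ m ∈ monoVec (N + 1) n, contentCoeff (PowerSeries.mk (gOne q t c)) (contents m) d •
        (schurVec polyT (shiftVec m) * schurVec polyS (shiftVec m)) =
      ∑ x : n.Partition × n.Partition, hurwitzF q t c d x.1 x.2 •
        (powerSumPart polyT x.1 * powerSumPart polyS x.2) := by
  set F := weightPoly (gOne q t c) n d
  obtain ⟨T, hT⟩ := exists_linearMap_charMap_mul (evalJM n F)
    (evalJM_commute_of_isSymmetric (weightPoly_isSymmetric _ _ _))
  obtain ⟨T', hT'⟩ := exists_linearMap_rename_inl T
  have hTm : ∀ m ∈ monoVec (N + 1) n, T (polySchur m) =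
      contentCoeff (PowerSeries.mk (gOne q t c)) (contents m) d • polySchur m := by
    intro m hm
    obtain ⟨k, x, hk, hx⟩ := exists_content_eigenvector hn hm
    have h1 := hx 1
    rw [map_one, one_mul, map_one, one_smul] at h1
    rw [← h1, hT, hx, h1, eval_weightPoly, contentCoeff, ← hk, Multiset.map_map]
    rfl
  have hcauchy := congrArg T' (cauchy_identity N n hn)
  have hh : hSum (fun j => powerSum polyT j * powerSum polyS j) n =
      algebraMap ℂ _ (n.factorial : ℂ)⁻¹ * ∑ h : Equiv.Perm (Fin n),
        (cycProd (powerSum polyT) h * cycProd (powerSum polyS) h) := by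
    have h := sum_cycProd (Ω := Fin n) (fun j => powerSum polyT j * powerSum polyS j)
    rw [Fintype.card_fin] at h
    simp_rw [cycProd_mul] at h
    rw [h, ← mul_assoc, ← map_natCast (algebraMap ℂ (MvPolynomial (ℕ ⊕ ℕ) ℂ)), ← map_mul,
      inv_mul_cancel₀ (by exact_mod_cast n.factorial_ne_zero), map_one, one_mul]
  have hR := sum_hurwitzF q t c n d polyT polyS
  simp_rw [mul_assoc, ← Algebra.smul_def] at hR
  rw [hR]
  rw [hh, ← Algebra.smul_def, map_smul, map_sum, map_sum] at hcauchy
  convert hcauchy using 1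
  · refine Finset.sum_congr rfl fun m hm => ?_
    rw [← rename_polySchur, ← rename_polySchur, hT', hTm m hm, map_smul, smul_mul_assoc]
  · congr 1
    refine Finset.sum_congr rfl fun h _ => ?_
    rw [← charMap_of, ← charMap_of, ← rename_charMap Sum.inl, ← rename_charMap Sum.inr,
      ← rename_charMap Sum.inl, hT', hT]

end WeightedCauchy

/-! ### Weights -/

section Weights

/-- The grading in which `t_k` has weight `k` and `s_k` has weight `0`. -/
def flowWeight : ℕ ⊕ ℕ → ℕ := Sum.elim (· + 1) 0

theorem isWeightedHomogeneous_multiset_prod {p : ℕ → MvPolynomial (ℕ ⊕ ℕ) ℂ} {a : ℕ}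
    (hp : ∀ j, 0 < j → MvPolynomial.IsWeightedHomogeneous flowWeight (p j) (a * j))
    (s : Multiset ℕ) (hs : ∀ j ∈ s, 0 < j) :
    MvPolynomial.IsWeightedHomogeneous flowWeight (s.map p).prod (a * s.sum) := by
  induction s using Multiset.induction_on with
  | empty => simpa using MvPolynomial.isWeightedHomogeneous_one ℂ flowWeight
  | cons j s ih =>
    rw [Multiset.map_cons, Multiset.prod_cons, Multiset.sum_cons, mul_add]
    exact (hp j (hs j (Multiset.mem_cons_self j s))).mul
      (ih fun i hi => hs i (Multiset.mem_cons_of_mem hi))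

theorem isWeightedHomogeneous_charMap {p : ℕ → MvPolynomial (ℕ ⊕ ℕ) ℂ} {a : ℕ}
    (hp : ∀ j, 0 < j → MvPolynomial.IsWeightedHomogeneous flowWeight (p j) (a * j)) {n : ℕ}
    (x : PermAlgebra n) :
    MvPolynomial.IsWeightedHomogeneous flowWeight (charMap p x) (a * n) := by
  rw [← MvPolynomial.mem_weightedHomogeneousSubmodule]
  induction x using MonoidAlgebra.induction_linear with
  | zero => rw [map_zero]; exact Submodule.zero_mem _
  | add x y hx hy => rw [map_add]; exact Submodule.add_mem _ hx hy
  | single g b =>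
    rw [charMap_single]
    refine Submodule.smul_mem _ _ ?_
    rw [MvPolynomial.mem_weightedHomogeneousSubmodule]
    have h := isWeightedHomogeneous_multiset_prod hp g.partition.parts
      fun j hj => g.partition.parts_pos hj
    rwa [g.partition.parts_sum.trans (Fintype.card_fin n)] at h

theorem isWeightedHomogeneous_powerSum_polyT (j : ℕ) (hj : 0 < j) :
    MvPolynomial.IsWeightedHomogeneous flowWeight (powerSum polyT j) (1 * j) := by
  have h := (MvPolynomial.isWeightedHomogeneous_C flowWeight (j : ℂ)).mul
    (MvPolynomial.isWeightedHomogeneous_X ℂ flowWeight (Sum.inl (j - 1)))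
  have hw : flowWeight (Sum.inl (j - 1)) = 1 * j := by simp [flowWeight]; omega
  rwa [zero_add, map_natCast, hw] at h

theorem isWeightedHomogeneous_powerSum_polyS (j : ℕ) (_hj : 0 < j) :
    MvPolynomial.IsWeightedHomogeneous flowWeight (powerSum polyS j) (0 * j) := by
  have h := (MvPolynomial.isWeightedHomogeneous_C flowWeight (j : ℂ)).mul
    (MvPolynomial.isWeightedHomogeneous_X ℂ flowWeight (Sum.inr (j - 1)))
  have hw : flowWeight (Sum.inr (j - 1)) = 0 * j := by simp [flowWeight]
  rwa [zero_add, map_natCast, hw] at h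

theorem isWeightedHomogeneous_powerSumPart {n : ℕ} (μ ν : n.Partition) :
    MvPolynomial.IsWeightedHomogeneous flowWeight
      (powerSumPart polyT μ * powerSumPart polyS ν) n := by
  have h := (isWeightedHomogeneous_multiset_prod isWeightedHomogeneous_powerSum_polyT μ.parts
    fun j hj => μ.parts_pos hj).mul (isWeightedHomogeneous_multiset_prod
      isWeightedHomogeneous_powerSum_polyS ν.parts fun j hj => ν.parts_pos hj)
  rwa [μ.parts_sum, one_mul, zero_mul, add_zero] at h

/-- Homogeneity is read off from the presentation of the Schur function as an image under the
characteristic map. -/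
theorem isWeightedHomogeneous_schurVec {N n : ℕ} (hn : n ≤ N + 1) {m : Fin (N + 1) → ℕ}
    (hm : m ∈ monoVec (N + 1) n) :
    MvPolynomial.IsWeightedHomogeneous flowWeight
      (schurVec polyT (shiftVec m) * schurVec polyS (shiftVec m)) n := by
  obtain ⟨_, x, _, hx⟩ := exists_content_eigenvector hn hm
  have h1 := hx 1
  rw [map_one, one_mul, map_one, one_smul] at h1
  rw [← rename_polySchur, ← rename_polySchur, ← h1, rename_charMap, rename_charMap]
  have h := (isWeightedHomogeneous_charMap isWeightedHomogeneous_powerSum_polyT x).mul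
    (isWeightedHomogeneous_charMap isWeightedHomogeneous_powerSum_polyS x)
  rwa [one_mul, zero_mul, add_zero] at h

end Weights

/-! ### Young diagrams as vectors -/

section Diagrams

/-- The lengths of the first `N + 1` rows in increasing order. -/
def rowVec (N : ℕ) (lam : YoungDiagram) (i : Fin (N + 1)) : ℕ := lam.rowLen (N - i)

theorem rowVec_monotone (N : ℕ) (lam : YoungDiagram) : Monotone (rowVec N lam) := fun _ _ hij =>
  lam.rowLen_anti _ _ (Nat.sub_le_sub_left hij N)

theorem rowLen_eq_zero {lam : YoungDiagram} {i : ℕ} (hi : lam.colLen 0 ≤ i) :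
    lam.rowLen i = 0 := by
  by_contra h
  have h' := YoungDiagram.mem_iff_lt_rowLen.2 (Nat.pos_of_ne_zero h)
  exact absurd (YoungDiagram.mem_iff_lt_colLen.1 h') (by omega)

@[to_additive]
theorem prod_cells {M : Type*} [CommMonoid M] {N : ℕ} {lam : YoungDiagram}
    (hN : lam.colLen 0 ≤ N + 1) (f : ℕ × ℕ → M) :
    ∏ x ∈ lam.cells, f x =
      ∏ i : Fin (N + 1), ∏ j ∈ Finset.range (rowVec N lam i), f (N - i, j) := by
  have h : ∀ x ∈ lam.cells, x.1 ∈ Finset.range (N + 1) := fun x hx => by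
    have h1 : (x.1, 0) ∈ lam := lam.isLowerSet (show (x.1, 0) ≤ x from ⟨le_rfl, Nat.zero_le _⟩)
      (YoungDiagram.mem_cells x |>.1 hx)
    have := YoungDiagram.mem_iff_lt_colLen.1 h1
    exact Finset.mem_range.2 (by omega)
  rw [← Finset.prod_fiberwise_of_maps_to h, Finset.prod_range, ← Equiv.prod_comp Fin.revPerm]
  refine Finset.prod_congr rfl fun i _ => ?_
  have hi : ((Fin.revPerm i : Fin (N + 1)) : ℕ) = N - i := by simp [Fin.val_rev]
  rw [hi]
  change ∏ x ∈ lam.row (N - i), f x = _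
  rw [YoungDiagram.row_eq_prod, Finset.prod_product, Finset.prod_singleton, rowVec]

theorem sum_rowVec {N : ℕ} {lam : YoungDiagram} (hN : lam.colLen 0 ≤ N + 1) :
    ∑ i, rowVec N lam i = lam.card := by
  rw [YoungDiagram.card, Finset.card_eq_sum_ones, sum_cells hN]
  simp

theorem prod_cells_content {M : Type*} [CommMonoid M] {N : ℕ} {lam : YoungDiagram}
    (hN : lam.colLen 0 ≤ N + 1) (f : ℤ → M) :
    ∏ x ∈ lam.cells, f ((x.2 : ℤ) - x.1) = ((contents (rowVec N lam)).map f).prod := by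
  rw [prod_cells hN (fun x => f ((x.2 : ℤ) - x.1)), contents, ← Multiset.coe_mapAddMonoidHom,
    map_sum, Multiset.prod_sum]
  refine Finset.prod_congr rfl fun i _ => ?_
  rw [Multiset.coe_mapAddMonoidHom, Multiset.map_map, Finset.prod_eq_multiset_prod]
  refine congrArg _ (Multiset.map_congr rfl fun j _ => ?_)
  simp only [Function.comp_apply]
  congr 1
  have : (i : ℕ) ≤ N := Nat.lt_succ_iff.1 i.2
  push_cast [Nat.cast_sub this]
  ring

theorem schur_eq_schurVec {A : Type*} [CommRing A] [Algebra ℂ A] (u : ℕ → A) {N : ℕ}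
    {lam : YoungDiagram} (hN : lam.colLen 0 ≤ N + 1) :
    schur u lam = schurVec u (shiftVec (rowVec N lam)) := by
  -- empty rows may be added to the determinant
  have h1 : ∀ k L, L = lam.colLen 0 + k → schur u lam = Matrix.det (Matrix.of fun i j : Fin L =>
      complete u ((lam.rowLen i : ℤ) - (i : ℤ) + (j : ℤ))) := by
    intro k
    induction k with
    | zero => rintro _ rfl; rfl
    | succ k ih =>
      intro L hL
      obtain rfl : L = lam.colLen 0 + k + 1 := hL
      rw [ih _ rfl]
      symm
      rw [Matrix.det_succ_row _ (Fin.last _), Finset.sum_eq_single (Fin.last _)]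
      · have h0 : ((-1 : A)) ^ (lam.colLen 0 + k + (lam.colLen 0 + k)) = 1 :=
          Even.neg_one_pow ⟨_, rfl⟩
        rw [Fin.val_last, h0, one_mul, Matrix.of_apply, Fin.val_last,
          rowLen_eq_zero (Nat.le_add_right _ k)]
        simp only [Nat.cast_zero, zero_sub, neg_add_cancel, complete_zero, one_mul]
        congr 1
        ext i j
        simp
      · intro j _ hj
        have hlt : (j : ℕ) < lam.colLen 0 + k := Fin.val_lt_last hj
        rw [Matrix.of_apply, Fin.val_last, rowLen_eq_zero (Nat.le_add_right _ k),
          complete_of_neg u (by push_cast; omega), mul_zero, zero_mul]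
      · simp
  obtain ⟨k, hk⟩ := Nat.exists_eq_add_of_le hN
  rw [h1 k _ hk, schurVec, ← Matrix.det_submatrix_equiv_self Fin.revPerm]
  congr 1
  ext i j
  simp only [Matrix.submatrix_apply, Matrix.of_apply, shiftVec, rowVec, Fin.revPerm_apply,
    Fin.val_rev]
  have hi : (i : ℕ) ≤ N := Nat.lt_succ_iff.1 i.2
  have hj : (j : ℕ) ≤ N := Nat.lt_succ_iff.1 j.2
  rw [show N + 1 - ((i : ℕ) + 1) = N - i by omega, show N + 1 - ((j : ℕ) + 1) = N - j by omega]
  congr 1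
  push_cast [Nat.cast_sub hi, Nat.cast_sub hj]
  ring

theorem colLen_le_card (lam : YoungDiagram) : lam.colLen 0 ≤ lam.card := by
  rw [YoungDiagram.colLen_eq_card]
  exact Finset.card_le_card (Finset.filter_subset _ _)

theorem rowVec_injOn (N : ℕ) : Set.InjOn (rowVec N) {lam | lam.colLen 0 ≤ N + 1} := by
  intro lam h1 mu h2 h
  refine SetLike.ext fun x => ?_
  obtain ⟨i, j⟩ := x
  rw [YoungDiagram.mem_iff_lt_rowLen, YoungDiagram.mem_iff_lt_rowLen]
  rcases Nat.lt_or_ge i (N + 1) with hi | hi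
  · have h3 := congrFun h ⟨N - i, by omega⟩
    simp only [rowVec, show N - (N - i) = i by omega] at h3
    rw [h3]
  · rw [rowLen_eq_zero (h1.trans hi), rowLen_eq_zero (h2.trans hi)]

theorem exists_rowVec_eq {N : ℕ} {m : Fin (N + 1) → ℕ} (hm : Monotone m) :
    ∃ lam : YoungDiagram, lam.colLen 0 ≤ N + 1 ∧ rowVec N lam = m := by
  classical
  let cells : Finset (ℕ × ℕ) :=
    Finset.univ.biUnion fun i : Fin (N + 1) => {N - (i : ℕ)} ×ˢ Finset.range (m i)
  have hcells : ∀ x, x ∈ cells ↔ ∃ i : Fin (N + 1), x.1 = N - i ∧ x.2 < m i := by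
    intro x
    simp only [cells, Finset.mem_biUnion, Finset.mem_univ, true_and, Finset.mem_product,
      Finset.mem_singleton, Finset.mem_range]
  let lam : YoungDiagram := ⟨cells, by
    rintro x y hxy hx
    obtain ⟨i, hi, hlt⟩ := (hcells x).1 hx
    refine (hcells y).2 ⟨⟨N - y.1, by omega⟩, ?_, hxy.2.trans_lt (hlt.trans_le (hm ?_))⟩
    · have := hxy.1
      simp only
      omega
    · have := hxy.1
      have := i.2
      rw [Fin.le_def]
      simp only
      omega⟩
  have hmem : ∀ x, x ∈ lam ↔ ∃ i : Fin (N + 1), x.1 = N - i ∧ x.2 < m i := hcells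
  refine ⟨lam, ?_, ?_⟩
  · by_contra! h
    obtain ⟨i, hi, -⟩ := (hmem _).1 (YoungDiagram.mem_iff_lt_colLen.2 h)
    simp only at hi
    omega
  · ext i
    refine eq_of_forall_lt_iff fun j => ?_
    rw [rowVec, ← YoungDiagram.mem_iff_lt_rowLen, hmem]
    constructor
    · rintro ⟨k, hk, hlt⟩
      have : k = i := Fin.ext (by have := k.2; have := i.2; simp only at hk; omega)
      rwa [← this]
    · exact fun h => ⟨i, rfl, h⟩

/-- The Young diagrams with `n` boxes. -/
theorem finite_card_eq (n : ℕ) : {lam : YoungDiagram | lam.card = n}.Finite :=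
  Set.Finite.of_injOn (f := rowVec n) (t := monoVec (n + 1) n)
    (fun lam hlam => Finset.mem_coe.2 (mem_monoVec.2 ⟨by
      rw [sum_rowVec]
      · exact hlam
      · exact (colLen_le_card lam).trans (by rw [show lam.card = n from hlam]; omega),
      rowVec_monotone n lam⟩))
    ((rowVec_injOn n).mono fun lam hlam => (colLen_le_card lam).trans (by
      rw [show lam.card = n from hlam]; omega))
    (Finset.finite_toSet _)

theorem sum_youngDiagram {M : Type*} [AddCommMonoid M] (n : ℕ) (f : YoungDiagram → M)
    (g : (Fin (n + 1) → ℕ) → M)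
    (h : ∀ lam : YoungDiagram, lam.card = n → f lam = g (rowVec n lam)) :
    ∑ lam ∈ (finite_card_eq n).toFinset, f lam = ∑ m ∈ monoVec (n + 1) n, g m := by
  have hle : ∀ lam ∈ (finite_card_eq n).toFinset, lam.colLen 0 ≤ n + 1 := fun lam hlam => by
    have h1 : lam.card = n := by simpa using hlam
    have := colLen_le_card lam
    omega
  refine Finset.sum_nbij (rowVec n) (fun lam hlam => ?_) (fun lam hlam mu hmu => ?_)
    (fun m hm => ?_) fun lam hlam => h lam (by simpa using hlam)
  · have h1 : lam.card = n := by simpa using hlam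
    exact mem_monoVec.2 ⟨by rw [sum_rowVec (hle lam hlam), h1], rowVec_monotone n lam⟩
  · exact rowVec_injOn n (hle lam hlam) (hle mu hmu)
  · obtain ⟨h1, h2⟩ := mem_monoVec.1 (Finset.mem_coe.1 hm)
    obtain ⟨lam, hlam, rfl⟩ := exists_rowVec_eq h2
    refine ⟨lam, ?_, rfl⟩
    rw [sum_rowVec hlam] at h1
    simpa using h1

end Diagrams

/-! ### Coefficients of the `τ`-function -/

section Coefficients

/-- The substitution of the flow variables into polynomials. -/
def toToda : MvPolynomial (ℕ ⊕ ℕ) ℂ →ₐ[ℂ] TodaSeries := MvPolynomial.aeval (Sum.elim tVar sVar)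

theorem toToda_polyT : (fun k => toToda (polyT k)) = tVar := by
  ext1 k; simp [toToda]

theorem toToda_polyS : (fun k => toToda (polyS k)) = sVar := by
  ext1 k; simp [toToda]

theorem coeff_toToda (f : MvPolynomial (ℕ ⊕ ℕ) ℂ) (e : ℕ ⊕ ℕ →₀ ℕ) :
    MvPowerSeries.coeff e (toToda f) = PowerSeries.C (f.coeff e) := by
  have h : toToda = MvPolynomial.coeToMvPowerSeries.algHom ℂ⟦X⟧ :=
    MvPolynomial.algHom_ext fun i => by
      rcases i with i | i <;> simp [toToda, tVar, sVar]
  rw [h, MvPolynomial.coeToMvPowerSeries.algHom_apply, MvPowerSeries.coeff_map,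
    MvPolynomial.coeff_coe]
  rfl

theorem coeff_tauTerm {q : ℂ} (hq : ‖q‖ < 1) (t : ℂ) {c : ℕ → ℂ} (hc : Summable c)
    {N : ℕ} {lam : YoungDiagram} (hN : lam.colLen 0 ≤ N + 1) (e : ℕ ⊕ ℕ →₀ ℕ) (d : ℕ) :
    PowerSeries.coeff d (MvPowerSeries.coeff e (tauTerm q t c lam)) =
      contentCoeff (PowerSeries.mk (gOne q t c)) (contents (rowVec N lam)) d *
        (schurVec polyT (shiftVec (rowVec N lam)) *
          schurVec polyS (shiftVec (rowVec N lam))).coeff e := by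
  have h : schur tVar lam * schur sVar lam = toToda (schurVec polyT (shiftVec (rowVec N lam)) *
      schurVec polyS (shiftVec (rowVec N lam))) := by
    rw [schur_eq_schurVec _ hN, schur_eq_schurVec _ hN, map_mul, map_schurVec, map_schurVec,
      toToda_polyT, toToda_polyS]
  rw [tauTerm, mul_assoc, h, MvPowerSeries.coeff_C_mul, coeff_toToda, PowerSeries.coeff_mul_C,
    contentCoeff, ← prod_cells_content hN, contentProduct, weightSeries_eq hq t hc]
  congr 3
  ext x
  push_cast
  rfl

theorem coeff_hurwitzTerm (q t : ℂ) (c : ℕ → ℂ) (d : ℕ) {n : ℕ} (μ ν : n.Partition)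
    (e : ℕ ⊕ ℕ →₀ ℕ) (k : ℕ) :
    PowerSeries.coeff k (MvPowerSeries.coeff e (hurwitzTerm q t c d μ ν)) =
      if k = d then hurwitzF q t c d μ ν *
        (powerSumPart polyT μ * powerSumPart polyS ν).coeff e else 0 := by
  have h : powerSumPart tVar μ * powerSumPart sVar ν =
      toToda (powerSumPart polyT μ * powerSumPart polyS ν) := by
    have hp : ∀ u : ℕ → MvPolynomial (ℕ ⊕ ℕ) ℂ, toToda (powerSumPart u μ) =
        powerSumPart (fun k => toToda (u k)) μ := fun u => by
      simp [powerSumPart, powerSum, map_multiset_prod, Multiset.map_map]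
    have hp' : ∀ u : ℕ → MvPolynomial (ℕ ⊕ ℕ) ℂ, toToda (powerSumPart u ν) =
        powerSumPart (fun k => toToda (u k)) ν := fun u => by
      simp [powerSumPart, powerSum, map_multiset_prod, Multiset.map_map]
    rw [map_mul, hp, hp', toToda_polyT, toToda_polyS]
  rw [hurwitzTerm, mul_assoc, h, MvPowerSeries.coeff_C_mul, coeff_toToda, PowerSeries.coeff_mul_C,
    PowerSeries.coeff_C_mul, PowerSeries.coeff_X_pow]
  split_ifs <;> simp

/-- The coefficients of the `τ`-function. -/
def tauCoeff (q t : ℂ) (c : ℕ → ℂ) : TodaSeries := fun e => PowerSeries.mk fun d =>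
  ∑ x : (Finsupp.weight flowWeight e).Partition × (Finsupp.weight flowWeight e).Partition,
    hurwitzF q t c d x.1 x.2 * (powerSumPart polyT x.1 * powerSumPart polyS x.2).coeff e

theorem coeff_tauCoeff (q t : ℂ) (c : ℕ → ℂ) (e : ℕ ⊕ ℕ →₀ ℕ) (d : ℕ) :
    PowerSeries.coeff d (MvPowerSeries.coeff e (tauCoeff q t c)) =
      ∑ x : (Finsupp.weight flowWeight e).Partition × (Finsupp.weight flowWeight e).Partition,
        hurwitzF q t c d x.1 x.2 * (powerSumPart polyT x.1 * powerSumPart polyS x.2).coeff e :=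
  PowerSeries.coeff_mk d fun d =>
    ∑ x : (Finsupp.weight flowWeight e).Partition × (Finsupp.weight flowWeight e).Partition,
      hurwitzF q t c d x.1 x.2 * (powerSumPart polyT x.1 * powerSumPart polyS x.2).coeff e

theorem hasSum_tauTerm {q : ℂ} (hq : ‖q‖ < 1) (t : ℂ) {c : ℕ → ℂ} (hc : Summable c) :
    HasSum (tauTerm q t c) (tauCoeff q t c) := by
  rw [MvPowerSeries.WithPiTopology.hasSum_iff_hasSum_coeff]
  intro e
  rw [PowerSeries.WithPiTopology.hasSum_iff_hasSum_coeff]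
  intro d
  set n := Finsupp.weight flowWeight e with hn
  have h : PowerSeries.coeff d (MvPowerSeries.coeff e (tauCoeff q t c)) =
      ∑ lam ∈ (finite_card_eq n).toFinset,
        PowerSeries.coeff d (MvPowerSeries.coeff e (tauTerm q t c lam)) := by
    rw [sum_youngDiagram n _ (fun m => contentCoeff (PowerSeries.mk (gOne q t c)) (contents m) d *
      (schurVec polyT (shiftVec m) * schurVec polyS (shiftVec m)).coeff e) fun lam hlam =>
      coeff_tauTerm (N := n) hq t hc ((colLen_le_card lam).trans (by omega)) e d]
    have hw := congrArg (MvPolynomial.coeff e)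
      (weighted_cauchy_identity q t c d (Nat.le_succ n))
    simp only [MvPolynomial.coeff_sum, MvPolynomial.coeff_smul, smul_eq_mul] at hw
    rw [hw]
    exact coeff_tauCoeff q t c e d
  rw [h]
  refine hasSum_sum_of_ne_finset_zero fun lam hlam => ?_
  have hne : lam.card ≠ n := by simpa using hlam
  have hN : lam.colLen 0 ≤ lam.card + 1 := (colLen_le_card lam).trans (Nat.le_succ _)
  rw [coeff_tauTerm hq t hc hN, (isWeightedHomogeneous_schurVec (Nat.le_succ _)
    (mem_monoVec.2 ⟨sum_rowVec hN, rowVec_monotone _ lam⟩)).coeff_eq_zero e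
      (by rw [← hn]; exact hne.symm), mul_zero]

theorem hasSum_hurwitzTerm (q t : ℂ) (c : ℕ → ℂ) :
    HasSum (fun x : ℕ × (Σ n : ℕ, n.Partition × n.Partition) =>
      hurwitzTerm q t c x.1 x.2.2.1 x.2.2.2) (tauCoeff q t c) := by
  rw [MvPowerSeries.WithPiTopology.hasSum_iff_hasSum_coeff]
  intro e
  rw [PowerSeries.WithPiTopology.hasSum_iff_hasSum_coeff]
  intro d
  set n := Finsupp.weight flowWeight e with hn
  have h : PowerSeries.coeff d (MvPowerSeries.coeff e (tauCoeff q t c)) =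
      ∑ x ∈ ({d} : Finset ℕ) ×ˢ ({n} : Finset ℕ).sigma
        (fun n => (Finset.univ : Finset (n.Partition × n.Partition))),
        PowerSeries.coeff d
          (MvPowerSeries.coeff e (hurwitzTerm q t c x.1 x.2.2.1 x.2.2.2)) := by
    rw [Finset.sum_product, Finset.sum_singleton, Finset.sum_sigma, Finset.sum_singleton]
    simp_rw [coeff_hurwitzTerm, if_true]
    exact coeff_tauCoeff q t c e d
  rw [h]
  refine hasSum_sum_of_ne_finset_zero fun x hx => ?_
  obtain ⟨k, n', μ, ν⟩ := x
  rw [coeff_hurwitzTerm]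
  split_ifs with hk
  · have hne : n ≠ n' := by
      rintro rfl
      exact hx (by simp [hk])
    rw [(isWeightedHomogeneous_powerSumPart μ ν).coeff_eq_zero e hne, mul_zero]
  · rfl

end Coefficients

end QuantumHurwitz

end

theorem mainTheorem1 (q t : ℂ) (hq : ‖q‖ < 1) (c : ℕ → ℂ) (hc : Summable c) :
    -- the infinite products and the sum that define `M(q, t, c, z)` and `τ` converge
    (∀ a : ℂ, Multipliable fun k : ℕ =>
      (1 - PowerSeries.C (a * q ^ k) * PowerSeries.X : PowerSeries ℂ)) ∧
    (Multipliable fun i : ℕ => QuantumHurwitz.quantumFactor q t (c i)) ∧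
    Summable (QuantumHurwitz.tauTerm q t c) ∧
    -- the generating function of the `g_j(c, q, t)` is `M(q, t, c, z)`
    QuantumHurwitz.weightSeries q t c = PowerSeries.mk (QuantumHurwitz.gOne q t c) ∧
    -- the expansion of `τ` in products of power sums
    HasSum (fun x : ℕ × (Σ n : ℕ, n.Partition × n.Partition) =>
        QuantumHurwitz.hurwitzTerm q t c x.1 x.2.2.1 x.2.2.2)
      (QuantumHurwitz.tau q t c) := by
  have htau := QuantumHurwitz.hasSum_tauTerm hq t hc
  refine ⟨fun a => (QuantumHurwitz.hasProd_qPochhammer hq a).multipliable,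
    (QuantumHurwitz.hasProd_quantumFactor hq t hc).multipliable, htau.summable,
    QuantumHurwitz.weightSeries_eq hq t hc, ?_⟩
  rw [QuantumHurwitz.tau, htau.tsum_eq]
  exact QuantumHurwitz.hasSum_hurwitzTerm q t c
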